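/- Let $\mathbb D=\{|z|<1\}$. Let $\psi$ be analytic and univalent in $\mathbb D$ with $\operatorname{Re}\psi>0$, $\psi(0)=1$, $\psi'(0)>0$ and $\psi(\mathbb D)$ symmetric about the real axis. Let $\mathcal C(\psi)$ be the class of analytic functions $f(z)=z+\sum_{m\ge2}a_mz^m$ in $\mathbb D$ with $1+zf''(z)/f'(z)\prec\psi(z)$. Here $F\prec G$ means $F=G\circ w$ for some analytic $w:\mathbb D\to\mathbb D$ with $w(0)=0$, both for analytic and for harmonic $F,G$. Then there is a unique analytic function $f_0(z)=z+\sum_{m\ge 2}t_mz^m$ in $\mathbb D$ with $1+zf_0''(z)/f_0'(z)=\psi(z)$; the limit $f_0(-1):=\lim_{t\to1^-}f_0(-t)$ exists and is a negative real number. Put $\hat f_0(r)=r+\sum_{m\ge2}|t_m|r^m$. Let $K\ge1$ and $k=(K-1)/(K+1)$. The equation $$\frac{2K}{K+1}\,\hat f_0(r)=-f_0(-1)$$ has a unique root $r_0$ in $(0,1)$. Let $h=f+\overline g$ be a sense-preserving $K$-quasiconformal harmonic mapping of $\mathbb D$, that is, $f,g$ are analytic in $\mathbb D$, $g(0)=0$,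 $h$ is a homeomorphism onto its image, $|f'|^2-|g'|^2>0$ and $|g'/f'|\le k$ in $\mathbb D$; and suppose $f\in\mathcal C(\psi)$. Let $h_1=f_1+\overline{g_1}\prec h$ with $f_1(z)=\sum_{m\ge1}c_mz^m$ and $g_1(z)=\sum_{m\ge1}d_mz^m$ analytic in $\mathbb D$. Then $$\sum_{m=1}^\infty(|c_m|+|d_m|)\,r^m\le d\big(f(0),\partial f(\mathbb D)\big)\qquad\text{for } 0\le r\le r^*=\min\{r_0,1/3\}.$$ The result is sharp when $r^*=r_0$ and all $t_m$ are real and nonnegative (that is, $\hat f_0=f_0$): in that case $f_0\in\mathcal C(\psi)$, $p=f_0+k\overline{f_0}$ is a sense-preserving $K$-quasiconformal harmonic mapping, and for $h_1=h=p$ equality holds in the inequality at $r=r_0$, while the inequality fails for every $r\in(r_0,1)$. -/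

import Mathlib

open Filter Topology Metric Set

/-- The open unit disk. -/
def unitDisk : Set ℂ := ball 0 1

/-- A Schwarz function: holomorphic self-map of the unit disk fixing the origin. -/
structure IsSchwarzFun (w : ℂ → ℂ) : Prop where
  holo : DifferentiableOn ℂ w unitDisk
  mapsTo : MapsTo w unitDisk unitDisk
  zero : w 0 = 0

/-- Subordination `F ≺ G` on the unit disk (for holomorphic or harmonic functions):
`F = G ∘ w` for a Schwarz function `w`. -/
def Subordinate (F G : ℂ → ℂ) : Prop :=
  ∃ w : ℂ → ℂ, IsSchwarzFun w ∧ ∀ z ∈ unitDisk, F z = G (w z)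

/-- The functions `ψ` admitted in the Ma-Minda classes. -/
structure IsMaMinda (ψ : ℂ → ℂ) : Prop where
  holo : DifferentiableOn ℂ ψ unitDisk
  univalent : InjOn ψ unitDisk
  re_pos : ∀ z ∈ unitDisk, 0 < (ψ z).re
  at_zero : ψ 0 = 1
  deriv_re_pos : 0 < (deriv ψ 0).re
  deriv_im : (deriv ψ 0).im = 0
  symm : ∀ v ∈ ψ '' unitDisk, (starRingEnd ℂ) v ∈ ψ '' unitDisk

/-- The class `𝒜`: holomorphic in the unit disk with `f(z) = z + a₂z² + ⋯`. -/
structure IsNormalized (f : ℂ → ℂ) : Prop where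
  holo : DifferentiableOn ℂ f unitDisk
  zero : f 0 = 0
  deriv_zero : deriv f 0 = 1

/-- The expression `1 + z f''(z) / f'(z)`. -/
noncomputable def convexQuotient (f : ℂ → ℂ) (z : ℂ) : ℂ :=
  1 + z * deriv (deriv f) z / deriv f z

/-- The Ma-Minda class `𝒞(ψ)`. The condition `f' ≠ 0` says that `1 + z f''/f'` is
meaningful (holomorphic) throughout the disk. -/
structure IsMaMindaConvex (ψ f : ℂ → ℂ) : Prop where
  normalized : IsNormalized f
  deriv_ne : ∀ z ∈ unitDisk, deriv f z ≠ 0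
  subord : Subordinate (convexQuotient f) ψ

/-- `f₀ ∈ 𝒜` solves `1 + z f₀''(z) / f₀'(z) = ψ(z)` in the unit disk. -/
structure IsConvexExtremal (ψ f₀ : ℂ → ℂ) : Prop where
  normalized : IsNormalized f₀
  deriv_ne : ∀ z ∈ unitDisk, deriv f₀ z ≠ 0
  eqn : ∀ z ∈ unitDisk, convexQuotient f₀ z = ψ z

/-- The harmonic function `f + conj g`. -/
noncomputable def harmonicMap (f g : ℂ → ℂ) (z : ℂ) : ℂ :=
  f z + (starRingEnd ℂ) (g z)

/-- `h = f + conj g`, with `f`, `g` holomorphic in the unit disk and `g(0) = 0`, is a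
sense-preserving `K`-quasiconformal harmonic mapping of the unit disk: a homeomorphism onto its
image with positive Jacobian and `|g'/f'| ≤ (K-1)/(K+1)`. -/
structure IsQuasiconformalHarmonic (K : ℝ) (f g : ℂ → ℂ) : Prop where
  holo_f : DifferentiableOn ℂ f unitDisk
  holo_g : DifferentiableOn ℂ g unitDisk
  g_zero : g 0 = 0
  homeo : IsEmbedding (unitDisk.domRestrict (harmonicMap f g))
  jacobian_pos : ∀ z ∈ unitDisk, 0 < ‖deriv f z‖ ^ 2 - ‖deriv g z‖ ^ 2
  dilatation_le : ∀ z ∈ unitDisk, ‖deriv g z / deriv f z‖ ≤ (K - 1) / (K + 1)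

/-- The `n`-th Taylor coefficient of `f` at the origin. -/
noncomputable def taylorCoeff (f : ℂ → ℂ) (n : ℕ) : ℂ :=
  iteratedDeriv n f 0 / (n.factorial : ℂ)

/-- The majorant `f̂(r) = ∑ |aₙ| rⁿ` of `f(z) = ∑ aₙ zⁿ`. -/
noncomputable def majorant (f : ℂ → ℂ) (r : ℝ) : ℝ :=
  ∑' n : ℕ, ‖taylorCoeff f n‖ * r ^ n

/-- The term `(|c_m| + |d_m|) r^m`, for `f = ∑ c_m z^m`, `g = ∑ d_m z^m`. -/
noncomputable def bohrTerm (f g : ℂ → ℂ) (r : ℝ) (m : ℕ) : ℝ :=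
  (‖taylorCoeff f m‖ + ‖taylorCoeff g m‖) * r ^ m

/-- The sum `∑_{m ≥ 1} (|c_m| + |d_m|) r^m`. -/
noncomputable def bohrSum (f g : ℂ → ℂ) (r : ℝ) : ℝ :=
  ∑' m : ℕ, bohrTerm f g r (m + 1)

/-- The distance from `f(0)` to the boundary of `f(𝔻)`. -/
noncomputable def boundaryDist (f : ℂ → ℂ) : ℝ :=
  infDist (f 0) (frontier (f '' unitDisk))

/-! Write f̂(s) for `majorant f s`, the sum of |a_n| s^n; it is a submultiplicative norm, and the
Bohr sum of h₁ is f̂₁(r) + ĝ₁(r). Separating analytic and co-analytic parts, h₁ = h ∘ w gives f₁ = f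
∘ w and g₁ = g ∘ w with the same Schwarz function w. For r ≤ 1/3, Bohr's theorem for bounded
functions yields ŵ(r) ≤ r, hence f̂₁ ≤ f̂ and ĝ₁ ≤ ĝ (`majorant_comp_le`); applied to g'/f' and
integrated, it yields ĝ ≤ k f̂ (`majorant_le_of_dilatation`). So the sum is at most (1 + k) f̂(r),
where 1 + k = 2K/(K+1). Two facts remain, with L = -f₀(-1): f̂ ≤ f̂₀ on [0, 1/3], and d(f(0), ∂f(𝔻))
≥ L. As f̂₀ increases, the equation for r₀ then closes the chain.

Comparison (`majorant_le_majorant`). Put φ = ψ - 1, G = f₀', H = f', so that zG' = φG and zH' = (φ ∘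
w)H, where now w is the Schwarz function of f. Write w = zω and c = |ω(0)|. The quotient E = H /
G(ω(0)z) satisfies zE' = (φ(w) - φ(ω(0)z))E. Since ψ is typically real with positive real part, the
n-th coefficient of φ is at most np with p = ψ'(0) ≤ 2, and the later coefficients of ω are at most
2(1 - c). A Grönwall argument gives Ê ≤ exp(2(1 - c)pJ), with J of order s². This loss is weighed
against the first-order gain (1 - c)ps from replacing Ĝ(s) by Ĝ(cs). The resulting pointwise bound
changes sign before 1/3, but its integral from 0 to r stays nonpositive for r ≤ 1/3.

Distance (`IsMaMindaConvex.le_boundaryDist`). Where |f'| is critical in the angle, ψ(w(z)) is real,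
hence w(z) is real and at least -|z|, and ψ increases on (-1, 1). With the minimum principle
`lt_of_polar_critical` this gives f₀'(-|z|) ≤ |f'(z)|, and a second application gives -f₀(-|z|) ≤
|f(z)|. The same principle shows that convexity implies starlikeness, from which univalence follows;
thus boundary points of f(𝔻) have modulus at least L.

Sharpness. For f₀ itself -L is a boundary point, so the distance is exactly L, while the Bohr sum of
p is (2K/(K+1)) f̂₀(r), strictly increasing in r. -/

theorem isOpen_unitDisk : IsOpen unitDisk := isOpen_ball

theorem mem_unitDisk {z : ℂ} : z ∈ unitDisk ↔ ‖z‖ < 1 := by simp [unitDisk]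

theorem zero_mem_unitDisk : (0 : ℂ) ∈ unitDisk := by simp [unitDisk]

theorem unitDisk_mem_nhds {z : ℂ} (hz : z ∈ unitDisk) : unitDisk ∈ 𝓝 z :=
  isOpen_unitDisk.mem_nhds hz

theorem ofReal_mem_unitDisk {s : ℝ} (h0 : 0 ≤ s) (h1 : s < 1) : (s : ℂ) ∈ unitDisk := by
  rw [mem_unitDisk, Complex.norm_real, Real.norm_of_nonneg h0]; exact h1

/-! ### Taylor coefficients -/

section TaylorCoeff

variable {f g : ℂ → ℂ}

theorem hasSum_taylorCoeff (hf : DifferentiableOn ℂ f unitDisk) {z : ℂ} (hz : z ∈ unitDisk) :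
    HasSum (fun n => taylorCoeff f n * z ^ n) (f z) := by
  have := Complex.hasSum_taylorSeries_on_ball hf hz
  simp only [smul_eq_mul, sub_zero] at this
  refine this.congr_fun fun n => ?_
  rw [taylorCoeff]
  ring

/-- Uniqueness of power series. Any positive radius is allowed, so that an expansion known only on a
smaller disk (as in `majorant_le_tsum`) also determines the coefficients. -/
theorem taylorCoeff_eq_of_hasSum {a : ℕ → ℂ} {ρ : ℝ} (hρ : 0 < ρ)
    (h : ∀ z : ℂ, ‖z‖ < ρ → HasSum (fun n => a n * z ^ n) (f z)) (n : ℕ) :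
    taylorCoeff f n = a n := by
  have h1 : HasFPowerSeriesAt f (FormalMultilinearSeries.ofScalars ℂ a) 0 := by
    rw [hasFPowerSeriesAt_iff]
    filter_upwards [ball_mem_nhds (0 : ℂ) hρ] with z hz
    have := h z (by simpa using hz)
    simpa [FormalMultilinearSeries.coeff_ofScalars, mul_comm] using this
  have h2 := h1.analyticAt.hasFPowerSeriesAt
  have h3 := h2.eq_formalMultilinearSeries h1
  have h4 := congrArg (fun p => FormalMultilinearSeries.coeff p n) h3
  simpa [FormalMultilinearSeries.coeff_ofScalars, taylorCoeff] using h4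

theorem taylorCoeff_congr (h : EqOn f g unitDisk) (n : ℕ) : taylorCoeff f n = taylorCoeff g n := by
  have : f =ᶠ[𝓝 0] g := h.eventuallyEq_of_mem (unitDisk_mem_nhds zero_mem_unitDisk)
  rw [taylorCoeff, taylorCoeff, this.iteratedDeriv_eq]

theorem taylorCoeff_zero : taylorCoeff f 0 = f 0 := by simp [taylorCoeff]

theorem taylorCoeff_one : taylorCoeff f 1 = deriv f 0 := by simp [taylorCoeff]

theorem taylorCoeff_deriv (n : ℕ) : taylorCoeff (deriv f) n = (n + 1) * taylorCoeff f (n + 1) := by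
  have h1 : ((n : ℂ) + 1) ≠ 0 := by exact_mod_cast n.succ_ne_zero
  have h2 : ((n.factorial : ℕ) : ℂ) ≠ 0 := by exact_mod_cast n.factorial_ne_zero
  simp only [taylorCoeff, iteratedDeriv_succ', Nat.factorial_succ]
  push_cast
  field_simp

theorem taylorCoeff_const_mul (c : ℂ) (hf : DifferentiableOn ℂ f unitDisk) (n : ℕ) :
    taylorCoeff (fun z => c * f z) n = c * taylorCoeff f n :=
  taylorCoeff_eq_of_hasSum (a := fun n => c * taylorCoeff f n) one_pos (fun z hz => by
    simpa only [mul_assoc] using (hasSum_taylorCoeff hf (mem_unitDisk.2 hz)).mul_left c) n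

theorem taylorCoeff_sub (hf : DifferentiableOn ℂ f unitDisk) (hg : DifferentiableOn ℂ g unitDisk)
    (n : ℕ) : taylorCoeff (fun z => f z - g z) n = taylorCoeff f n - taylorCoeff g n :=
  taylorCoeff_eq_of_hasSum (a := fun n => taylorCoeff f n - taylorCoeff g n) one_pos (fun z hz => by
    simpa only [sub_mul] using (hasSum_taylorCoeff hf (mem_unitDisk.2 hz)).sub
      (hasSum_taylorCoeff hg (mem_unitDisk.2 hz))) n

theorem taylorCoeff_const (c : ℂ) (n : ℕ) :
    taylorCoeff (fun _ => c) n = if n = 0 then c else 0 :=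
  taylorCoeff_eq_of_hasSum (a := fun n => if n = 0 then c else 0) one_pos (fun z _ => by
    have := hasSum_ite_eq (0 : ℕ) c
    refine this.congr_fun ?_
    intro n
    by_cases hn : n = 0 <;> simp [hn]) n

theorem mul_mem_unitDisk {c z : ℂ} (hc : ‖c‖ ≤ 1) (hz : z ∈ unitDisk) : c * z ∈ unitDisk := by
  rw [mem_unitDisk] at *
  rw [norm_mul]
  calc ‖c‖ * ‖z‖ ≤ 1 * ‖z‖ := by gcongr
    _ < 1 := by simpa using hz

theorem DifferentiableOn.comp_mul_unitDisk (hf : DifferentiableOn ℂ f unitDisk) {c : ℂ}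
    (hc : ‖c‖ ≤ 1) : DifferentiableOn ℂ (fun z => f (c * z)) unitDisk :=
  hf.comp (by fun_prop) (fun _ hz => mul_mem_unitDisk hc hz)

theorem taylorCoeff_comp_mul (hf : DifferentiableOn ℂ f unitDisk) {c : ℂ} (hc : ‖c‖ ≤ 1) (n : ℕ) :
    taylorCoeff (fun z => f (c * z)) n = taylorCoeff f n * c ^ n :=
  taylorCoeff_eq_of_hasSum (a := fun n => taylorCoeff f n * c ^ n) one_pos (fun z hz => by
    have := hasSum_taylorCoeff hf (mul_mem_unitDisk hc (mem_unitDisk.2 hz))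
    simpa [mul_pow, mul_assoc] using this) n

theorem summable_taylorCoeff (hf : DifferentiableOn ℂ f unitDisk) {s : ℝ} (h0 : 0 ≤ s)
    (h1 : s < 1) : Summable (fun n => ‖taylorCoeff f n‖ * s ^ n) := by
  have := (hasSum_taylorCoeff hf (ofReal_mem_unitDisk h0 h1)).summable.norm
  simpa [abs_of_nonneg h0] using this

theorem summable_norm_taylorCoeff_mul_pow (hf : DifferentiableOn ℂ f unitDisk) {z : ℂ}
    (hz : z ∈ unitDisk) : Summable (fun n => ‖taylorCoeff f n * z ^ n‖) :=
  (hasSum_taylorCoeff hf hz).summable.norm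

theorem taylorCoeff_mul (hf : DifferentiableOn ℂ f unitDisk) (hg : DifferentiableOn ℂ g unitDisk)
    (n : ℕ) : taylorCoeff (fun z => f z * g z) n =
      ∑ kl ∈ Finset.HasAntidiagonal.antidiagonal n, taylorCoeff f kl.1 * taylorCoeff g kl.2 := by
  refine taylorCoeff_eq_of_hasSum (a := fun n => ∑ kl ∈ Finset.HasAntidiagonal.antidiagonal n,
    taylorCoeff f kl.1 * taylorCoeff g kl.2) one_pos (fun z hz => ?_) n
  have hz := mem_unitDisk.2 hz
  have hf1 := summable_norm_taylorCoeff_mul_pow hf hz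
  have hg1 := summable_norm_taylorCoeff_mul_pow hg hz
  have hs := (summable_norm_sum_mul_antidiagonal_of_summable_norm hf1 hg1).of_norm
  have ht := tsum_mul_tsum_eq_tsum_sum_antidiagonal_of_summable_norm hf1 hg1
  rw [(hasSum_taylorCoeff hf hz).tsum_eq, (hasSum_taylorCoeff hg hz).tsum_eq] at ht
  rw [ht]
  refine hs.hasSum.congr_fun ?_
  intro m
  rw [Finset.sum_mul]
  refine Finset.sum_congr rfl (fun kl hkl => ?_)
  rw [← Finset.HasAntidiagonal.mem_antidiagonal.1 hkl, pow_add]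
  ring

theorem taylorCoeff_id_mul_succ (hf : DifferentiableOn ℂ f unitDisk) (n : ℕ) :
    taylorCoeff (fun z => z * f z) (n + 1) = taylorCoeff f n := by
  refine taylorCoeff_eq_of_hasSum
    (a := fun n => Nat.casesOn n 0 (fun m => taylorCoeff f m)) one_pos (fun z hz => ?_) (n + 1)
  rw [← hasSum_nat_add_iff' 1]
  have := (hasSum_taylorCoeff hf (mem_unitDisk.2 hz)).mul_left z
  have e : z * f z - ∑ i ∈ Finset.range 1,
      (Nat.casesOn i 0 (fun m => taylorCoeff f m) : ℂ) * z ^ i = z * f z := by simp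
  rw [e]
  refine this.congr_fun ?_
  intro n
  simp only [pow_succ]
  ring

end TaylorCoeff

/-! ### The majorant as a norm -/

section Majorant

variable {f g : ℂ → ℂ} {s : ℝ}

theorem majorant_congr (h : EqOn f g unitDisk) (s : ℝ) : majorant f s = majorant g s := by
  simp only [majorant, taylorCoeff_congr h]

theorem majorant_nonneg (hs : 0 ≤ s) : 0 ≤ majorant f s :=
  tsum_nonneg fun _ => by positivity

theorem majorant_const_mul (c : ℂ) (hf : DifferentiableOn ℂ f unitDisk) (s : ℝ) :
    majorant (fun z => c * f z) s = ‖c‖ * majorant f s := by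
  simp only [majorant, taylorCoeff_const_mul c hf, norm_mul, mul_assoc, tsum_mul_left]

/-- Triangle inequality in each coefficient of the Cauchy product; the product of the two majorants
is the same Cauchy product taken with absolute values. -/
theorem majorant_mul_le (hf : DifferentiableOn ℂ f unitDisk) (hg : DifferentiableOn ℂ g unitDisk)
    (h0 : 0 ≤ s) (h1 : s < 1) :
    majorant (fun z => f z * g z) s ≤ majorant f s * majorant g s := by
  have hf1 := summable_taylorCoeff hf h0 h1
  have hg1 := summable_taylorCoeff hg h0 h1
  have key := tsum_mul_tsum_eq_tsum_sum_antidiagonal_of_summable_norm hf1.norm hg1.norm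
  have hsum := (summable_norm_sum_mul_antidiagonal_of_summable_norm hf1.norm hg1.norm).of_norm
  rw [majorant, majorant, majorant, key]
  refine Summable.tsum_le_tsum (fun n => ?_) (summable_taylorCoeff (hf.mul hg) h0 h1) hsum
  rw [taylorCoeff_mul hf hg]
  calc ‖∑ kl ∈ Finset.HasAntidiagonal.antidiagonal n, taylorCoeff f kl.1 * taylorCoeff g kl.2‖
        * s ^ n
      ≤ (∑ kl ∈ Finset.HasAntidiagonal.antidiagonal n,
          ‖taylorCoeff f kl.1 * taylorCoeff g kl.2‖) * s ^ n := by
        gcongr; exact norm_sum_le _ _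
    _ = _ := by
        rw [Finset.sum_mul]
        refine Finset.sum_congr rfl (fun kl hkl => ?_)
        rw [← Finset.HasAntidiagonal.mem_antidiagonal.1 hkl, pow_add, norm_mul]
        ring

/-- Multiplication by z only shifts coefficients, so there is equality; this later allows the factor
s to be cancelled from estimates of z E'. -/
theorem majorant_id_mul (hf : DifferentiableOn ℂ f unitDisk) (h0 : 0 ≤ s) (h1 : s < 1) :
    majorant (fun z => z * f z) s = s * majorant f s := by
  have hd : DifferentiableOn ℂ (fun z => z * f z) unitDisk := differentiableOn_id.mul hf
  rw [majorant, (summable_taylorCoeff hd h0 h1).tsum_eq_zero_add, majorant, ← tsum_mul_left,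
    taylorCoeff_zero]
  simp only [zero_mul, norm_zero, zero_add]
  refine tsum_congr fun n => ?_
  rw [taylorCoeff_id_mul_succ hf, pow_succ]
  ring

theorem majorant_one (s : ℝ) : majorant (fun _ => 1) s = 1 := by
  rw [majorant, tsum_eq_single 0]
  · simp [taylorCoeff_const]
  · intro n hn; simp [taylorCoeff_const, hn]

theorem majorant_pow_le (hf : DifferentiableOn ℂ f unitDisk) (h0 : 0 ≤ s) (h1 : s < 1) (n : ℕ) :
    majorant (fun z => f z ^ n) s ≤ majorant f s ^ n := by
  induction n with
  | zero => simp [majorant_one]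
  | succ n ih =>
    have h := majorant_mul_le (hf.fun_pow n) hf h0 h1
    simp only [pow_succ] at h ⊢
    refine h.trans ?_
    gcongr
    exact majorant_nonneg h0

theorem majorant_sub_le (hf : DifferentiableOn ℂ f unitDisk) (hg : DifferentiableOn ℂ g unitDisk)
    (h0 : 0 ≤ s) (h1 : s < 1) :
    majorant (fun z => f z - g z) s ≤ majorant f s + majorant g s := by
  have hf1 := summable_taylorCoeff hf h0 h1
  have hg1 := summable_taylorCoeff hg h0 h1
  rw [majorant, majorant, majorant, ← hf1.tsum_add hg1]
  refine Summable.tsum_le_tsum (fun n => ?_) (summable_taylorCoeff (hf.sub hg) h0 h1)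
    (hf1.add hg1)
  rw [taylorCoeff_sub hf hg, ← add_mul]
  gcongr
  exact norm_sub_le _ _

theorem majorant_add_le (hf : DifferentiableOn ℂ f unitDisk) (hg : DifferentiableOn ℂ g unitDisk)
    (h0 : 0 ≤ s) (h1 : s < 1) :
    majorant (fun z => f z + g z) s ≤ majorant f s + majorant g s := by
  have h := majorant_sub_le hf ((differentiableOn_const (-1 : ℂ)).fun_mul hg) h0 h1
  have e := majorant_const_mul (-1) hg s
  simp only [norm_neg, norm_one, one_mul] at e
  rw [e] at h
  refine le_of_eq_of_le (majorant_congr (fun z _ => ?_) s) h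
  simp

/-- Countable subadditivity of the majorant. -/
theorem majorant_le_tsum {F : ℕ → ℂ → ℂ} {B : ℕ → ℝ}
    (hF : ∀ n, DifferentiableOn ℂ (F n) unitDisk) (h0 : 0 < s) (h1 : s < 1)
    (hf : DifferentiableOn ℂ f unitDisk)
    (hsum : ∀ z : ℂ, ‖z‖ < s → HasSum (fun n => F n z) (f z))
    (hB : ∀ n, majorant (F n) s ≤ B n) (hBs : Summable B) :
    majorant f s ≤ ∑' n, B n := by
  have hFs : Summable (fun n => majorant (F n) s) :=
    hBs.of_nonneg_of_le (fun n => majorant_nonneg h0.le) hB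
  -- Absolute summability of the double series justifies both interchanges: the one identifying the
  -- coefficients of `f`, and the one summing the majorants.
  have hdouble : Summable (fun p : ℕ × ℕ => ‖taylorCoeff (F p.1) p.2‖ * s ^ p.2) := by
    rw [summable_prod_of_nonneg (fun p => by positivity)]
    exact ⟨fun n => summable_taylorCoeff (hF n) h0.le h1, hFs⟩
  have hswap : Summable (fun p : ℕ × ℕ => ‖taylorCoeff (F p.2) p.1‖ * s ^ p.1) :=
    hdouble.prod_symm
  have hcol : ∀ m, Summable (fun n => ‖taylorCoeff (F n) m‖ * s ^ m) := fun m =>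
    hswap.prod_factor m
  have hcol' : ∀ m, Summable (fun n => ‖taylorCoeff (F n) m‖) := fun m =>
    (summable_mul_right_iff (pow_pos h0 m).ne').1 (hcol m)
  have hcoef : ∀ m, taylorCoeff f m = ∑' n, taylorCoeff (F n) m := by
    refine taylorCoeff_eq_of_hasSum (a := fun m => ∑' n, taylorCoeff (F n) m) h0 (fun z hz => ?_)
    have hzD : z ∈ unitDisk := mem_unitDisk.2 (hz.trans h1)
    have hdz : Summable (fun p : ℕ × ℕ => taylorCoeff (F p.1) p.2 * z ^ p.2) := by
      refine Summable.of_norm_bounded hdouble (fun p => ?_)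
      rw [norm_mul, norm_pow]
      gcongr
    have h3 := hdz.hasSum.prod_fiberwise (fun n => hasSum_taylorCoeff (hF n) hzD)
    have h4 : HasSum (fun p : ℕ × ℕ => taylorCoeff (F p.2) p.1 * z ^ p.1) (f z) := by
      have := hdz.hasSum
      rw [h3.unique (hsum z hz)] at this
      rw [← (Equiv.prodComm ℕ ℕ).hasSum_iff] at this
      exact this.congr_fun fun p => rfl
    have h6 : ∀ m, HasSum (fun n => taylorCoeff (F n) m * z ^ m)
        ((∑' n, taylorCoeff (F n) m) * z ^ m) :=
      fun m => ((hcol' m).of_norm.hasSum.mul_right (z ^ m))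
    exact h4.prod_fiberwise h6
  have hle : ∀ m, ‖taylorCoeff f m‖ * s ^ m ≤ ∑' n, ‖taylorCoeff (F n) m‖ * s ^ m := by
    intro m
    rw [hcoef m, tsum_mul_right]
    gcongr
    exact norm_tsum_le_tsum_norm (hcol' m)
  calc majorant f s ≤ ∑' m, ∑' n, ‖taylorCoeff (F n) m‖ * s ^ m :=
        Summable.tsum_le_tsum hle (summable_taylorCoeff hf h0.le h1) hswap.prod
    _ = ∑' n, majorant (F n) s :=
        Summable.tsum_comm (f := fun n m => ‖taylorCoeff (F n) m‖ * s ^ m) hdouble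
    _ ≤ _ := hFs.tsum_le_tsum hB hBs

theorem continuousOn_majorant (hf : DifferentiableOn ℂ f unitDisk) :
    ContinuousOn (majorant f) (Ico 0 1) := by
  intro s hs
  obtain ⟨t, hst, ht1⟩ := exists_between hs.2
  have h0t : 0 ≤ t := hs.1.trans hst.le
  -- Weierstrass M-test on [0, t] for some t strictly between s and 1.
  have : ContinuousOn (majorant f) (Icc 0 t) := by
    refine continuousOn_tsum (u := fun n => ‖taylorCoeff f n‖ * t ^ n) (fun n => by fun_prop)
      (summable_taylorCoeff hf h0t ht1) (fun n x hx => ?_)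
    rw [norm_mul, norm_norm, norm_pow, Real.norm_of_nonneg hx.1]
    gcongr
    exacts [hx.1, hx.2]
  refine (this s ⟨hs.1, hst.le⟩).mono_of_mem_nhdsWithin ?_
  filter_upwards [inter_mem_nhdsWithin (Ico (0 : ℝ) 1) (Iio_mem_nhds hst)] with x hx
  exact ⟨hx.1.1, (mem_Iio.1 hx.2).le⟩

theorem majorant_mono (hf : DifferentiableOn ℂ f unitDisk) {t : ℝ} (h0 : 0 ≤ s) (hst : s ≤ t)
    (h1 : t < 1) : majorant f s ≤ majorant f t :=
  Summable.tsum_le_tsum (fun n => by gcongr) (summable_taylorCoeff hf h0 (hst.trans_lt h1))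
    (summable_taylorCoeff hf (h0.trans hst) h1)

theorem majorant_strictMono (hf : DifferentiableOn ℂ f unitDisk) (hf1 : deriv f 0 ≠ 0) {t : ℝ}
    (h0 : 0 ≤ s) (hst : s < t) (h1 : t < 1) : majorant f s < majorant f t :=
  Summable.tsum_lt_tsum (i := 1) (fun n => by gcongr)
    (by rw [taylorCoeff_one, pow_one, pow_one]; have := norm_pos_iff.2 hf1; gcongr)
    (summable_taylorCoeff hf h0 (hst.trans h1)) (summable_taylorCoeff hf (h0.trans hst.le) h1)

theorem majorant_zero : majorant f 0 = ‖f 0‖ := by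
  rw [majorant, tsum_eq_single 0]
  · simp [taylorCoeff_zero]
  · intro n hn; simp [hn]

theorem intervalIntegrable_majorant (hf : DifferentiableOn ℂ f unitDisk) (h0 : 0 ≤ s) (h1 : s < 1) :
    IntervalIntegrable (majorant f) MeasureTheory.volume 0 s := by
  refine ContinuousOn.intervalIntegrable ?_
  rw [uIcc_of_le h0]
  exact (continuousOn_majorant hf).mono (fun x hx => ⟨hx.1, hx.2.trans_lt h1⟩)

/-- Termwise integration, since |a_{n+1}| s^{n+1} is the integral of (n+1)|a_{n+1}| u^n. Estimates
for derivatives thereby pass to the functions. -/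
theorem majorant_eq_integral (hf : DifferentiableOn ℂ f unitDisk) (h0 : 0 ≤ s) (h1 : s < 1) :
    majorant f s = ‖f 0‖ + ∫ u in (0 : ℝ)..s, majorant (deriv f) u := by
  have hd := hf.deriv isOpen_unitDisk
  have key : HasSum (fun n => ∫ u in (0 : ℝ)..s, ‖taylorCoeff (deriv f) n‖ * u ^ n)
      (∫ u in (0 : ℝ)..s, majorant (deriv f) u) := by
    refine intervalIntegral.hasSum_integral_of_dominated_convergence
      (fun n _ => ‖taylorCoeff (deriv f) n‖ * s ^ n)
      (fun n => (by fun_prop : Continuous fun u : ℝ => ‖taylorCoeff (deriv f) n‖ * u ^ n).aestronglyMeasurable)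
      (fun n => Eventually.of_forall fun u hu => ?_)
      (Eventually.of_forall fun u hu => summable_taylorCoeff hd h0 h1)
      intervalIntegrable_const
      (Eventually.of_forall fun u hu => ?_)
    · rw [uIoc_of_le h0] at hu
      rw [norm_mul, norm_norm, norm_pow, Real.norm_of_nonneg hu.1.le]
      have := hu.1.le
      gcongr
      exact hu.2
    · rw [uIoc_of_le h0] at hu
      exact (summable_taylorCoeff hd hu.1.le (hu.2.trans_lt h1)).hasSum
  rw [← key.tsum_eq, majorant, (summable_taylorCoeff hf h0 h1).tsum_eq_zero_add, taylorCoeff_zero,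
    pow_zero, mul_one]
  congr 1
  refine tsum_congr fun n => ?_
  rw [intervalIntegral.integral_const_mul, integral_pow, taylorCoeff_deriv, norm_mul]
  have : ‖((n : ℂ) + 1)‖ = (n : ℝ) + 1 := by
    have : ((n : ℂ) + 1) = ((n + 1 : ℕ) : ℂ) := by push_cast; ring
    rw [this, Complex.norm_natCast]; push_cast; ring
  rw [this]
  have : (n : ℝ) + 1 ≠ 0 := by positivity
  field_simp
  simp

theorem hasDerivAt_majorant (hf : DifferentiableOn ℂ f unitDisk) (h0 : 0 < s) (h1 : s < 1) :
    HasDerivAt (majorant f) (majorant (deriv f) s) s := by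
  have hd := hf.deriv isOpen_unitDisk
  have hc : ContinuousOn (majorant (deriv f)) (Ioo 0 1) :=
    (continuousOn_majorant hd).mono Ioo_subset_Ico_self
  have h2 := intervalIntegral.integral_hasDerivAt_right (intervalIntegrable_majorant hd h0.le h1)
    (hc.stronglyMeasurableAtFilter isOpen_Ioo s ⟨h0, h1⟩) (hc.continuousAt (Ioo_mem_nhds h0 h1))
  have h3 := h2.const_add ‖f 0‖
  refine h3.congr_of_eventuallyEq ?_
  filter_upwards [Ioo_mem_nhds h0 h1] with u hu
  exact majorant_eq_integral hf hu.1.le hu.2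

end Majorant

/-! ### Fourier integrals on circles and coefficient estimates -/

section Coefficients

open Complex in
theorem integral_exp_int_mul_I (j : ℤ) :
    ∫ θ in (0 : ℝ)..2 * Real.pi, exp (j * I * θ) = if j = 0 then 2 * (Real.pi : ℂ) else 0 := by
  split_ifs with hj
  · simp [hj]
  · have hc : (j : ℂ) * I ≠ 0 := mul_ne_zero (by exact_mod_cast hj) I_ne_zero
    rw [integral_exp_mul_complex hc]
    have : exp ((j : ℂ) * I * ((2 * Real.pi : ℝ) : ℂ)) = 1 := by
      rw [exp_eq_one_iff]; exact ⟨j, by push_cast; ring⟩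
    rw [this]; simp

variable {f : ℂ → ℂ}

open Complex in
theorem ofReal_mul_exp_mem_unitDisk {r : ℝ} (h0 : 0 ≤ r) (h1 : r < 1) (θ : ℝ) :
    (r : ℂ) * exp (I * θ) ∈ unitDisk := by
  rw [mem_unitDisk, norm_mul, mul_comm I, norm_exp_ofReal_mul_I, norm_real,
    Real.norm_of_nonneg h0, mul_one]
  exact h1

open Complex in
theorem continuous_circle_comp (hf : DifferentiableOn ℂ f unitDisk) {r : ℝ} (h0 : 0 ≤ r)
    (h1 : r < 1) : Continuous (fun θ : ℝ => f (r * exp (I * θ))) :=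
  hf.continuousOn.comp_continuous (by fun_prop) (ofReal_mul_exp_mem_unitDisk h0 h1)

open Complex in
-- Termwise integration of the Taylor series on |z| = r, dominated by its majorant; orthogonality of
-- the exponentials leaves at most the index m = -k.
theorem hasSum_circle_integral (hf : DifferentiableOn ℂ f unitDisk) {r : ℝ} (h0 : 0 ≤ r)
    (h1 : r < 1) (k : ℤ) :
    HasSum (fun m : ℕ => taylorCoeff f m * r ^ m * if (m : ℤ) + k = 0 then 2 * (Real.pi : ℂ) else 0)
      (∫ θ in (0 : ℝ)..2 * Real.pi, f (r * exp (I * θ)) * exp (k * I * θ)) := by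
  have hs := summable_taylorCoeff hf h0 h1
  have key : HasSum (fun m : ℕ => ∫ θ in (0 : ℝ)..2 * Real.pi,
      taylorCoeff f m * (r * exp (I * θ)) ^ m * exp (k * I * θ))
      (∫ θ in (0 : ℝ)..2 * Real.pi, f (r * exp (I * θ)) * exp (k * I * θ)) := by
    refine intervalIntegral.hasSum_integral_of_dominated_convergence
      (fun m _ => ‖taylorCoeff f m‖ * r ^ m)
      (fun m => Continuous.aestronglyMeasurable (by fun_prop))
      (fun m => Eventually.of_forall fun θ _ => ?_)
      (Eventually.of_forall fun θ _ => hs) intervalIntegrable_const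
      (Eventually.of_forall fun θ _ => ?_)
    · have e1 : ‖exp (k * I * θ)‖ = 1 := by
        rw [show (k : ℂ) * I * θ = ((k * θ : ℝ) : ℂ) * I by push_cast; ring, norm_exp_ofReal_mul_I]
      have e2 : ‖exp (I * θ)‖ = 1 := by rw [mul_comm, norm_exp_ofReal_mul_I]
      rw [norm_mul, norm_mul, norm_pow, norm_mul, e1, e2, norm_real, Real.norm_of_nonneg h0]
      simp
    · exact (hasSum_taylorCoeff hf (ofReal_mul_exp_mem_unitDisk h0 h1 θ)).mul_right _
  refine key.congr_fun fun m => ?_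
  have : ∀ θ : ℝ, taylorCoeff f m * (r * exp (I * θ)) ^ m * exp (k * I * θ) =
      (taylorCoeff f m * r ^ m) * exp (((m + k : ℤ) : ℂ) * I * θ) := by
    intro θ
    rw [mul_pow, ← exp_nat_mul]
    push_cast
    rw [show ((m : ℂ) + k) * I * θ = m * (I * θ) + k * I * θ by ring, exp_add]
    ring
  simp_rw [this]
  rw [intervalIntegral.integral_const_mul, integral_exp_int_mul_I]

open Complex in
theorem circle_integral_neg (hf : DifferentiableOn ℂ f unitDisk) {r : ℝ} (h0 : 0 ≤ r)
    (h1 : r < 1) (n : ℕ) :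
    ∫ θ in (0 : ℝ)..2 * Real.pi, f (r * exp (I * θ)) * exp (-n * I * θ) =
      2 * Real.pi * (taylorCoeff f n * r ^ n) := by
  have h := hasSum_circle_integral hf h0 h1 (-n)
  have h2 : HasSum (fun m : ℕ => taylorCoeff f m * r ^ m *
      if (m : ℤ) + (-n : ℤ) = 0 then 2 * (Real.pi : ℂ) else 0)
      (2 * Real.pi * (taylorCoeff f n * r ^ n)) := by
    convert hasSum_single n (fun m hm => ?_) using 1
    · simp; ring
    · rw [if_neg (by omega), mul_zero]
  have h3 := h.unique h2
  push_cast at h3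
  exact h3

open Complex in
theorem circle_integral_pos (hf : DifferentiableOn ℂ f unitDisk) {r : ℝ} (h0 : 0 ≤ r)
    (h1 : r < 1) {n : ℕ} (hn : n ≠ 0) :
    ∫ θ in (0 : ℝ)..2 * Real.pi, f (r * exp (I * θ)) * exp (n * I * θ) = 0 := by
  have h := hasSum_circle_integral hf h0 h1 n
  have h2 : HasSum (fun m : ℕ => taylorCoeff f m * r ^ m *
      if (m : ℤ) + (n : ℤ) = 0 then 2 * (Real.pi : ℂ) else 0) 0 := by
    convert hasSum_zero using 2 with m
    rw [if_neg (by omega), mul_zero]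
  have h3 := h.unique h2
  push_cast at h3
  exact h3

open Complex in
-- An analytic function has no frequency of the opposite sign, so the integral against e^{inθ}
-- vanishes and may be subtracted. The kernel becomes e^{-inθ} - e^{inθ} = -2i sin(nθ), whose real
-- part with f isolates Im f.
theorem circle_integral_sin (hf : DifferentiableOn ℂ f unitDisk) {r : ℝ} (h0 : 0 ≤ r)
    (h1 : r < 1) {n : ℕ} (hn : n ≠ 0) :
    ∫ θ in (0 : ℝ)..2 * Real.pi, (f (r * exp (I * θ))).im * Real.sin (n * θ) =
      Real.pi * ((taylorCoeff f n).re * r ^ n) := by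
  have hc := continuous_circle_comp hf h0 h1
  have e : ∫ θ in (0 : ℝ)..2 * Real.pi, (f (r * exp (I * θ)) * exp (-n * I * θ) -
      f (r * exp (I * θ)) * exp (n * I * θ)) = 2 * Real.pi * (taylorCoeff f n * r ^ n) := by
    rw [intervalIntegral.integral_sub, circle_integral_neg hf h0 h1, circle_integral_pos hf h0 h1 hn,
      sub_zero]
    · exact (hc.mul (by fun_prop)).intervalIntegrable _ _
    · exact (hc.mul (by fun_prop)).intervalIntegrable _ _
  have e2 := congrArg Complex.re e
  have e3 := reCLM.intervalIntegral_comp_comm (μ := MeasureTheory.volume) (a := 0)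
    (b := 2 * Real.pi) (f := fun θ : ℝ => (f (r * exp (I * θ)) * exp (-n * I * θ) -
      f (r * exp (I * θ)) * exp (n * I * θ)))
    (((hc.mul (by fun_prop)).sub (hc.mul (by fun_prop))).intervalIntegrable _ _)
  simp only [reCLM_apply] at e3
  rw [← e3] at e2
  have e4 : ∀ θ : ℝ, (f (r * exp (I * θ)) * exp (-n * I * θ) -
      f (r * exp (I * θ)) * exp (n * I * θ)).re =
      2 * ((f (r * exp (I * θ))).im * Real.sin (n * θ)) := by
    intro θ
    have a1 : exp (n * I * θ) = Real.cos (n * θ) + Real.sin (n * θ) * I := by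
      rw [show (n : ℂ) * I * θ = ((n * θ : ℝ) : ℂ) * I by push_cast; ring, exp_mul_I,
        ← ofReal_cos, ← ofReal_sin]
    have a2 : exp (-n * I * θ) = Real.cos (n * θ) - Real.sin (n * θ) * I := by
      rw [show -(n : ℂ) * I * θ = ((-(n * θ) : ℝ) : ℂ) * I by push_cast; ring, exp_mul_I,
        ← ofReal_cos, ← ofReal_sin, Real.cos_neg, Real.sin_neg]
      push_cast; ring
    rw [a1, a2, ← mul_sub]
    have : (Real.cos (n * θ) - Real.sin (n * θ) * I - (Real.cos (n * θ) + Real.sin (n * θ) * I) : ℂ)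
        = ((-2 * Real.sin (n * θ) : ℝ) : ℂ) * I := by push_cast; ring
    rw [this]
    simp only [mul_re, mul_im, ofReal_re, ofReal_im, I_re, I_im]
    ring
  simp_rw [e4] at e2
  rw [intervalIntegral.integral_const_mul] at e2
  have e5 : (2 * (Real.pi : ℂ) * (taylorCoeff f n * r ^ n)).re =
      2 * (Real.pi * ((taylorCoeff f n).re * r ^ n)) := by
    rw [← ofReal_pow, show 2 * (Real.pi : ℂ) * (taylorCoeff f n * ((r ^ n : ℝ) : ℂ)) =
      taylorCoeff f n * ((2 * Real.pi * r ^ n : ℝ) : ℂ) by push_cast; ring, re_mul_ofReal]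
    ring
  rw [e5] at e2
  linarith

theorem le_of_forall_mul_pow_le {a b : ℝ} (n : ℕ) (h : ∀ r : ℝ, 0 < r → r < 1 → a * r ^ n ≤ b) :
    a ≤ b := by
  have ht : Tendsto (fun r : ℝ => a * r ^ n) (𝓝[<] 1) (𝓝 (a * 1 ^ n)) :=
    (Continuous.tendsto (by fun_prop) 1).mono_left nhdsWithin_le_nhds
  rw [one_pow, mul_one] at ht
  refine le_of_tendsto ht ?_
  filter_upwards [Ioo_mem_nhdsLT (zero_lt_one' ℝ)] with r hr using h r hr.1 hr.2

open Complex in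
/-- Carathéodory's coefficient estimate. -/
theorem norm_taylorCoeff_le_of_re_nonneg (hf : DifferentiableOn ℂ f unitDisk)
    (hre : ∀ z ∈ unitDisk, 0 ≤ (f z).re) {n : ℕ} (hn : n ≠ 0) :
    ‖taylorCoeff f n‖ ≤ 2 * (f 0).re := by
  refine le_of_forall_mul_pow_le n fun r h0 h1 => ?_
  have hc := continuous_circle_comp hf h0.le h1
  have hpi := Real.pi_pos
  have e0 := circle_integral_pos hf h0.le h1 hn
  -- Adding the conjugate of the vanishing integral turns f into 2 Re f, a nonnegative density whose
  -- total mass is given by Re f(0).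
  have e0' : ∫ θ in (0 : ℝ)..2 * Real.pi,
      (starRingEnd ℂ) (f (r * exp (I * θ))) * exp (-n * I * θ) = 0 := by
    have := Complex.conjCLE.toContinuousLinearMap.intervalIntegral_comp_comm
      (μ := MeasureTheory.volume) (a := 0) (b := 2 * Real.pi)
      (f := fun θ : ℝ => f (r * exp (I * θ)) * exp (n * I * θ))
      ((hc.mul (by fun_prop)).intervalIntegrable _ _)
    rw [e0, map_zero] at this
    rw [← this]
    congr 1 with θ
    simp only [ContinuousLinearEquiv.coe_coe, conjCLE_apply]
    rw [map_mul, ← exp_conj]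
    simp
  have e1 : ∫ θ in (0 : ℝ)..2 * Real.pi, ((2 * (f (r * exp (I * θ))).re : ℝ) : ℂ) * exp (-n * I * θ)
      = 2 * Real.pi * (taylorCoeff f n * r ^ n) := by
    rw [← circle_integral_neg hf h0.le h1 n, ← add_zero (∫ θ in (0 : ℝ)..2 * Real.pi,
      f (r * exp (I * θ)) * exp (-n * I * θ)), ← e0', ← intervalIntegral.integral_add]
    · congr 1 with θ
      rw [← add_mul, add_conj]
    · exact (hc.mul (by fun_prop)).intervalIntegrable _ _
    · exact ((continuous_conj.comp hc).mul (by fun_prop)).intervalIntegrable _ _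
  have e2 : ∫ θ in (0 : ℝ)..2 * Real.pi, 2 * (f (r * exp (I * θ))).re =
      2 * Real.pi * (2 * (f 0).re) := by
    have a := circle_integral_neg hf h0.le h1 0
    have a2 := congrArg Complex.re a
    simp only [Nat.cast_zero, neg_zero, zero_mul, exp_zero, mul_one, pow_zero,
      taylorCoeff_zero] at a2
    have a3 := reCLM.intervalIntegral_comp_comm (μ := MeasureTheory.volume) (a := 0)
      (b := 2 * Real.pi) (f := fun θ : ℝ => f (r * exp (I * θ))) (hc.intervalIntegrable _ _)
    simp only [reCLM_apply] at a3
    rw [intervalIntegral.integral_const_mul, a3, a2,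
      show 2 * (Real.pi : ℂ) * f 0 = ((2 * Real.pi : ℝ) : ℂ) * f 0 by push_cast; ring, re_ofReal_mul]
    ring
  have e3 : ‖(2 * Real.pi * (taylorCoeff f n * r ^ n) : ℂ)‖ ≤ 2 * Real.pi * (2 * (f 0).re) := by
    rw [← e1, ← e2]
    refine intervalIntegral.norm_integral_le_of_norm_le (by positivity)
      (Eventually.of_forall fun θ _ => ?_) ((continuous_const.mul
        (continuous_re.comp hc)).intervalIntegrable _ _)
    rw [norm_mul, show -(n : ℂ) * I * θ = ((-(n * θ) : ℝ) : ℂ) * I by push_cast; ring,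
      norm_exp_ofReal_mul_I, norm_real, mul_one, Real.norm_of_nonneg]
    have := hre _ (ofReal_mul_exp_mem_unitDisk h0.le h1 θ)
    positivity
  have e4 : ‖(2 * Real.pi * (taylorCoeff f n * r ^ n) : ℂ)‖ =
      2 * Real.pi * (‖taylorCoeff f n‖ * r ^ n) := by
    rw [norm_mul, norm_mul, norm_mul, norm_pow, norm_real, norm_real, Real.norm_of_nonneg hpi.le,
      Real.norm_of_nonneg h0.le]
    simp
  rw [e4] at e3
  exact le_of_mul_le_mul_left e3 (by positivity)

theorem abs_sin_nat_mul_le (n : ℕ) (θ : ℝ) : |Real.sin (n * θ)| ≤ n * |Real.sin θ| := by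
  induction n with
  | zero => simp
  | succ n ih =>
    push_cast
    rw [add_mul, one_mul, Real.sin_add]
    calc |Real.sin (n * θ) * Real.cos θ + Real.cos (n * θ) * Real.sin θ|
        ≤ |Real.sin (n * θ)| * |Real.cos θ| + |Real.cos (n * θ)| * |Real.sin θ| := by
          rw [← abs_mul, ← abs_mul]; exact abs_add_le _ _
      _ ≤ |Real.sin (n * θ)| * 1 + 1 * |Real.sin θ| := by
          gcongr <;> exact Real.abs_cos_le_one _
      _ ≤ _ := by linarith

theorem conj_mem_unitDisk {z : ℂ} (hz : z ∈ unitDisk) : (starRingEnd ℂ) z ∈ unitDisk := by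
  rw [mem_unitDisk] at *; rwa [Complex.norm_conj]

theorem conj_taylorCoeff (hf : DifferentiableOn ℂ f unitDisk)
    (hconj : ∀ z ∈ unitDisk, f ((starRingEnd ℂ) z) = (starRingEnd ℂ) (f z)) (n : ℕ) :
    (starRingEnd ℂ) (taylorCoeff f n) = taylorCoeff f n := by
  refine (taylorCoeff_eq_of_hasSum (a := fun n => (starRingEnd ℂ) (taylorCoeff f n)) one_pos
    (fun z hz => ?_) n).symm
  have hz := mem_unitDisk.2 hz
  have h1 := hasSum_taylorCoeff hf (conj_mem_unitDisk hz)
  rw [hconj z hz] at h1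
  have h2 := (Complex.hasSum_conj'.2 h1)
  simpa using h2

/-- Coefficient estimate for typically real functions. -/
theorem norm_taylorCoeff_le_of_typicallyReal (hf : DifferentiableOn ℂ f unitDisk)
    (hconj : ∀ z ∈ unitDisk, f ((starRingEnd ℂ) z) = (starRingEnd ℂ) (f z))
    (him : ∀ z ∈ unitDisk, 0 ≤ (f z).im * z.im) {n : ℕ} (hn : n ≠ 0) :
    ‖taylorCoeff f n‖ ≤ n * (taylorCoeff f 1).re := by
  obtain ⟨m, rfl⟩ := Nat.exists_eq_succ_of_ne_zero hn
  refine le_of_forall_mul_pow_le m fun r h0 h1 => ?_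
  have hc := continuous_circle_comp hf h0.le h1
  have hpi := Real.pi_pos
  have e1 := circle_integral_sin hf h0.le h1 hn
  have e2 := circle_integral_sin hf h0.le h1 one_ne_zero
  have hreal : ‖taylorCoeff f (m + 1)‖ = |(taylorCoeff f (m + 1)).re| := by
    obtain ⟨x, hx⟩ := Complex.conj_eq_iff_real.1 (conj_taylorCoeff hf hconj (m + 1))
    rw [hx, Complex.norm_real, Complex.ofReal_re, Real.norm_eq_abs]
  have hv : Continuous fun θ : ℝ => (f (r * Complex.exp (Complex.I * θ))).im :=
    Complex.continuous_im.comp hc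
  -- Typical reality makes Im f · sin θ ≥ 0 on the circle, so |sin nθ| ≤ n |sin θ| bounds the n-th
  -- sine integral by n times the first.
  have e3 : ‖∫ θ in (0 : ℝ)..2 * Real.pi, (f (r * Complex.exp (Complex.I * θ))).im *
      Real.sin ((m + 1 : ℕ) * θ)‖ ≤ ∫ θ in (0 : ℝ)..2 * Real.pi, ((m + 1 : ℕ) : ℝ) *
        ((f (r * Complex.exp (Complex.I * θ))).im * Real.sin ((1 : ℕ) * θ)) := by
    refine intervalIntegral.norm_integral_le_of_norm_le (by positivity)
      (Eventually.of_forall fun θ _ => ?_) (Continuous.intervalIntegrable (by fun_prop) _ _)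
    have hpos : 0 ≤ (f (r * Complex.exp (Complex.I * θ))).im * Real.sin θ := by
      have := him _ (ofReal_mul_exp_mem_unitDisk h0.le h1 θ)
      have e : ((r : ℂ) * Complex.exp (Complex.I * θ)).im = r * Real.sin θ := by
        rw [mul_comm Complex.I, Complex.im_ofReal_mul, Complex.exp_ofReal_mul_I_im]
      rw [e] at this
      nlinarith [this]
    rw [Nat.cast_one, one_mul, norm_mul, Real.norm_eq_abs, Real.norm_eq_abs,
      ← abs_of_nonneg hpos, abs_mul]
    calc _ ≤ |(f (r * Complex.exp (Complex.I * θ))).im| * (((m + 1 : ℕ) : ℝ) * |Real.sin θ|) := by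
          gcongr; exact abs_sin_nat_mul_le _ _
      _ = _ := by ring
  rw [intervalIntegral.integral_const_mul, e1, e2, Real.norm_eq_abs, abs_mul, abs_mul,
    abs_of_pos hpi, ← hreal, abs_of_nonneg (by positivity : 0 ≤ r ^ (m + 1)), pow_one, pow_succ]
    at e3
  have h3 : (Real.pi * r) * (‖taylorCoeff f (m + 1)‖ * r ^ m) ≤
      (Real.pi * r) * (((m + 1 : ℕ) : ℝ) * (taylorCoeff f 1).re) := by
    calc _ = Real.pi * (‖taylorCoeff f (m + 1)‖ * (r ^ m * r)) := by ring
      _ ≤ _ := e3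
      _ = _ := by ring
  exact le_of_mul_le_mul_left h3 (by positivity)

end Coefficients

/-! ### Bohr's theorem for bounded functions and for subordination -/

section Bohr

variable {f w : ℂ → ℂ} {s M : ℝ}

/-- With u unimodular and u f(0) = |f(0)|, the function M - u f has nonnegative real part and value
M - |f(0)| at the origin; Carathéodory's estimate applies to it. -/
theorem norm_taylorCoeff_le_of_bounded (hf : DifferentiableOn ℂ f unitDisk)
    (hM : ∀ z ∈ unitDisk, ‖f z‖ ≤ M) {n : ℕ} (hn : n ≠ 0) :
    ‖taylorCoeff f n‖ ≤ 2 * (M - ‖f 0‖) := by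
  obtain ⟨u, hu, hu2⟩ : ∃ u : ℂ, ‖u‖ = 1 ∧ u * f 0 = ‖f 0‖ := by
    by_cases h : f 0 = 0
    · exact ⟨1, by simp, by simp [h]⟩
    · have hn : (‖f 0‖ : ℂ) ≠ 0 := by exact_mod_cast norm_ne_zero_iff.2 h
      refine ⟨‖f 0‖ / f 0, ?_, by field_simp⟩
      rw [norm_div, Complex.norm_real, norm_norm, div_self (norm_ne_zero_iff.2 h)]
  have hd : DifferentiableOn ℂ (fun z => (M : ℂ) - u * f z) unitDisk :=
    (differentiableOn_const _).sub (hf.const_mul u)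
  have h := norm_taylorCoeff_le_of_re_nonneg hd (fun z hz => ?_) hn
  · rw [taylorCoeff_sub (differentiableOn_const _) (hf.const_mul u), taylorCoeff_const, if_neg hn,
      taylorCoeff_const_mul u hf, zero_sub, norm_neg, norm_mul, hu, one_mul, hu2,
      ← Complex.ofReal_sub, Complex.ofReal_re] at h
    exact h
  · rw [Complex.sub_re, Complex.ofReal_re]
    have := (Complex.re_le_norm (u * f z)).trans_eq (by rw [norm_mul, hu, one_mul])
    linarith [hM z hz]

theorem majorant_sub_apply_zero_le (hf : DifferentiableOn ℂ f unitDisk)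
    (hM : ∀ z ∈ unitDisk, ‖f z‖ ≤ M) (h0 : 0 ≤ s) (h1 : s < 1) :
    majorant (fun z => f z - f 0) s ≤ 2 * (M - ‖f 0‖) * (s / (1 - s)) := by
  have hd : DifferentiableOn ℂ (fun z => f z - f 0) unitDisk :=
    hf.sub (differentiableOn_const _)
  have hg : HasSum (fun n => 2 * (M - ‖f 0‖) * s * s ^ n) (2 * (M - ‖f 0‖) * s * (1 - s)⁻¹) :=
    (hasSum_geometric_of_lt_one h0 h1).mul_left _
  rw [majorant, (summable_taylorCoeff hd h0 h1).tsum_eq_zero_add, taylorCoeff_zero, sub_self,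
    norm_zero, zero_mul, zero_add, div_eq_mul_inv, ← mul_assoc, ← hg.tsum_eq]
  refine Summable.tsum_le_tsum (fun n => ?_)
    ((summable_nat_add_iff 1).2 (summable_taylorCoeff hd h0 h1)) hg.summable
  rw [taylorCoeff_sub hf (differentiableOn_const _), taylorCoeff_const, if_neg n.succ_ne_zero,
    sub_zero, pow_succ, mul_assoc, mul_comm s]
  gcongr
  exact norm_taylorCoeff_le_of_bounded hf hM n.succ_ne_zero

theorem majorant_const (c : ℂ) (s : ℝ) : majorant (fun _ => c) s = ‖c‖ := by
  rw [majorant, tsum_eq_single 0]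
  · simp [taylorCoeff_const]
  · intro n hn; simp [taylorCoeff_const, hn]

/-- The bound is |f(0)| + (M - |f(0)|) · 2s/(1-s), and 2s/(1-s) ≤ 1 exactly when s ≤ 1/3. -/
theorem majorant_le_of_bounded (hf : DifferentiableOn ℂ f unitDisk)
    (hM : ∀ z ∈ unitDisk, ‖f z‖ ≤ M) (h0 : 0 ≤ s) (h1 : s ≤ 1 / 3) : majorant f s ≤ M := by
  have hs1 : s < 1 := by linarith
  have h := majorant_add_le (f := fun z => f z - f 0) (g := fun _ => f 0)
    (hf.sub (differentiableOn_const _)) (differentiableOn_const _) h0 hs1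
  simp only [sub_add_cancel] at h
  rw [majorant_const] at h
  have h2 := majorant_sub_apply_zero_le hf hM h0 hs1
  have h3 : s / (1 - s) ≤ 1 / 2 := by rw [div_le_iff₀ (by linarith)]; linarith
  have h4 : 0 ≤ M - ‖f 0‖ := sub_nonneg.2 (hM 0 zero_mem_unitDisk)
  nlinarith

theorem IsSchwarzFun.norm_le (hw : IsSchwarzFun w) {z : ℂ} (hz : z ∈ unitDisk) : ‖w z‖ ≤ ‖z‖ :=
  Complex.norm_le_norm_of_mapsTo_ball hw.holo
    (fun _ h => ball_subset_closedBall (hw.mapsTo h)) hw.zero (mem_unitDisk.1 hz)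

/-- Schwarz's lemma, with the quotient w(z)/z extended through the origin by `dslope`; in particular
ω(0) = w'(0). -/
theorem IsSchwarzFun.exists_eq_mul (hw : IsSchwarzFun w) :
    ∃ ω : ℂ → ℂ, DifferentiableOn ℂ ω unitDisk ∧ (∀ z ∈ unitDisk, ‖ω z‖ ≤ 1) ∧
      ∀ z, w z = z * ω z := by
  refine ⟨dslope w 0, (Complex.differentiableOn_dslope
    (unitDisk_mem_nhds zero_mem_unitDisk)).2 hw.holo, fun z hz => ?_, fun z => ?_⟩
  · have := Complex.norm_dslope_le_div_of_mapsTo_ball hw.holo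
      (fun x h => by rw [hw.zero]; exact ball_subset_closedBall (hw.mapsTo h)) hz
    simpa using this
  · have := sub_smul_dslope w 0 z
    simp only [sub_zero, smul_eq_mul, hw.zero] at this
    exact this.symm

theorem IsSchwarzFun.majorant_le (hw : IsSchwarzFun w) (h0 : 0 ≤ s) (h1 : s ≤ 1 / 3) :
    majorant w s ≤ s := by
  obtain ⟨ω, hω, hω1, hωw⟩ := hw.exists_eq_mul
  have : w = fun z => z * ω z := funext hωw
  rw [this, majorant_id_mul hω h0 (by linarith)]
  have := majorant_le_of_bounded hω hω1 h0 h1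
  nlinarith

theorem IsSchwarzFun.comp_holo (hw : IsSchwarzFun w) (hf : DifferentiableOn ℂ f unitDisk) :
    DifferentiableOn ℂ (fun z => f (w z)) unitDisk :=
  hf.comp hw.holo hw.mapsTo

/-- Bohr's inequality for subordinate functions. -/
theorem majorant_comp_le (hf : DifferentiableOn ℂ f unitDisk) (hw : IsSchwarzFun w) (h0 : 0 ≤ s)
    (h1 : s ≤ 1 / 3) : majorant (fun z => f (w z)) s ≤ majorant f s := by
  have hs1 : s < 1 := by linarith
  rcases h0.eq_or_lt with rfl | h0'
  · rw [majorant_zero, majorant_zero, hw.zero]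
  -- Expand f ∘ w as the series of a_n w^n; each term costs |a_n| ŵ(s)^n ≤ |a_n| s^n.
  refine majorant_le_tsum (F := fun n z => taylorCoeff f n * w z ^ n)
    (B := fun n => ‖taylorCoeff f n‖ * s ^ n) (fun n => (hw.holo.fun_pow n).const_mul _) h0' hs1
    (hw.comp_holo hf) (fun z hz => ?_) (fun n => ?_) (summable_taylorCoeff hf h0 hs1)
  · exact hasSum_taylorCoeff hf (hw.mapsTo (mem_unitDisk.2 (hz.trans hs1)))
  · rw [majorant_const_mul _ (hw.holo.fun_pow n)]
    gcongr
    refine (majorant_pow_le hw.holo h0 hs1 n).trans ?_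
    have := majorant_nonneg (f := w) h0
    gcongr
    exact hw.majorant_le h0 h1

end Bohr

/-! ### Comparison of majorants -/

section Comparison

/-- After shifting the index by one, (n+1)² = 2·C(n+2, 2) - C(n+1, 1), a combination of two
negative-binomial series. -/
theorem hasSum_sq_mul_geometric {s : ℝ} (h0 : 0 ≤ s) (h1 : s < 1) :
    HasSum (fun n : ℕ => ((n : ℝ) * (n * s ^ (n - 1)))) ((1 + s) / (1 - s) ^ 3) := by
  have hs : ‖s‖ < 1 := by rwa [Real.norm_of_nonneg h0]
  have a2 := (hasSum_choose_mul_geometric_of_norm_lt_one 2 hs).mul_left 2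
  have a1 := hasSum_choose_mul_geometric_of_norm_lt_one 1 hs
  rw [← hasSum_nat_add_iff' 1]
  have h := a2.sub a1
  have h1s : (1 - s) ≠ 0 := by linarith
  convert h using 1
  · ext n
    have e : ((n + 2).choose 2 : ℝ) = (n + 2) * (n + 1) / 2 := by
      rw [Nat.cast_choose_two]; push_cast; ring
    rw [e, Nat.choose_one_right]
    rw [Nat.add_sub_cancel]
    push_cast
    ring
  · simp
    field_simp
    ring

/-- The (1,1) Padé bound e^y ≤ (2+y)/(2-y), cleared of its denominator. The derivative of the
difference is 1 - e^y(1-y), nonnegative because 1 - y ≤ e^{-y}. -/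
theorem exp_le_rational {y : ℝ} (h0 : 0 ≤ y) : Real.exp y * (2 - y) ≤ 2 + y := by
  have hmono : MonotoneOn (fun y : ℝ => 2 + y - Real.exp y * (2 - y)) (Ici 0) := by
    refine monotoneOn_of_deriv_nonneg (convex_Ici 0) (by fun_prop) (by fun_prop) (fun x _ => ?_)
    have hd : HasDerivAt (fun y : ℝ => 2 + y - Real.exp y * (2 - y))
        (1 - (Real.exp x * (2 - x) + Real.exp x * (-1))) x :=
      ((hasDerivAt_id x).const_add 2).sub ((Real.hasDerivAt_exp x).mul
        ((hasDerivAt_id x).const_sub 2))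
    rw [hd.deriv]
    have h := Real.add_one_le_exp (-x)
    have h2 : Real.exp x * Real.exp (-x) = 1 := by rw [← Real.exp_add]; simp
    nlinarith [Real.exp_pos x]
  have := hmono self_mem_Ici (mem_Ici.2 h0) h0
  simp only [Real.exp_zero] at this
  linarith

/-- The function `s²(3+s)/(6(1-s)³) = ∑ n(2n+1)/6 s^(n+1)`. -/
noncomputable def bohrJ (s : ℝ) : ℝ := s ^ 2 * (3 + s) / (6 * (1 - s) ^ 3)

theorem hasDerivAt_bohrJ {s : ℝ} (h1 : s < 1) :
    HasDerivAt bohrJ (s * (1 + s) / (1 - s) ^ 4) s := by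
  have h1s : (1 - s) ≠ 0 := by linarith
  have hn : HasDerivAt (fun s : ℝ => s ^ 2 * (3 + s)) (2 * s * (3 + s) + s ^ 2 * 1) s := by
    simpa using (hasDerivAt_pow 2 s).fun_mul ((hasDerivAt_id' s).const_add 3)
  have hd : HasDerivAt (fun s : ℝ => 6 * (1 - s) ^ 3) (6 * (3 * (1 - s) ^ 2 * (-1))) s := by
    have := (((hasDerivAt_id' s).const_sub 1).fun_pow 3).const_mul 6
    simpa using this
  refine (hn.div hd (by positivity)).congr_deriv ?_
  field_simp
  ring

theorem bohrJ_nonneg {s : ℝ} (h0 : 0 ≤ s) (h1 : s < 1) : 0 ≤ bohrJ s := by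
  have : 0 < 1 - s := by linarith
  unfold bohrJ; positivity

theorem bohrJ_le {s : ℝ} (h0 : 0 ≤ s) (h1 : s ≤ 1 / 3) : bohrJ s ≤ 1 / 4 := by
  have h : 0 < 1 - s := by linarith
  rw [bohrJ, div_le_iff₀ (by positivity)]
  have : 8 / 27 ≤ (1 - s) ^ 3 := by
    calc (8 / 27 : ℝ) = (2 / 3) ^ 3 := by norm_num
      _ ≤ _ := by gcongr; linarith
  nlinarith

/-- A polynomial bound used to integrate the comparison of majorants. -/
noncomputable def bohrB (s : ℝ) : ℝ := s ^ 2 * (1 + 6 * s + 4 * s ^ 2 + 81 * s ^ 3)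

/-- The case p = 2, c = 1 of the inequality `hB` in `mul_exp_bohrJ_sub_le`. -/
theorem two_bohrJ_mul_le {s : ℝ} (h0 : 0 ≤ s) (h1 : s ≤ 1 / 3) :
    2 * bohrJ s * (1 + 2 * s) ≤ bohrB s := by
  have h : 0 < 1 - s := by linarith
  have e : 2 * bohrJ s * (1 + 2 * s) = s ^ 2 * ((3 + s) * (1 + 2 * s)) / (3 * (1 - s) ^ 3) := by
    unfold bohrJ; field_simp; ring
  rw [e, div_le_iff₀ (by positivity), bohrB, mul_assoc]
  refine mul_le_mul_of_nonneg_left ?_ (sq_nonneg s)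
  -- After clearing denominators and cancelling s², the difference of the two sides is s times this
  -- quintic.
  have q : 0 ≤ 2 - 35 * s + 258 * s ^ 2 - 711 * s ^ 3 + 717 * s ^ 4 - 243 * s ^ 5 := by
    have h2 : 0 ≤ 1 / 3 - s := by linarith
    nlinarith [sq_nonneg (s - 1 / 10), sq_nonneg (s - 1 / 3), mul_nonneg h0 h2,
      mul_nonneg h0 (sq_nonneg (s - 1 / 5)), mul_nonneg h0 (sq_nonneg (s - 1 / 3)),
      mul_nonneg (mul_nonneg h0 h0) (sq_nonneg (s - 1 / 3)), mul_nonneg (pow_nonneg h0 4) h2,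
      mul_nonneg (pow_nonneg h0 3) h2, mul_nonneg (pow_nonneg h0 2) h2,
      mul_nonneg h2 (sq_nonneg (s - 1 / 10))]
  nlinarith [mul_nonneg h0 q]

/-- The case p = 2, c = 0 of the inequality `hB` in `mul_exp_bohrJ_sub_le`. -/
theorem two_bohrJ_le {s : ℝ} (h0 : 0 ≤ s) (h1 : s ≤ 1 / 3) :
    2 * bohrJ s ≤ bohrB s * (1 - 2 * bohrJ s) := by
  have h : 0 < 1 - s := by linarith
  have e : 2 * bohrJ s = s ^ 2 * (3 + s) / (3 * (1 - s) ^ 3) := by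
    unfold bohrJ; field_simp; ring
  have e2 : 1 - 2 * bohrJ s = (3 * (1 - s) ^ 3 - s ^ 2 * (3 + s)) / (3 * (1 - s) ^ 3) := by
    rw [e]; field_simp
  rw [e2, e, ← mul_div_assoc]
  refine div_le_div_of_nonneg_right ?_ (by positivity)
  rw [bohrB, mul_assoc]
  refine mul_le_mul_of_nonneg_left ?_ (sq_nonneg s)
  have h2 : 0 ≤ 1 / 3 - s := by linarith
  have q : 3 + s ≤ (1 + 6 * s + 4 * s ^ 2 + 81 * s ^ 3) * (3 * (1 - s) ^ 3 - s ^ 2 * (3 + s)) := by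
    nlinarith [sq_nonneg (s - 1 / 10), sq_nonneg (s - 1 / 3), mul_nonneg h0 h2,
      mul_nonneg h0 (sq_nonneg (s - 1 / 5)), mul_nonneg h0 (sq_nonneg (s - 1 / 3)),
      mul_nonneg (mul_nonneg h0 h0) (sq_nonneg (s - 1 / 3)), mul_nonneg (pow_nonneg h0 5) h2,
      mul_nonneg (pow_nonneg h0 4) h2,
      mul_nonneg (pow_nonneg h0 3) h2, mul_nonneg (pow_nonneg h0 2) h2]
  exact q

/-- Near 1/3 the integrand is positive, so only the integrated inequality survives up to 1/3. After
division by r² the positive terms increase in r, and at r = 1/3 they total 64/135 < 1/2. -/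
theorem integral_bohrB_sub_le {r : ℝ} (h0 : 0 ≤ r) (h1 : r ≤ 1 / 3) :
    ∫ s in (0 : ℝ)..r, (bohrB s - s) ≤ 0 := by
  have e : ∫ s in (0 : ℝ)..r, (bohrB s - s) =
      r ^ 3 / 3 + 6 * r ^ 4 / 4 + 4 * r ^ 5 / 5 + 81 * r ^ 6 / 6 - r ^ 2 / 2 := by
    have hd : ∀ x ∈ uIcc 0 r, HasDerivAt
        (fun r : ℝ => r ^ 3 / 3 + 6 * r ^ 4 / 4 + 4 * r ^ 5 / 5 + 81 * r ^ 6 / 6 - r ^ 2 / 2)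
        (bohrB x - x) x := by
      intro x _
      have := (((((hasDerivAt_pow 3 x).div_const 3).add
        (((hasDerivAt_pow 4 x).const_mul 6).div_const 4)).add
        (((hasDerivAt_pow 5 x).const_mul 4).div_const 5)).add
        (((hasDerivAt_pow 6 x).const_mul 81).div_const 6)).sub ((hasDerivAt_pow 2 x).div_const 2)
      refine this.congr_deriv ?_
      unfold bohrB; push_cast; ring
    rw [intervalIntegral.integral_eq_sub_of_hasDerivAt hd
      (Continuous.intervalIntegrable (by unfold bohrB; fun_prop) _ _)]
    ring
  rw [e]
  have : r / 3 + 6 * r ^ 2 / 4 + 4 * r ^ 3 / 5 + 81 * r ^ 4 / 6 ≤ 1 / 2 := by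
    calc _ ≤ (1 / 3 : ℝ) / 3 + 6 * (1 / 3) ^ 2 / 4 + 4 * (1 / 3) ^ 3 / 5 + 81 * (1 / 3) ^ 4 / 6 := by
          gcongr
      _ ≤ _ := by norm_num
  nlinarith [mul_le_mul_of_nonneg_left this (sq_nonneg r)]

/-- Pointwise comparison: here `g = 1 + p s + R` and `gc` plays the role of `g` at `c s`. -/
theorem mul_exp_bohrJ_sub_le {s c p R gc : ℝ} (h0 : 0 ≤ s) (h1 : s ≤ 1 / 3) (c0 : 0 ≤ c)
    (c1 : c ≤ 1) (p0 : 0 ≤ p) (p2 : p ≤ 2) (hR : 0 ≤ R)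
    (hgc : gc ≤ 1 + p * (c * s) + c ^ 2 * R) :
    gc * Real.exp (2 * (1 - c) * p * bohrJ s) - (1 + p * s + R) ≤ (1 - c) * p * (bohrB s - s) := by
  set J := bohrJ s with hJ
  have J0 : 0 ≤ J := bohrJ_nonneg h0 (by linarith)
  have J1 : J ≤ 1 / 4 := bohrJ_le h0 h1
  have hc : 0 ≤ 1 - c := by linarith
  set y := 2 * (1 - c) * p * J with hy
  have y0 : 0 ≤ y := by positivity
  -- This gives y ≤ 1 - c, which is what keeps c² e^y ≤ 1 and lets the quadratic remainder R be
  -- absorbed.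
  have pJ : p * J ≤ 1 / 2 := by nlinarith
  have pJ0 : 0 ≤ p * J := by positivity
  have y1 : y ≤ 1 - c := by
    have : y = (1 - c) * (2 * (p * J)) := by rw [hy]; ring
    nlinarith
  have hexp := exp_le_rational y0
  have hE : 0 < Real.exp y := Real.exp_pos y
  -- the remainder terms
  have hR2 : c ^ 2 * Real.exp y ≤ 1 := by
    have hce : c ≤ Real.exp (c - 1) := by linarith [Real.add_one_le_exp (c - 1)]
    calc c ^ 2 * Real.exp y ≤ Real.exp (c - 1) ^ 2 * Real.exp y := by gcongr
      _ = Real.exp (2 * (c - 1) + y) := by rw [Real.exp_add, ← Real.exp_nat_mul]; push_cast; rfl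
      _ ≤ 1 := Real.exp_le_one_iff.2 (by linarith)
  -- the main terms
  have hB : 2 * J * (1 + p * (c * s)) ≤ bohrB s * (1 - (1 - c) * (p * J)) := by
    have k1 := two_bohrJ_mul_le h0 h1
    have k2 := two_bohrJ_le h0 h1
    rw [← hJ] at k1 k2
    have k0 : 2 * J ≤ bohrB s := by nlinarith
    have hp : 0 ≤ 2 - p := by linarith
    -- Twice the claim is the combination of `k0`, `k1`, `k2` with weights 2 - p, pc, p(1 - c): the
    -- extreme cases p = 0, (p, c) = (2, 1) and (p, c) = (2, 0).
    nlinarith [mul_nonneg hp (sub_nonneg.2 k0), mul_nonneg (mul_nonneg p0 c0) (sub_nonneg.2 k1),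
      mul_nonneg (mul_nonneg p0 hc) (sub_nonneg.2 k2)]
  have hu : 0 < 1 - (1 - c) * (p * J) := by nlinarith
  have hmain : (1 + p * (c * s)) * (Real.exp y - 1) ≤ (1 - c) * p * bohrB s := by
    -- The factor is 1 - y/2, so this is the Padé bound rearranged.
    have e1 : (Real.exp y - 1) * (1 - (1 - c) * (p * J)) ≤ y := by
      have : y = 2 * ((1 - c) * (p * J)) := by rw [hy]; ring
      rw [this] at hexp ⊢
      nlinarith
    have e2 : (1 + p * (c * s)) * (Real.exp y - 1) * (1 - (1 - c) * (p * J)) ≤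
        (1 - c) * p * bohrB s * (1 - (1 - c) * (p * J)) := by
      calc _ = (1 + p * (c * s)) * ((Real.exp y - 1) * (1 - (1 - c) * (p * J))) := by ring
        _ ≤ (1 + p * (c * s)) * y := by gcongr
        _ = (1 - c) * p * (2 * J * (1 + p * (c * s))) := by rw [hy]; ring
        _ ≤ (1 - c) * p * (bohrB s * (1 - (1 - c) * (p * J))) := by gcongr
        _ = _ := by ring
    exact le_of_mul_le_mul_right e2 hu
  have : gc * Real.exp y ≤ (1 + p * (c * s) + c ^ 2 * R) * Real.exp y := by gcongr
  -- The R-terms contribute (c² e^y - 1)R ≤ 0; the linear terms leave pcs - ps = -(1 - c)ps, which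
  -- combines with `hmain`.
  nlinarith [mul_le_mul_of_nonneg_right hR2 hR]

/-! ### Comparison of two solutions of first-order equations -/

variable {φ w ω G H : ℂ → ℂ} {s p : ℝ}

/-- Induction on a^{n+1} - b^{n+1} = a(a^n - b^n) + (a - b)b^n. -/
theorem majorant_pow_sub_pow_le {a b : ℂ → ℂ} {ρ : ℝ} (ha : DifferentiableOn ℂ a unitDisk)
    (hb : DifferentiableOn ℂ b unitDisk) (h0 : 0 ≤ s) (h1 : s < 1) (ha1 : majorant a s ≤ s)
    (hb1 : majorant b s ≤ s) (hab : majorant (fun z => a z - b z) s ≤ ρ) (n : ℕ) :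
    majorant (fun z => a z ^ n - b z ^ n) s ≤ n * s ^ (n - 1) * ρ := by
  have hρ : 0 ≤ ρ := (majorant_nonneg h0).trans hab
  induction n with
  | zero => simp [majorant_const]
  | succ n ih =>
    have e : (fun z => a z ^ (n + 1) - b z ^ (n + 1)) =
        fun z => a z * (a z ^ n - b z ^ n) + (a z - b z) * b z ^ n := by
      ext z; ring
    have hd1 : DifferentiableOn ℂ (fun z => a z ^ n - b z ^ n) unitDisk :=
      (ha.fun_pow n).fun_sub (hb.fun_pow n)
    have hd2 : DifferentiableOn ℂ (fun z => a z - b z) unitDisk := ha.fun_sub hb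
    rw [e]
    refine (majorant_add_le (ha.fun_mul hd1) (hd2.fun_mul (hb.fun_pow n)) h0 h1).trans ?_
    have k1 := majorant_mul_le ha hd1 h0 h1
    have k2 := majorant_mul_le hd2 (hb.fun_pow n) h0 h1
    have k3 : majorant (fun z => b z ^ n) s ≤ s ^ n :=
      (majorant_pow_le hb h0 h1 n).trans (by have := majorant_nonneg (f := b) h0; gcongr)
    have k4 : majorant a s * majorant (fun z => a z ^ n - b z ^ n) s ≤
        s * (n * s ^ (n - 1) * ρ) := by
      have := majorant_nonneg (f := fun z => a z ^ n - b z ^ n) h0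
      gcongr
    have k5 : majorant (fun z => a z - b z) s * majorant (fun z => b z ^ n) s ≤ ρ * s ^ n := by
      have := majorant_nonneg (f := fun z => b z ^ n) h0
      gcongr
    have e2 : s * (n * s ^ (n - 1) * ρ) = n * s ^ n * ρ := by
      rcases n with _ | n
      · simp
      · simp only [Nat.add_sub_cancel, pow_succ]; ring
    rw [Nat.add_sub_cancel]
    push_cast
    linarith

/-- The majorant of `φ ∘ w - φ(c₀ z)`, where `w(z) = z ω(z)` and `c₀ = ω(0)`. -/
theorem majorant_comp_sub_comp_mul_le (hφ : DifferentiableOn ℂ φ unitDisk) (hp : 0 ≤ p)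
    (hφp : ∀ n, n ≠ 0 → ‖taylorCoeff φ n‖ ≤ n * p) (hw : IsSchwarzFun w)
    (hω : DifferentiableOn ℂ ω unitDisk) (hω1 : ∀ z ∈ unitDisk, ‖ω z‖ ≤ 1)
    (hwω : ∀ z, w z = z * ω z) (h0 : 0 < s) (h1 : s ≤ 1 / 3) :
    majorant (fun z => φ (w z) - φ (ω 0 * z)) s ≤
      s * (2 * (1 - ‖ω 0‖) * p * (s * (1 + s) / (1 - s) ^ 4)) := by
  have hs1 : s < 1 := by linarith
  have hc1 : ‖ω 0‖ ≤ 1 := hω1 0 zero_mem_unitDisk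
  have hlin : DifferentiableOn ℂ (fun z => ω 0 * z) unitDisk := by fun_prop
  have hid : majorant (fun z : ℂ => z) s = s := by
    have := majorant_id_mul (f := fun _ => 1) (differentiableOn_const _) h0.le hs1
    simpa [majorant_const] using this
  have hb1 : majorant (fun z => ω 0 * z) s ≤ s := by
    rw [majorant_const_mul (f := fun z => z) _ differentiableOn_id, hid]
    nlinarith
  -- Bound for w - ω(0)z = z(ω - ω(0)), from the coefficient estimate for a function bounded by 1.
  set ρ := s * (2 * (1 - ‖ω 0‖) * (s / (1 - s))) with hρ
  have hab : majorant (fun z => w z - ω 0 * z) s ≤ ρ := by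
    have e : (fun z => w z - ω 0 * z) = fun z => z * (ω z - ω 0) := by
      ext z; rw [hwω]; ring
    rw [e, majorant_id_mul (hω.fun_sub (differentiableOn_const _)) h0.le hs1]
    exact mul_le_mul_of_nonneg_left (majorant_sub_apply_zero_le hω hω1 h0.le hs1) h0.le
  have hρ0 : 0 ≤ ρ := (majorant_nonneg h0.le).trans hab
  -- One factor n comes from the coefficients of φ, the other from the difference of n-th powers.
  have hsum := ((hasSum_sq_mul_geometric h0.le hs1).mul_left (p * ρ))
  have key := majorant_le_tsum (s := s) (f := fun z => φ (w z) - φ (ω 0 * z))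
    (F := fun n z => taylorCoeff φ n * (w z ^ n - (ω 0 * z) ^ n))
    (B := fun n : ℕ => p * ρ * ((n : ℝ) * (n * s ^ (n - 1))))
    (fun n => ((hw.holo.fun_pow n).fun_sub (hlin.fun_pow n)).const_mul _) h0 hs1
    ((hw.comp_holo hφ).fun_sub (hφ.comp_mul_unitDisk hc1)) (fun z hz => ?_) (fun n => ?_)
    hsum.summable
  · rw [hsum.tsum_eq] at key
    refine key.trans_eq ?_
    have : 1 - s ≠ 0 := by linarith
    rw [hρ]
    field_simp
  · have hz := mem_unitDisk.2 (hz.trans hs1)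
    have := (hasSum_taylorCoeff hφ (hw.mapsTo hz)).sub
      (hasSum_taylorCoeff hφ (mul_mem_unitDisk hc1 hz))
    simpa only [mul_sub] using this
  · rw [majorant_const_mul _ ((hw.holo.fun_pow n).fun_sub (hlin.fun_pow n))]
    rcases eq_or_ne n 0 with rfl | hn
    · simp [majorant_const]
    have k := majorant_pow_sub_pow_le hw.holo hlin h0.le hs1 (hw.majorant_le h0.le h1) hb1 hab n
    calc _ ≤ (n * p) * (n * s ^ (n - 1) * ρ) := by
          have := majorant_nonneg (f := fun z => w z ^ n - (ω 0 * z) ^ n) h0.le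
          gcongr
          exact hφp n hn
      _ = _ := by ring

/-- Growth of the majorant of `H` relative to that of `G(c₀ z)` when
`z G' = φ G`, `z H' = (φ ∘ w) H`. -/
theorem majorant_le_mul_exp (hφ : DifferentiableOn ℂ φ unitDisk) (hp : 0 ≤ p)
    (hφp : ∀ n, n ≠ 0 → ‖taylorCoeff φ n‖ ≤ n * p) (hw : IsSchwarzFun w)
    (hω : DifferentiableOn ℂ ω unitDisk) (hω1 : ∀ z ∈ unitDisk, ‖ω z‖ ≤ 1)
    (hwω : ∀ z, w z = z * ω z)
    (hG : DifferentiableOn ℂ G unitDisk) (hG0 : G 0 = 1) (hGne : ∀ z ∈ unitDisk, G z ≠ 0)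
    (hGe : ∀ z ∈ unitDisk, z * deriv G z = φ z * G z)
    (hH : DifferentiableOn ℂ H unitDisk) (hH0 : H 0 = 1)
    (hHe : ∀ z ∈ unitDisk, z * deriv H z = φ (w z) * H z) (h0 : 0 ≤ s) (h1 : s ≤ 1 / 3) :
    majorant H s ≤ majorant G (‖ω 0‖ * s) * Real.exp (2 * (1 - ‖ω 0‖) * p * bohrJ s) := by
  have hs1 : s < 1 := by linarith
  have hc1 : ‖ω 0‖ ≤ 1 := hω1 0 zero_mem_unitDisk
  set k := 2 * (1 - ‖ω 0‖) * p with hk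
  have hGc : DifferentiableOn ℂ (fun z => G (ω 0 * z)) unitDisk := hG.comp_mul_unitDisk hc1
  have hGcne : ∀ z ∈ unitDisk, G (ω 0 * z) ≠ 0 := fun z hz => hGne _ (mul_mem_unitDisk hc1 hz)
  -- Dividing by G(ω(0)z) removes the part of φ ∘ w that comes from the linear term of w; what is
  -- left carries the factor 1 - |ω(0)|.
  let E : ℂ → ℂ := fun z => H z / G (ω 0 * z)
  have hE : DifferentiableOn ℂ E unitDisk := hH.fun_div hGc hGcne
  have hE0 : E 0 = 1 := by simp [E, hH0, hG0]
  have hEe : ∀ z ∈ unitDisk, z * deriv E z = (φ (w z) - φ (ω 0 * z)) * E z := by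
    intro z hz
    have dH := (hH.differentiableAt (unitDisk_mem_nhds hz)).hasDerivAt
    have hcz := mul_mem_unitDisk hc1 hz
    have dG := (hG.differentiableAt (unitDisk_mem_nhds hcz)).hasDerivAt
    have dGc : HasDerivAt (fun z => G (ω 0 * z)) (deriv G (ω 0 * z) * (ω 0 * 1)) z :=
      dG.comp z ((hasDerivAt_id z).const_mul (ω 0))
    have dE : HasDerivAt E _ z := dH.div dGc (hGcne z hz)
    rw [dE.deriv]
    have a := hGe _ hcz
    have b := hHe z hz
    have hne := hGcne z hz
    simp only [E]
    generalize deriv G (ω 0 * z) = g' at *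
    generalize φ (ω 0 * z) = q at *
    generalize G (ω 0 * z) = g at *
    field_simp
    linear_combination g * b - H z * a
  have hder : ∀ t, 0 < t → t ≤ 1 / 3 →
      majorant (deriv E) t ≤ k * (t * (1 + t) / (1 - t) ^ 4) * majorant E t := by
    intro t ht0 ht1
    have ht : t < 1 := by linarith
    have e := majorant_id_mul (hE.deriv isOpen_unitDisk) ht0.le ht
    rw [majorant_congr (g := fun z => (φ (w z) - φ (ω 0 * z)) * E z) hEe] at e
    have m := majorant_mul_le ((hw.comp_holo hφ).fun_sub (hφ.comp_mul_unitDisk hc1)) hE ht0.le ht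
    have m2 := majorant_comp_sub_comp_mul_le hφ hp hφp hw hω hω1 hwω ht0 ht1
    rw [e] at m
    have m3 := m.trans (mul_le_mul_of_nonneg_right m2 (majorant_nonneg (f := E) ht0.le))
    rw [mul_assoc] at m3
    exact le_of_mul_le_mul_left m3 ht0
  -- Grönwall: `hder` reads Ê' ≤ k J' Ê, so Ê e^{-kJ} decreases from its value 1 at 0.
  have hanti : AntitoneOn (fun t => majorant E t * Real.exp (-(k * bohrJ t))) (Icc 0 (1 / 3)) := by
    have hJd : ∀ t ∈ Icc (0 : ℝ) (1 / 3), HasDerivAt bohrJ (t * (1 + t) / (1 - t) ^ 4) t :=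
      fun t ht => hasDerivAt_bohrJ (by linarith [ht.2])
    have hder2 : ∀ t ∈ Ioo (0 : ℝ) (1 / 3), HasDerivAt
        (fun t => majorant E t * Real.exp (-(k * bohrJ t)))
        (majorant (deriv E) t * Real.exp (-(k * bohrJ t)) + majorant E t *
          (Real.exp (-(k * bohrJ t)) * (-(k * (t * (1 + t) / (1 - t) ^ 4))))) t :=
      fun t ht => (hasDerivAt_majorant hE ht.1 (by linarith [ht.2])).mul
        ((hJd t (Ioo_subset_Icc_self ht)).const_mul k).neg.exp
    refine antitoneOn_of_deriv_nonpos (convex_Icc _ _) ?_ ?_ ?_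
    · refine ((continuousOn_majorant hE).mono ?_).mul
        (Real.continuous_exp.comp_continuousOn (ContinuousOn.neg (continuousOn_const.mul ?_)))
      · exact fun t ht => ⟨ht.1, by linarith [ht.2]⟩
      · exact fun t ht => (hJd t ht).continuousAt.continuousWithinAt
    · rw [interior_Icc]
      exact fun t ht => (hder2 t ht).differentiableAt.differentiableWithinAt
    · rw [interior_Icc]
      intro t ht
      rw [(hder2 t ht).deriv]
      nlinarith [hder t ht.1 ht.2.le, Real.exp_pos (-(k * bohrJ t))]
  have hEs : majorant E s ≤ Real.exp (k * bohrJ s) := by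
    have := hanti (left_mem_Icc.2 (by norm_num)) ⟨h0, h1⟩ h0
    simp only [majorant_zero, hE0, norm_one, one_mul] at this
    rw [show bohrJ 0 = 0 by simp [bohrJ], mul_zero, neg_zero, Real.exp_zero, Real.exp_neg,
      ← div_eq_mul_inv, div_le_one (Real.exp_pos _)] at this
    exact this
  have hHE : EqOn H (fun z => G (ω 0 * z) * E z) unitDisk := fun z hz => by
    have := hGcne z hz
    simp only [E]; field_simp
  have hGm : majorant (fun z => G (ω 0 * z)) s = majorant G (‖ω 0‖ * s) := by
    simp only [majorant, taylorCoeff_comp_mul hG hc1, norm_mul, norm_pow, mul_pow, mul_assoc]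
  rw [majorant_congr hHE, ← hGm]
  refine (majorant_mul_le hGc hE h0 hs1).trans ?_
  have := majorant_nonneg (f := fun z => G (ω 0 * z)) h0
  gcongr

/-- Split Ĝ(s) = 1 + ps + R, with R collecting the orders from 2 on. Since c^{n+2} ≤ c², Ĝ(cs) ≤ 1 +
pcs + c²R, the form in which `mul_exp_bohrJ_sub_le` uses it. -/
theorem majorant_sub_majorant_le (hφ : DifferentiableOn ℂ φ unitDisk) (hp : 0 ≤ p) (hp2 : p ≤ 2)
    (hφp : ∀ n, n ≠ 0 → ‖taylorCoeff φ n‖ ≤ n * p) (hw : IsSchwarzFun w)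
    (hω : DifferentiableOn ℂ ω unitDisk) (hω1 : ∀ z ∈ unitDisk, ‖ω z‖ ≤ 1)
    (hwω : ∀ z, w z = z * ω z)
    (hG : DifferentiableOn ℂ G unitDisk) (hG0 : G 0 = 1) (hGne : ∀ z ∈ unitDisk, G z ≠ 0)
    (hGe : ∀ z ∈ unitDisk, z * deriv G z = φ z * G z) (hG1 : ‖taylorCoeff G 1‖ = p)
    (hH : DifferentiableOn ℂ H unitDisk) (hH0 : H 0 = 1)
    (hHe : ∀ z ∈ unitDisk, z * deriv H z = φ (w z) * H z) (h0 : 0 ≤ s) (h1 : s ≤ 1 / 3) :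
    majorant H s - majorant G s ≤ (1 - ‖ω 0‖) * p * (bohrB s - s) := by
  have hs1 : s < 1 := by linarith
  have hc1 : ‖ω 0‖ ≤ 1 := hω1 0 zero_mem_unitDisk
  have hc0 : 0 ≤ ‖ω 0‖ := norm_nonneg _
  have hexp : ∀ t, 0 ≤ t → t < 1 → majorant G t = 1 + p * t +
      ∑' n : ℕ, ‖taylorCoeff G (n + 2)‖ * t ^ (n + 2) := by
    intro t ht0 ht1
    rw [majorant, ← (summable_taylorCoeff hG ht0 ht1).sum_add_tsum_nat_add 2,
      Finset.sum_range_succ, Finset.sum_range_one, hG1, taylorCoeff_zero, hG0]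
    simp
  have hcs0 : 0 ≤ ‖ω 0‖ * s := by positivity
  have hcs1 : ‖ω 0‖ * s < 1 := by nlinarith
  refine (sub_le_sub_right (majorant_le_mul_exp hφ hp hφp hw hω hω1 hwω hG hG0 hGne hGe hH hH0 hHe
    h0 h1) _).trans ?_
  rw [hexp s h0 hs1]
  refine mul_exp_bohrJ_sub_le h0 h1 hc0 hc1 hp hp2 (tsum_nonneg fun _ => by positivity) ?_
  rw [hexp _ hcs0 hcs1, ← tsum_mul_left]
  refine add_le_add_right (Summable.tsum_le_tsum (fun n => ?_)
    ((summable_nat_add_iff 2).2 (summable_taylorCoeff hG hcs0 hcs1))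
    (((summable_nat_add_iff 2).2 (summable_taylorCoeff hG h0 hs1)).mul_left _)) _
  · rw [mul_pow, mul_left_comm]
    exact mul_le_mul_of_nonneg_right (pow_le_pow_of_le_one hc0 hc1 (Nat.le_add_left 2 n))
      (by positivity)

/-- Integrated comparison: if `f₀' = G`, `f' = H` then `f̂(r) ≤ f̂₀(r)` for `r ≤ 1/3`. -/
theorem majorant_le_majorant {f f₀ : ℂ → ℂ} {r : ℝ} (hφ : DifferentiableOn ℂ φ unitDisk)
    (hp : 0 ≤ p) (hp2 : p ≤ 2)
    (hφp : ∀ n, n ≠ 0 → ‖taylorCoeff φ n‖ ≤ n * p) (hw : IsSchwarzFun w)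
    (hf₀ : IsNormalized f₀) (hf₀ne : ∀ z ∈ unitDisk, deriv f₀ z ≠ 0)
    (hf₀e : ∀ z ∈ unitDisk, z * deriv (deriv f₀) z = φ z * deriv f₀ z)
    (hf₀1 : ‖taylorCoeff (deriv f₀) 1‖ = p) (hf : IsNormalized f)
    (hfe : ∀ z ∈ unitDisk, z * deriv (deriv f) z = φ (w z) * deriv f z)
    (h0 : 0 ≤ r) (h1 : r ≤ 1 / 3) : majorant f r ≤ majorant f₀ r := by
  have hr1 : r < 1 := by linarith
  obtain ⟨ω, hω, hω1, hwω⟩ := hw.exists_eq_mul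
  have hG := hf₀.holo.deriv isOpen_unitDisk
  have hH := hf.holo.deriv isOpen_unitDisk
  have hc1 : ‖ω 0‖ ≤ 1 := hω1 0 zero_mem_unitDisk
  rw [majorant_eq_integral hf.holo h0 hr1, majorant_eq_integral hf₀.holo h0 hr1, hf.zero, hf₀.zero]
  have i1 := intervalIntegrable_majorant hH h0 hr1
  have i2 := intervalIntegrable_majorant hG h0 hr1
  have key : (∫ u in (0 : ℝ)..r, majorant (deriv f) u) - (∫ u in (0 : ℝ)..r, majorant (deriv f₀) u)
      ≤ ∫ u in (0 : ℝ)..r, (1 - ‖ω 0‖) * p * (bohrB u - u) := by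
    rw [← intervalIntegral.integral_sub i1 i2]
    refine intervalIntegral.integral_mono_on h0 (i1.sub i2)
      (Continuous.intervalIntegrable (by unfold bohrB; fun_prop) _ _) (fun u hu => ?_)
    exact majorant_sub_majorant_le hφ hp hp2 hφp hw hω hω1 hwω hG hf₀.deriv_zero hf₀ne hf₀e hf₀1 hH
      hf.deriv_zero hfe hu.1 (hu.2.trans h1)
  rw [intervalIntegral.integral_const_mul] at key
  have := integral_bohrB_sub_le h0 h1
  nlinarith [mul_nonneg (sub_nonneg.2 hc1) hp]

end Comparison

/-! ### Univalent functions and the Ma-Minda function `ψ` -/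

section Univalent

variable {f : ℂ → ℂ}

theorem isPreconnected_unitDisk : IsPreconnected unitDisk := (convex_ball _ _).isPreconnected

theorem not_eventually_const_of_injOn (hi : InjOn f unitDisk) {a : ℂ} (ha : a ∈ unitDisk) :
    ¬ ∀ᶠ z in 𝓝 a, f z = f a := by
  intro h
  have h2 : ∀ᶠ z in 𝓝 a, z = a := by
    filter_upwards [h, unitDisk_mem_nhds ha] with z hz hzD using hi hzD ha hz
  obtain ⟨z, hz⟩ := ((h2.filter_mono nhdsWithin_le_nhds).and
    (self_mem_nhdsWithin : {a}ᶜ ∈ 𝓝[≠] a)).exists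
  exact hz.2 hz.1

theorem nhds_le_map_nhds_of_injOn (hf : DifferentiableOn ℂ f unitDisk) (hi : InjOn f unitDisk)
    {a : ℂ} (ha : a ∈ unitDisk) : 𝓝 (f a) ≤ map f (𝓝 a) :=
  (hf.analyticAt (unitDisk_mem_nhds ha)).eventually_constant_or_nhds_le_map_nhds.resolve_left
    (not_eventually_const_of_injOn hi ha)

theorem image_mem_nhds_of_injOn (hf : DifferentiableOn ℂ f unitDisk) (hi : InjOn f unitDisk)
    {a : ℂ} (ha : a ∈ unitDisk) {V : Set ℂ} (hV : V ∈ 𝓝 a) : f '' V ∈ 𝓝 (f a) :=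
  nhds_le_map_nhds_of_injOn hf hi ha (image_mem_map hV)

/-- The inverse of a univalent function is holomorphic. -/
theorem exists_holomorphic_inverse (hf : DifferentiableOn ℂ f unitDisk) (hi : InjOn f unitDisk) :
    ∃ g : ℂ → ℂ, (∀ b ∈ f '' unitDisk, DifferentiableAt ℂ g b) ∧ ∀ z ∈ unitDisk, g (f z) = z := by
  let g := Function.invFunOn f unitDisk
  have hgf : ∀ z ∈ unitDisk, g (f z) = z := fun z hz => hi.leftInvOn_invFunOn hz
  have hcont : ∀ a ∈ unitDisk, ContinuousAt g (f a) := by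
    intro a ha V hV
    rw [hgf a ha] at hV
    refine mem_map.2 (mem_of_superset
      (image_mem_nhds_of_injOn hf hi ha (inter_mem hV (unitDisk_mem_nhds ha))) ?_)
    rintro _ ⟨x, hx, rfl⟩
    rw [mem_preimage, hgf x hx.2]
    exact hx.1
  have hreg : ∀ a ∈ unitDisk, deriv f a ≠ 0 → DifferentiableAt ℂ g (f a) := by
    intro a ha hda
    have hd := (hf.differentiableAt (unitDisk_mem_nhds ha)).hasDerivAt
    refine (HasDerivAt.of_local_left_inverse (f := f) (f' := deriv f a) (hcont a ha)
      (by rwa [hgf a ha]) hda ?_).differentiableAt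
    filter_upwards [image_mem_nhds_of_injOn hf hi ha (unitDisk_mem_nhds ha)] with y hy
    obtain ⟨x, hx, rfl⟩ := hy
    rw [hgf x hx]
  refine ⟨g, ?_, hgf⟩
  rintro _ ⟨a, ha, rfl⟩
  -- Possible zeros of f' need not be excluded: they are isolated, since otherwise f would be
  -- locally constant, and the continuous inverse extends analytically across their images.
  refine (Complex.analyticAt_of_differentiable_on_punctured_nhds_of_continuousAt ?_
    (hcont a ha)).differentiableAt
  have hda : AnalyticAt ℂ (deriv f) a := (hf.analyticAt (unitDisk_mem_nhds ha)).deriv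
  have hne : ∀ᶠ x in 𝓝[≠] a, deriv f x ≠ 0 := by
    refine hda.eventually_eq_zero_or_eventually_ne_zero.resolve_left fun h0 => ?_
    refine not_eventually_const_of_injOn hi ha ?_
    obtain ⟨ε, hε, hball⟩ := Metric.eventually_nhds_iff_ball.1
      (h0.and (unitDisk_mem_nhds ha))
    filter_upwards [ball_mem_nhds a hε] with z hz
    exact isOpen_ball.is_const_of_deriv_eq_zero (convex_ball a ε).isPreconnected
      (hf.mono fun x hx => (hball x hx).2) (fun x hx => (hball x hx).1) hz (mem_ball_self hε)
  rw [eventually_nhdsWithin_iff] at hne ⊢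
  filter_upwards [image_mem_nhds_of_injOn hf hi ha (inter_mem hne (unitDisk_mem_nhds ha))] with y hy
  obtain ⟨x, hx, rfl⟩ := hy
  intro hxa
  exact hreg x hx.2 (hx.1 fun h => hxa (by rw [mem_singleton_iff.1 h]; rfl))

end Univalent

/-! ### Symmetry, monotonicity and coefficients of ψ -/

section MaMinda

variable {ψ : ℂ → ℂ}

theorem IsMaMinda.deriv_zero_eq (hψ : IsMaMinda ψ) : deriv ψ 0 = ((deriv ψ 0).re : ℂ) := by
  apply Complex.ext <;> simp [hψ.deriv_im]

/-- With χ(z) the conjugate of ψ(z̄), the symmetry of the image makes σ = ψ⁻¹ ∘ χ a self-map of the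
disk fixing 0. As ψ'(0) is real, σ'(0) = 1, and equality in Schwarz's lemma forces σ(z) = z. -/
theorem IsMaMinda.conj_apply (hψ : IsMaMinda ψ) {z : ℂ} (hz : z ∈ unitDisk) :
    ψ ((starRingEnd ℂ) z) = (starRingEnd ℂ) (ψ z) := by
  obtain ⟨g, hg, hgψ⟩ := exists_holomorphic_inverse hψ.holo hψ.univalent
  set χ : ℂ → ℂ := fun z => (starRingEnd ℂ) (ψ ((starRingEnd ℂ) z)) with hχ
  have hχim : ∀ z ∈ unitDisk, χ z ∈ ψ '' unitDisk := fun z hz =>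
    hψ.symm _ (mem_image_of_mem _ (conj_mem_unitDisk hz))
  have hχd : ∀ z ∈ unitDisk, DifferentiableAt ℂ χ z := fun z hz => by
    have := (hψ.holo.differentiableAt (unitDisk_mem_nhds (conj_mem_unitDisk hz))).conj_conj
    rw [Complex.conj_conj] at this
    exact this
  have hχ0 : χ 0 = 1 := by simp [hχ, hψ.at_zero]
  let σ : ℂ → ℂ := fun z => g (χ z)
  have hψσ : ∀ z ∈ unitDisk, σ z ∈ unitDisk ∧ ψ (σ z) = χ z := by
    intro z hz
    obtain ⟨x, hx, hxz⟩ := hχim z hz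
    have : σ z = x := by simp only [σ]; rw [← hxz, hgψ x hx]
    rw [this]; exact ⟨hx, hxz⟩
  have hσd : DifferentiableOn ℂ σ unitDisk := fun z hz =>
    ((hg _ (hχim z hz)).comp z (hχd z hz)).differentiableWithinAt
  have hσ0 : σ 0 = 0 := by
    simp only [σ]
    rw [hχ0, ← hψ.at_zero, hgψ 0 zero_mem_unitDisk]
  have hσ1 : deriv σ 0 = 1 := by
    have e : (fun z => ψ (σ z)) =ᶠ[𝓝 0] χ := by
      filter_upwards [unitDisk_mem_nhds zero_mem_unitDisk] with z hz using (hψσ z hz).2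
    have d1 : HasDerivAt (fun z => ψ (σ z)) (deriv ψ (σ 0) * deriv σ 0) 0 := by
      refine HasDerivAt.comp (0 : ℂ) ?_
        (hσd.differentiableAt (unitDisk_mem_nhds zero_mem_unitDisk)).hasDerivAt
      rw [hσ0]
      exact (hψ.holo.differentiableAt (unitDisk_mem_nhds zero_mem_unitDisk)).hasDerivAt
    have d2 : HasDerivAt χ ((starRingEnd ℂ) (deriv ψ 0)) 0 := by
      have := (hψ.holo.differentiableAt (unitDisk_mem_nhds zero_mem_unitDisk)).hasDerivAt.conj_conj
      rw [map_zero] at this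
      exact this
    have h := d1.deriv.symm.trans (e.deriv_eq.trans d2.deriv)
    have hp : deriv ψ 0 ≠ 0 := fun h0 => by have := hψ.deriv_re_pos; simp [h0] at this
    rw [hσ0, hψ.deriv_zero_eq, Complex.conj_ofReal, ← hψ.deriv_zero_eq] at h
    exact mul_left_cancel₀ hp (by rw [h, mul_one])
  have hmaps : MapsTo σ (ball 0 1) (closedBall (σ 0) 1) := fun z hz => by
    rw [hσ0]; exact ball_subset_closedBall (hψσ z hz).1
  have hid := Complex.affine_of_mapsTo_ball_of_norm_dslope_eq_div hσd hmaps
    zero_mem_unitDisk (by rw [dslope_same, hσ1]; simp)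
  have hz2 := hid hz
  simp only [hσ0, dslope_same, hσ1, sub_zero, zero_add, smul_eq_mul, mul_one] at hz2
  have h3 := (hψσ z hz).2
  rw [hz2] at h3
  rw [h3, hχ]
  simp

theorem IsMaMinda.isReal_of_im_eq_zero (hψ : IsMaMinda ψ) {z : ℂ} (hz : z ∈ unitDisk)
    (h : (ψ z).im = 0) : z.im = 0 := by
  have h1 : ψ ((starRingEnd ℂ) z) = ψ z := by
    rw [hψ.conj_apply hz]; exact Complex.conj_eq_iff_im.2 h
  exact Complex.conj_eq_iff_im.1 (hψ.univalent (conj_mem_unitDisk hz) hz h1)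

theorem IsMaMinda.im_eq_zero (hψ : IsMaMinda ψ) {z : ℂ} (hz : z ∈ unitDisk)
    (h : z.im = 0) : (ψ z).im = 0 := by
  have h1 := hψ.conj_apply hz
  rw [Complex.conj_eq_iff_im.2 h] at h1
  exact Complex.conj_eq_iff_im.1 h1.symm

theorem HasDerivAt.eventually_lt_of_pos {g : ℝ → ℝ} {d x : ℝ} (h : HasDerivAt g d x) (hd : 0 < d) :
    ∀ᶠ t in 𝓝[>] (0 : ℝ), g x < g (x + t) := by
  filter_upwards [h.tendsto_slope_zero_right.eventually (lt_mem_nhds hd), self_mem_nhdsWithin]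
    with t ht ht0
  have ht0 : 0 < t := ht0
  rw [smul_eq_mul] at ht
  have := (mul_pos_iff_of_pos_left (inv_pos.2 ht0)).1 ht
  linarith

/-- Im ψ has no zero on the connected upper half-disk, since by univalence ψ is real only at real
points. It is positive at small it because ψ'(0) > 0, so a negative value would contradict the
intermediate value theorem; conjugation treats the lower half. -/
theorem IsMaMinda.im_mul_im_nonneg (hψ : IsMaMinda ψ) {z : ℂ} (hz : z ∈ unitDisk) :
    0 ≤ (ψ z).im * z.im := by
  have upper : ∀ z ∈ unitDisk, 0 < z.im → 0 ≤ (ψ z).im := by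
    intro z hz hzi
    by_contra hneg
    push Not at hneg
    set U : Set ℂ := unitDisk ∩ {z | 0 < z.im}
    have hU : IsPreconnected U :=
      ((convex_ball (0 : ℂ) 1).inter (convex_halfSpace_im_gt 0)).isPreconnected
    have hd : HasDerivAt (fun t : ℝ => (ψ (t * Complex.I)).im) (deriv ψ 0).re 0 := by
      have h1 : HasDerivAt ψ (deriv ψ 0) (((0 : ℝ) : ℂ) * Complex.I) := by
        simpa using (hψ.holo.differentiableAt (unitDisk_mem_nhds zero_mem_unitDisk)).hasDerivAt
      have h2 : HasDerivAt (fun t : ℝ => (t : ℂ) * Complex.I) (1 * Complex.I) (0 : ℝ) :=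
        Complex.ofRealCLM.hasDerivAt.mul_const Complex.I
      have h3 := Complex.imCLM.hasFDerivAt.comp_hasDerivAt (0 : ℝ) (h1.comp (0 : ℝ) h2)
      refine h3.congr_deriv ?_
      simp
    have hev := hd.eventually_lt_of_pos hψ.deriv_re_pos
    obtain ⟨t, ht, ht0⟩ := (hev.and (Ioo_mem_nhdsGT (zero_lt_one' ℝ))).exists
    have h0 : (ψ (((0 : ℝ) : ℂ) * Complex.I)).im = 0 := by simp [hψ.at_zero]
    rw [h0, zero_add] at ht
    have htU : (t : ℂ) * Complex.I ∈ U := by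
      refine ⟨?_, by simpa using ht0.1⟩
      rw [mem_unitDisk, norm_mul, Complex.norm_I, Complex.norm_real, mul_one,
        Real.norm_of_nonneg ht0.1.le]
      exact ht0.2
    obtain ⟨x, hxU, hx⟩ := hU.intermediate_value₂ ⟨hz, hzi⟩ htU
      (f := fun z => (ψ z).im) (g := fun _ => 0)
      (Complex.continuous_im.comp_continuousOn (hψ.holo.continuousOn.mono inter_subset_left))
      continuousOn_const hneg.le ht.le
    have : 0 < x.im := hxU.2
    have := hψ.isReal_of_im_eq_zero hxU.1 hx
    linarith
  rcases lt_trichotomy z.im 0 with h | h | h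
  · have h2 := upper _ (conj_mem_unitDisk hz) (by simpa using h)
    rw [hψ.conj_apply hz, Complex.conj_im] at h2
    exact mul_nonneg_of_nonpos_of_nonpos (by linarith) h.le
  · simp [h]
  · exact mul_nonneg (upper z hz h) h.le

theorem ofReal_mem_unitDisk_of_mem_Ioo {x : ℝ} (hx : x ∈ Ioo (-1 : ℝ) 1) : (x : ℂ) ∈ unitDisk := by
  rw [mem_unitDisk, Complex.norm_real, Real.norm_eq_abs, abs_lt]; exact hx

theorem IsMaMinda.ofReal_re (hψ : IsMaMinda ψ) {x : ℝ} (hx : x ∈ Ioo (-1 : ℝ) 1) :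
    ((ψ x).re : ℂ) = ψ x := by
  apply Complex.ext
  · simp
  · simp [hψ.im_eq_zero (ofReal_mem_unitDisk_of_mem_Ioo hx) (Complex.ofReal_im x)]

/-- On (-1, 1), ψ is real, continuous and injective, hence strictly monotone; ψ'(0) > 0 decides the
direction. -/
theorem IsMaMinda.strictMonoOn (hψ : IsMaMinda ψ) :
    StrictMonoOn (fun x : ℝ => (ψ x).re) (Ioo (-1) 1) := by
  have hc : ContinuousOn (fun x : ℝ => (ψ x).re) (Ioo (-1) 1) :=
    Complex.continuous_re.comp_continuousOn (hψ.holo.continuousOn.comp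
      Complex.continuous_ofReal.continuousOn fun x hx => ofReal_mem_unitDisk_of_mem_Ioo hx)
  have hi : InjOn (fun x : ℝ => (ψ x).re) (Ioo (-1) 1) := by
    intro x hx y hy hxy
    have : ψ x = ψ y := by
      rw [← hψ.ofReal_re hx, ← hψ.ofReal_re hy]; exact congrArg _ hxy
    exact_mod_cast hψ.univalent (ofReal_mem_unitDisk_of_mem_Ioo hx)
      (ofReal_mem_unitDisk_of_mem_Ioo hy) this
  refine (ContinuousOn.strictMonoOn_of_injOn_Ioo (by norm_num) hc hi).resolve_right fun hanti => ?_
  have hd : HasDerivAt (fun t : ℝ => (ψ t).re) (deriv ψ 0).re 0 := by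
    have h1 : HasDerivAt ψ (deriv ψ 0) ((0 : ℝ) : ℂ) := by
      simpa using (hψ.holo.differentiableAt (unitDisk_mem_nhds zero_mem_unitDisk)).hasDerivAt
    exact h1.real_of_complex
  obtain ⟨t, ht, ht0⟩ := ((hd.eventually_lt_of_pos hψ.deriv_re_pos).and
    (Ioo_mem_nhdsGT (zero_lt_one' ℝ))).exists
  rw [zero_add] at ht
  have := hanti (a := 0) (b := t) (by simp) ⟨by linarith [ht0.1], ht0.2⟩ ht0.1
  simp only at this
  linarith

theorem IsMaMinda.sub_one_holo (hψ : IsMaMinda ψ) :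
    DifferentiableOn ℂ (fun z => ψ z - 1) unitDisk := hψ.holo.sub (differentiableOn_const _)

theorem IsMaMinda.deriv_re_le_two (hψ : IsMaMinda ψ) : (deriv ψ 0).re ≤ 2 := by
  have h := norm_taylorCoeff_le_of_re_nonneg hψ.holo (fun z hz => (hψ.re_pos z hz).le) one_ne_zero
  rw [taylorCoeff_one, hψ.at_zero, Complex.one_re, mul_one] at h
  exact (Complex.re_le_norm _).trans h

theorem IsMaMinda.norm_taylorCoeff_sub_one_le (hψ : IsMaMinda ψ) (n : ℕ) (hn : n ≠ 0) :
    ‖taylorCoeff (fun z => ψ z - 1) n‖ ≤ n * (deriv ψ 0).re := by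
  have h := norm_taylorCoeff_le_of_typicallyReal hψ.sub_one_holo (fun z hz => ?_)
    (fun z hz => ?_) hn
  · rwa [taylorCoeff_one, deriv_sub_const] at h
  · simp [hψ.conj_apply hz]
  · simpa using hψ.im_mul_im_nonneg hz

end MaMinda

/-! ### A minimum principle in polar coordinates -/

section Polar

theorem nonpos_of_hasDerivAt_of_le_left {g : ℝ → ℝ} {d : ℝ} (hd : HasDerivAt g d 1)
    (h : ∀ t, 0 < t → t < 1 → g 1 ≤ g t) : d ≤ 0 := by
  refine le_of_tendsto hd.tendsto_slope_zero_left ?_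
  filter_upwards [Ioo_mem_nhdsLT (show (-1 : ℝ) < 0 by norm_num)] with t ht
  have := h (1 + t) (by linarith [ht.1]) (by linarith [ht.2])
  rw [smul_eq_mul]
  exact mul_nonpos_of_nonpos_of_nonneg (inv_nonpos.2 ht.2.le) (by linarith)

theorem norm_mul_exp_mul_I (z : ℂ) (θ : ℝ) : ‖z * Complex.exp (θ * Complex.I)‖ = ‖z‖ := by
  rw [norm_mul, Complex.norm_exp_ofReal_mul_I, mul_one]

/-- If `u` exceeds `m` at the origin and, at every angular critical point where `u ≤ m`, the radial
derivative is positive, then `u > m` on the disk. -/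
theorem lt_of_polar_critical {u A R : ℂ → ℝ} {m : ℝ} (hc : ContinuousOn u unitDisk)
    (hA : ∀ z ∈ unitDisk, z ≠ 0 →
      HasDerivAt (fun θ : ℝ => u (z * Complex.exp (θ * Complex.I))) (A z) 0)
    (hR : ∀ z ∈ unitDisk, z ≠ 0 → HasDerivAt (fun t : ℝ => u (t * z)) (R z) 1)
    (h0 : m < u 0) (h : ∀ z ∈ unitDisk, z ≠ 0 → u z ≤ m → A z = 0 → 0 < R z)
    {z : ℂ} (hz : z ∈ unitDisk) : m < u z := by
  by_contra hle
  push Not at hle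
  have hsub : closedBall (0 : ℂ) ‖z‖ ⊆ unitDisk := fun x hx =>
    mem_unitDisk.2 ((mem_closedBall_zero_iff.1 hx).trans_lt (mem_unitDisk.1 hz))
  -- At a minimum over |x| ≤ |z|, even on its boundary circle, rotations and inward moves are
  -- admissible: the angular derivative vanishes and the radial one is nonpositive.
  obtain ⟨x, hx, hmin⟩ := (isCompact_closedBall (0 : ℂ) ‖z‖).exists_isMinOn
    ⟨z, by simp⟩ (hc.mono hsub)
  have hxD := hsub hx
  have hxm : u x ≤ m := (hmin (by simp : z ∈ closedBall (0 : ℂ) ‖z‖)).trans hle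
  have hx0 : x ≠ 0 := by rintro rfl; linarith
  have hAx : A x = 0 := by
    refine IsLocalMin.hasDerivAt_eq_zero (Eventually.of_forall fun θ => ?_) (hA x hxD hx0)
    have : u x ≤ u (x * Complex.exp (θ * Complex.I)) := hmin (by
      rw [mem_closedBall_zero_iff, norm_mul_exp_mul_I]; exact mem_closedBall_zero_iff.1 hx)
    simpa using this
  have hRx := h x hxD hx0 hxm hAx
  have : R x ≤ 0 := nonpos_of_hasDerivAt_of_le_left (hR x hxD hx0) fun t ht0 ht1 => by
    have : u x ≤ u (t * x) := hmin (by
      rw [mem_closedBall_zero_iff, norm_mul, Complex.norm_real, Real.norm_of_nonneg ht0.le]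
      have := mem_closedBall_zero_iff.1 hx
      nlinarith [norm_nonneg x])
    simpa using this
  linarith

theorem HasDerivAt.comp_rotation {F : ℂ → ℂ} {F' z : ℂ} (h : HasDerivAt F F' z) :
    HasDerivAt (fun θ : ℝ => F (z * Complex.exp (θ * Complex.I))) (F' * (z * Complex.I)) 0 := by
  have h1 : HasDerivAt (fun θ : ℝ => z * Complex.exp (θ * Complex.I)) (z * Complex.I) (0 : ℝ) := by
    have := ((Complex.ofRealCLM.hasDerivAt (x := (0 : ℝ))).mul_const Complex.I).cexp.const_mul z
    simpa using this
  refine HasDerivAt.comp (0 : ℝ) (h₂ := F) ?_ h1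
  simpa using h

theorem HasDerivAt.comp_radial {F : ℂ → ℂ} {F' z : ℂ} (h : HasDerivAt F F' z) :
    HasDerivAt (fun t : ℝ => F (t * z)) (F' * z) 1 := by
  have h1 : HasDerivAt (fun t : ℝ => (t : ℂ) * z) (1 * z) (1 : ℝ) :=
    (Complex.ofRealCLM.hasDerivAt (x := (1 : ℝ))).mul_const z
  rw [one_mul] at h1
  refine HasDerivAt.comp (1 : ℝ) (h₂ := F) ?_ h1
  simpa using h

theorem HasDerivAt.re_complex {γ : ℝ → ℂ} {γ' : ℂ} {t : ℝ} (h : HasDerivAt γ γ' t) :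
    HasDerivAt (fun t => (γ t).re) γ'.re t :=
  Complex.reCLM.hasFDerivAt.comp_hasDerivAt t h

theorem HasDerivAt.norm_complex {γ : ℝ → ℂ} {γ' : ℂ} {t : ℝ} (h : HasDerivAt γ γ' t)
    (hne : γ t ≠ 0) : HasDerivAt (fun t => ‖γ t‖) (‖γ t‖ * (γ' / γ t).re) t := by
  have h1 := h.norm_sq.sqrt (by positivity)
  have hn : ‖γ t‖ ≠ 0 := norm_ne_zero_iff.2 hne
  simp only [Real.sqrt_sq (norm_nonneg _)] at h1
  refine h1.congr_deriv ?_
  have e : Inner.inner ℝ (γ t) γ' = ‖γ t‖ ^ 2 * (γ' / γ t).re := by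
    rw [Complex.inner, Complex.div_re, ← Complex.normSq_eq_norm_sq]
    have hns : Complex.normSq (γ t) ≠ 0 := Complex.normSq_eq_zero.not.2 hne
    simp only [Complex.mul_re, Complex.conj_re, Complex.conj_im]
    field_simp
    ring
  rw [e]
  field_simp

theorem hasDerivAt_radial_comp_norm {q : ℝ → ℝ} {q' : ℝ} {z : ℂ} (h : HasDerivAt q q' ‖z‖) :
    HasDerivAt (fun t : ℝ => q ‖(t : ℂ) * z‖) (q' * ‖z‖) 1 := by
  have h1 : HasDerivAt (fun t : ℝ => t * ‖z‖) (1 * ‖z‖) (1 : ℝ) :=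
    (hasDerivAt_id' (1 : ℝ)).mul_const ‖z‖
  rw [one_mul] at h1
  have h2 : HasDerivAt (fun t : ℝ => q (t * ‖z‖)) (q' * ‖z‖) 1 := by
    refine HasDerivAt.comp (1 : ℝ) (h₂ := q) ?_ h1
    simpa using h
  refine h2.congr_of_eventuallyEq ?_
  filter_upwards [lt_mem_nhds (show (0 : ℝ) < 1 by norm_num)] with t ht
  rw [norm_mul, Complex.norm_real, Real.norm_of_nonneg ht.le]

theorem hasDerivAt_rotation_comp_norm (q : ℝ → ℝ) (z : ℂ) :
    HasDerivAt (fun θ : ℝ => q ‖z * Complex.exp (θ * Complex.I)‖) 0 0 := by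
  simp only [norm_mul_exp_mul_I]
  exact hasDerivAt_const _ _

end Polar

/-! ### The extremal function `f₀` -/

section Extremal

variable {ψ f₀ : ℂ → ℂ}

/-- Arguing on Taylor coefficients avoids dividing by z at the origin. -/
theorem eq_of_forall_mul_deriv_eq_zero {D : ℂ → ℂ} (hD : DifferentiableOn ℂ D unitDisk)
    (h : ∀ z ∈ unitDisk, z * deriv D z = 0) {z : ℂ} (hz : z ∈ unitDisk) : D z = D 0 := by
  have hD' := hD.deriv isOpen_unitDisk
  have hc : ∀ n, taylorCoeff (deriv D) n = 0 := fun n => by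
    rw [← taylorCoeff_id_mul_succ hD', taylorCoeff_congr (g := fun _ => 0) h, taylorCoeff_const,
      if_neg n.succ_ne_zero]
  have hz' : EqOn (deriv D) 0 unitDisk := fun x hx => by
    have := hasSum_taylorCoeff hD' hx
    simp only [hc, zero_mul] at this
    exact this.unique hasSum_zero
  exact isOpen_unitDisk.is_const_of_deriv_eq_zero isPreconnected_unitDisk hD hz' hz zero_mem_unitDisk

theorem mul_deriv_deriv_eq {F : ℂ → ℂ} {z q : ℂ} (hne : deriv F z ≠ 0)
    (h : convexQuotient F z = q) : z * deriv (deriv F) z = (q - 1) * deriv F z := by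
  rw [← h, convexQuotient]; field_simp; ring

/-- Both derivatives solve the same linear equation, so their quotient D satisfies z D' = 0 and is
constantly 1. -/
theorem IsConvexExtremal.eqOn {F : ℂ → ℂ} (hF : IsConvexExtremal ψ F)
    (hf₀ : IsConvexExtremal ψ f₀) : EqOn F f₀ unitDisk := by
  have dF := hF.normalized.holo.deriv isOpen_unitDisk
  have df := hf₀.normalized.holo.deriv isOpen_unitDisk
  have hquot : ∀ z ∈ unitDisk, deriv F z / deriv f₀ z = 1 := by
    intro z hz
    have := eq_of_forall_mul_deriv_eq_zero (D := fun z => deriv F z / deriv f₀ z)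
      (dF.fun_div df hf₀.deriv_ne) (fun x hx => ?_) hz
    · rw [this, hF.normalized.deriv_zero, hf₀.normalized.deriv_zero, div_one]
    · have d1 := (dF.differentiableAt (unitDisk_mem_nhds hx)).hasDerivAt
      have d2 := (df.differentiableAt (unitDisk_mem_nhds hx)).hasDerivAt
      rw [(d1.fun_div d2 (hf₀.deriv_ne x hx)).deriv]
      have e1 := mul_deriv_deriv_eq (hF.deriv_ne x hx) (hF.eqn x hx)
      have e2 := mul_deriv_deriv_eq (hf₀.deriv_ne x hx) (hf₀.eqn x hx)
      rw [← mul_div_assoc, div_eq_zero_iff]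
      left
      linear_combination deriv f₀ x * e1 - deriv F x * e2
  intro z hz
  refine isOpen_unitDisk.eqOn_of_deriv_eq isPreconnected_unitDisk hF.normalized.holo
    hf₀.normalized.holo (fun x hx => ?_) zero_mem_unitDisk
    (by rw [hF.normalized.zero, hf₀.normalized.zero]) hz
  have := hquot x hx
  rwa [div_eq_one_iff_eq (hf₀.deriv_ne x hx)] at this

/-- Explicitly, f₀' = exp(q), where q is the primitive of (ψ - 1)/z vanishing at 0; the quotient is
analytic at 0 because ψ(0) = 1. -/
theorem IsMaMinda.exists_convexExtremal (hψ : IsMaMinda ψ) : ∃ f₀, IsConvexExtremal ψ f₀ := by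
  have hκ : DifferentiableOn ℂ (dslope ψ 0) unitDisk :=
    (Complex.differentiableOn_dslope (unitDisk_mem_nhds zero_mem_unitDisk)).2 hψ.holo
  have hκe : ∀ z, z * dslope ψ 0 z = ψ z - 1 := fun z => by
    have := sub_smul_dslope ψ 0 z
    rwa [sub_zero, smul_eq_mul, hψ.at_zero] at this
  obtain ⟨q, hq0, hq⟩ := (DifferentiableOn.isExactOn_ball hκ).with_val_at 0 0
  have hGd : ∀ z ∈ unitDisk, HasDerivAt (fun z => Complex.exp (q z))
      (Complex.exp (q z) * dslope ψ 0 z) z := fun z hz => (hq z hz).cexp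
  have hG : DifferentiableOn ℂ (fun z => Complex.exp (q z)) (ball 0 1) := fun z hz =>
    (hGd z hz).differentiableAt.differentiableWithinAt
  obtain ⟨f, hf0, hf⟩ := (DifferentiableOn.isExactOn_ball hG).with_val_at 0 0
  have hd : ∀ z ∈ unitDisk, deriv f z = Complex.exp (q z) := fun z hz => (hf z hz).deriv
  have hdd : ∀ z ∈ unitDisk, deriv (deriv f) z = Complex.exp (q z) * dslope ψ 0 z := by
    intro z hz
    have e : deriv f =ᶠ[𝓝 z] fun z => Complex.exp (q z) := by
      filter_upwards [unitDisk_mem_nhds hz] with x hx using hd x hx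
    rw [e.deriv_eq, (hGd z hz).deriv]
  refine ⟨f, ⟨⟨fun z hz => (hf z hz).differentiableAt.differentiableWithinAt, hf0, ?_⟩,
    fun z hz => ?_, fun z hz => ?_⟩⟩
  · rw [hd 0 zero_mem_unitDisk, hq0, Complex.exp_zero]
  · rw [hd z hz]; exact Complex.exp_ne_zero _
  · rw [convexQuotient, hd z hz, hdd z hz, mul_div_assoc, mul_div_cancel_left₀ _
      (Complex.exp_ne_zero _), hκe]
    ring

theorem IsConvexExtremal.mul_deriv_deriv (h : IsConvexExtremal ψ f₀) {z : ℂ} (hz : z ∈ unitDisk) :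
    z * deriv (deriv f₀) z = (ψ z - 1) * deriv f₀ z :=
  mul_deriv_deriv_eq (h.deriv_ne z hz) (h.eqn z hz)

/-- The conjugate of f₀(z̄) solves the same problem because ψ has the same symmetry; uniqueness
identifies the two. -/
theorem IsConvexExtremal.conj_apply (hψ : IsMaMinda ψ) (h : IsConvexExtremal ψ f₀) {z : ℂ}
    (hz : z ∈ unitDisk) : f₀ ((starRingEnd ℂ) z) = (starRingEnd ℂ) (f₀ z) := by
  set F : ℂ → ℂ := fun z => (starRingEnd ℂ) (f₀ ((starRingEnd ℂ) z)) with hF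
  have hd : deriv F = fun z => (starRingEnd ℂ) (deriv f₀ ((starRingEnd ℂ) z)) :=
    deriv_conj_conj (f := f₀)
  have hdd : deriv (deriv F) = fun z => (starRingEnd ℂ) (deriv (deriv f₀) ((starRingEnd ℂ) z)) := by
    rw [hd]; exact deriv_conj_conj (f := deriv f₀)
  have hFe : IsConvexExtremal ψ F := by
    refine ⟨⟨fun z hz => ?_, by simp [hF, h.normalized.zero], by simp [hd, h.normalized.deriv_zero]⟩,
      fun z hz => ?_, fun z hz => ?_⟩
    · have := (h.normalized.holo.differentiableAt
        (unitDisk_mem_nhds (conj_mem_unitDisk hz))).conj_conj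
      rw [Complex.conj_conj] at this
      exact this.differentiableWithinAt
    · rw [hd]
      simpa using h.deriv_ne _ (conj_mem_unitDisk hz)
    · have e := congrArg (starRingEnd ℂ) (h.eqn _ (conj_mem_unitDisk hz))
      rw [hψ.conj_apply hz, Complex.conj_conj] at e
      rw [← e, convexQuotient, convexQuotient, hdd, hd]
      simp
  have := h.eqOn hFe (conj_mem_unitDisk hz)
  simpa [hF] using this

theorem IsConvexExtremal.deriv_conj_apply (hψ : IsMaMinda ψ) (h : IsConvexExtremal ψ f₀) {z : ℂ}
    (hz : z ∈ unitDisk) : deriv f₀ ((starRingEnd ℂ) z) = (starRingEnd ℂ) (deriv f₀ z) := by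
  have e : f₀ =ᶠ[𝓝 ((starRingEnd ℂ) z)] fun z => (starRingEnd ℂ) (f₀ ((starRingEnd ℂ) z)) := by
    filter_upwards [unitDisk_mem_nhds (conj_mem_unitDisk hz)] with x hx
    rw [h.conj_apply hψ hx, Complex.conj_conj]
  rw [e.deriv_eq]
  have := congrFun (deriv_conj_conj (f := f₀)) ((starRingEnd ℂ) z)
  simp only [Function.comp_apply, Complex.conj_conj] at this
  exact this

theorem IsConvexExtremal.deriv_ofReal (hψ : IsMaMinda ψ) (h : IsConvexExtremal ψ f₀) {x : ℝ}
    (hx : x ∈ Ioo (-1 : ℝ) 1) : deriv f₀ x = ((deriv f₀ x).re : ℂ) := by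
  have := h.deriv_conj_apply hψ (ofReal_mem_unitDisk_of_mem_Ioo hx)
  rw [Complex.conj_ofReal] at this
  exact (Complex.conj_eq_iff_re.1 this.symm).symm

theorem IsConvexExtremal.apply_ofReal (hψ : IsMaMinda ψ) (h : IsConvexExtremal ψ f₀) {x : ℝ}
    (hx : x ∈ Ioo (-1 : ℝ) 1) : f₀ x = ((f₀ x).re : ℂ) := by
  have := h.conj_apply hψ (ofReal_mem_unitDisk_of_mem_Ioo hx)
  rw [Complex.conj_ofReal] at this
  exact (Complex.conj_eq_iff_re.1 this.symm).symm

/-- On (-1, 1), f₀' is real, never zero, and equal to 1 at the origin. -/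
theorem IsConvexExtremal.deriv_re_pos (hψ : IsMaMinda ψ) (h : IsConvexExtremal ψ f₀) {x : ℝ}
    (hx : x ∈ Ioo (-1 : ℝ) 1) : 0 < (deriv f₀ x).re := by
  by_contra hneg
  push Not at hneg
  have hc : ContinuousOn (fun x : ℝ => (deriv f₀ x).re) (Ioo (-1) 1) :=
    Complex.continuous_re.comp_continuousOn ((h.normalized.holo.deriv
      isOpen_unitDisk).continuousOn.comp Complex.continuous_ofReal.continuousOn
        fun x hx => ofReal_mem_unitDisk_of_mem_Ioo hx)
  have h00 : (0 : ℝ) ∈ Ioo (-1 : ℝ) 1 := by simp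
  obtain ⟨y, hy, hy0⟩ := isPreconnected_Ioo.intermediate_value₂ hx h00 hc
    (g := fun _ => 0) continuousOn_const hneg (by simp [h.normalized.deriv_zero])
  have := h.deriv_ofReal hψ hy
  rw [hy0, Complex.ofReal_zero] at this
  exact h.deriv_ne _ (ofReal_mem_unitDisk_of_mem_Ioo hy) this

theorem IsConvexExtremal.strictMonoOn (hψ : IsMaMinda ψ) (h : IsConvexExtremal ψ f₀) :
    StrictMonoOn (fun x : ℝ => (f₀ x).re) (Ioo (-1) 1) := by
  have hd : ∀ x ∈ Ioo (-1 : ℝ) 1, HasDerivAt (fun x : ℝ => (f₀ x).re) (deriv f₀ x).re x :=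
    fun x hx => (h.normalized.holo.differentiableAt
      (unitDisk_mem_nhds (ofReal_mem_unitDisk_of_mem_Ioo hx))).hasDerivAt.real_of_complex
  refine strictMonoOn_of_deriv_pos (convex_Ioo _ _)
    (fun x hx => (hd x hx).continuousAt.continuousWithinAt) fun x hx => ?_
  rw [interior_Ioo] at hx
  rw [(hd x hx).deriv]
  exact h.deriv_re_pos hψ hx

theorem neg_mem_Ioo_of_mem_Ico {r : ℝ} (hr : r ∈ Ico (0 : ℝ) 1) : -r ∈ Ioo (-1 : ℝ) 1 :=
  ⟨by linarith [hr.2], by linarith [hr.1]⟩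

/-- Derivative of `r ↦ -f₀(-r)`. -/
theorem IsConvexExtremal.hasDerivAt_neg_apply_neg (h : IsConvexExtremal ψ f₀) {r : ℝ}
    (hr : r ∈ Ico (0 : ℝ) 1) :
    HasDerivAt (fun r : ℝ => -(f₀ ((-r : ℝ) : ℂ)).re) (deriv f₀ ((-r : ℝ) : ℂ)).re r := by
  have h1 : HasDerivAt (fun x : ℝ => (f₀ x).re) (deriv f₀ ((-r : ℝ) : ℂ)).re (-r) :=
    (h.normalized.holo.differentiableAt (unitDisk_mem_nhds
      (ofReal_mem_unitDisk_of_mem_Ioo (neg_mem_Ioo_of_mem_Ico hr)))).hasDerivAt.real_of_complex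
  have h2 := (h1.comp r (hasDerivAt_neg r)).neg
  refine h2.congr_deriv ?_
  ring

/-- Derivative of `r ↦ f₀'(-r)`. -/
theorem IsConvexExtremal.hasDerivAt_deriv_neg (hψ : IsMaMinda ψ) (h : IsConvexExtremal ψ f₀) {r : ℝ}
    (hr : r ∈ Ioo (0 : ℝ) 1) :
    HasDerivAt (fun r : ℝ => (deriv f₀ ((-r : ℝ) : ℂ)).re)
      ((deriv f₀ ((-r : ℝ) : ℂ)).re * (((ψ ((-r : ℝ) : ℂ)).re - 1) / r)) r := by
  have hr' := neg_mem_Ioo_of_mem_Ico (Ioo_subset_Ico_self hr)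
  have hD := ofReal_mem_unitDisk_of_mem_Ioo hr'
  have h1 : HasDerivAt (fun x : ℝ => (deriv f₀ x).re) (deriv (deriv f₀) ((-r : ℝ) : ℂ)).re (-r) :=
    ((h.normalized.holo.deriv isOpen_unitDisk).differentiableAt
      (unitDisk_mem_nhds hD)).hasDerivAt.real_of_complex
  have h2 := h1.comp r (hasDerivAt_neg r)
  refine h2.congr_deriv ?_
  have e := h.mul_deriv_deriv hD
  rw [h.deriv_ofReal hψ hr', ← hψ.ofReal_re hr'] at e
  have e2 := congrArg Complex.re e
  rw [Complex.re_ofReal_mul, ← Complex.ofReal_one, ← Complex.ofReal_sub, ← Complex.ofReal_mul,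
    Complex.ofReal_re] at e2
  have hr0 : r ≠ 0 := hr.1.ne'
  field_simp
  linarith

theorem IsConvexExtremal.continuousOn_neg (h : IsConvexExtremal ψ f₀) :
    ContinuousOn (fun r : ℝ => -(f₀ ((-r : ℝ) : ℂ)).re) (Ico 0 1) := fun _ hr =>
  (h.hasDerivAt_neg_apply_neg hr).continuousAt.continuousWithinAt

theorem IsConvexExtremal.continuousOn_deriv_neg (h : IsConvexExtremal ψ f₀) :
    ContinuousOn (fun r : ℝ => (deriv f₀ ((-r : ℝ) : ℂ)).re) (Ico 0 1) :=
  Complex.continuous_re.comp_continuousOn ((h.normalized.holo.deriv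
    isOpen_unitDisk).continuousOn.comp (by fun_prop)
      fun _ hr => ofReal_mem_unitDisk_of_mem_Ioo (neg_mem_Ioo_of_mem_Ico hr))

/-- Since ψ(-r) < ψ(0) = 1, the derivative of r ↦ f₀'(-r) is nonpositive; hence f₀'(-r) ≤ 1, and
integration gives the bound. It makes the radial limit finite, with L ≤ 1. -/
theorem IsConvexExtremal.neg_le (hψ : IsMaMinda ψ) (h : IsConvexExtremal ψ f₀) {r : ℝ}
    (hr : r ∈ Ico (0 : ℝ) 1) : -(f₀ ((-r : ℝ) : ℂ)).re ≤ r := by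
  have hanti : AntitoneOn (fun r : ℝ => (deriv f₀ ((-r : ℝ) : ℂ)).re) (Ico 0 1) := by
    refine antitoneOn_of_deriv_nonpos (convex_Ico _ _) h.continuousOn_deriv_neg ?_ ?_
    · rw [interior_Ico]
      exact fun r hr => (h.hasDerivAt_deriv_neg hψ hr).differentiableAt.differentiableWithinAt
    · rw [interior_Ico]
      intro r hr
      rw [(h.hasDerivAt_deriv_neg hψ hr).deriv]
      have hr' := neg_mem_Ioo_of_mem_Ico (Ioo_subset_Ico_self hr)
      have h1 := h.deriv_re_pos hψ hr'
      have h2 := hψ.strictMonoOn hr' (b := 0) (by simp) (by linarith [hr.1])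
      simp only [Complex.ofReal_zero, hψ.at_zero, Complex.one_re] at h2
      exact mul_nonpos_of_nonneg_of_nonpos h1.le
        (div_nonpos_of_nonpos_of_nonneg (by linarith) hr.1.le)
  have hmono : MonotoneOn (fun r : ℝ => r - -(f₀ ((-r : ℝ) : ℂ)).re) (Ico 0 1) := by
    refine monotoneOn_of_deriv_nonneg (convex_Ico _ _)
      (continuousOn_id.sub h.continuousOn_neg) ?_ ?_
    · rw [interior_Ico]
      exact fun r hr => ((hasDerivAt_id' r).fun_sub
        (h.hasDerivAt_neg_apply_neg (Ioo_subset_Ico_self hr))).differentiableAt.differentiableWithinAt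
    · rw [interior_Ico]
      intro r hr
      rw [((hasDerivAt_id' r).fun_sub (h.hasDerivAt_neg_apply_neg (Ioo_subset_Ico_self hr))).deriv]
      have := hanti (a := 0) (by simp) (Ioo_subset_Ico_self hr) hr.1.le
      simp only [neg_zero, Complex.ofReal_zero, h.normalized.deriv_zero, Complex.one_re] at this
      linarith
  have := hmono (a := 0) (by simp) hr hr.1
  simp only [neg_zero, Complex.ofReal_zero, h.normalized.zero, Complex.zero_re] at this
  linarith

/-- The radial limit of `f₀` at `-1`. -/
theorem IsConvexExtremal.exists_limit (hψ : IsMaMinda ψ) (h : IsConvexExtremal ψ f₀) :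
    ∃ L : ℝ, 0 < L ∧ L ≤ 1 ∧ (∀ r ∈ Ico (0 : ℝ) 1, -(f₀ ((-r : ℝ) : ℂ)).re < L) ∧
      Tendsto (fun r : ℝ => -(f₀ ((-r : ℝ) : ℂ)).re) (𝓝[<] 1) (𝓝 L) ∧
      Tendsto (fun t : ℝ => f₀ (-(t : ℂ))) (𝓝[<] (1 : ℝ)) (𝓝 (-(L : ℂ))) := by
  set l : ℝ → ℝ := fun r => -(f₀ ((-r : ℝ) : ℂ)).re with hl
  have hmono : StrictMonoOn l (Ico 0 1) := by
    intro a ha b hb hab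
    have := h.strictMonoOn hψ (neg_mem_Ioo_of_mem_Ico hb) (neg_mem_Ioo_of_mem_Ico ha)
      (neg_lt_neg hab)
    simp only [hl]
    exact neg_lt_neg this
  have hbdd : BddAbove (l '' Ico 0 1) := ⟨1, by
    rintro _ ⟨r, hr, rfl⟩
    exact (h.neg_le hψ hr).trans hr.2.le⟩
  set L := sSup (l '' Ico 0 1) with hL
  have hle : ∀ r ∈ Ico (0 : ℝ) 1, l r ≤ L := fun r hr => le_csSup hbdd (mem_image_of_mem _ hr)
  have hlt : ∀ r ∈ Ico (0 : ℝ) 1, l r < L := fun r hr => by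
    obtain ⟨t, ht1, ht2⟩ := exists_between hr.2
    have ht : t ∈ Ico (0 : ℝ) 1 := ⟨hr.1.trans ht1.le, ht2⟩
    exact (hmono hr ht ht1).trans_le (hle t ht)
  have hne : (l '' Ico 0 1).Nonempty := ⟨l 0, mem_image_of_mem _ (by simp)⟩
  have hlim : Tendsto l (𝓝[<] 1) (𝓝 L) := by
    refine tendsto_order.2 ⟨fun a ha => ?_, fun a ha => ?_⟩
    · obtain ⟨_, ⟨r, hr, rfl⟩, hra⟩ := exists_lt_of_lt_csSup hne ha
      filter_upwards [Ioo_mem_nhdsLT hr.2] with t ht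
      exact hra.trans (hmono hr ⟨hr.1.trans ht.1.le, ht.2⟩ ht.1)
    · filter_upwards [Ioo_mem_nhdsLT (zero_lt_one' ℝ)] with t ht
      exact (hle t (Ioo_subset_Ico_self ht)).trans_lt ha
  refine ⟨L, ?_, ?_, hlt, hlim, ?_⟩
  · have := hlt 0 (by simp)
    simpa [hl, h.normalized.zero] using this
  · refine csSup_le hne ?_
    rintro _ ⟨r, hr, rfl⟩
    exact (h.neg_le hψ hr).trans hr.2.le
  · have h1 : Tendsto (fun t : ℝ => (-(l t : ℂ))) (𝓝[<] 1) (𝓝 (-(L : ℂ))) :=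
      ((Complex.continuous_ofReal.tendsto L).comp hlim).neg
    refine h1.congr' ?_
    filter_upwards [Ioo_mem_nhdsLT (zero_lt_one' ℝ)] with t ht
    have := h.apply_ofReal hψ (neg_mem_Ioo_of_mem_Ico (Ioo_subset_Ico_self ht))
    simp only [hl]
    rw [Complex.ofReal_neg, neg_neg, ← this, Complex.ofReal_neg]

end Extremal

/-! ### Growth, starlikeness and univalence for the class `𝒞(ψ)` -/

section Growth

variable {ψ f f₀ : ℂ → ℂ} {z : ℂ}

theorem IsConvexExtremal.isMaMindaConvex (h : IsConvexExtremal ψ f₀) : IsMaMindaConvex ψ f₀ :=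
  ⟨h.normalized, h.deriv_ne, fun z => z, ⟨differentiableOn_id, fun _ hz => hz, rfl⟩, h.eqn⟩

theorem IsMaMindaConvex.re_convexQuotient_pos (hψ : IsMaMinda ψ) (hf : IsMaMindaConvex ψ f)
    (hz : z ∈ unitDisk) : 0 < (convexQuotient f z).re := by
  obtain ⟨w, hw, hwe⟩ := hf.subord
  rw [hwe z hz]
  exact hψ.re_pos _ (hw.mapsTo hz)

theorem mem_Ico_norm (hz : z ∈ unitDisk) : ‖z‖ ∈ Ico (0 : ℝ) 1 :=
  ⟨norm_nonneg z, mem_unitDisk.1 hz⟩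

theorem mem_Ioo_norm (hz : z ∈ unitDisk) (h0 : z ≠ 0) : ‖z‖ ∈ Ioo (0 : ℝ) 1 :=
  ⟨norm_pos_iff.2 h0, mem_unitDisk.1 hz⟩

/-- Distortion: `f₀'(-|z|) ≤ |f'(z)|`. -/
theorem IsMaMindaConvex.le_norm_deriv (hψ : IsMaMinda ψ) (h : IsConvexExtremal ψ f₀)
    (hf : IsMaMindaConvex ψ f) (hz : z ∈ unitDisk) :
    (deriv f₀ ((-‖z‖ : ℝ) : ℂ)).re ≤ ‖deriv f z‖ := by
  obtain ⟨w, hw, hwe⟩ := hf.subord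
  have hH := hf.normalized.holo.deriv isOpen_unitDisk
  have hHd : ∀ x ∈ unitDisk, HasDerivAt (deriv f) (deriv (deriv f) x) x := fun x hx =>
    (hH.differentiableAt (unitDisk_mem_nhds hx)).hasDerivAt
  set la : ℝ → ℝ := fun r => (deriv f₀ ((-r : ℝ) : ℂ)).re with hla
  have hla0 : ∀ x ∈ unitDisk, 0 < la ‖x‖ := fun x hx =>
    h.deriv_re_pos hψ (neg_mem_Ioo_of_mem_Ico (mem_Ico_norm hx))
  -- The slack ε|z| makes the radial derivative strictly positive, as the minimum principle
  -- requires; ε tends to 0 at the end.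
  have key : ∀ ε : ℝ, 0 < ε →
      -ε < Real.log ‖deriv f z‖ - (Real.log (la ‖z‖) - ε * ‖z‖) := by
    intro ε hε
    have hq : ∀ x ∈ unitDisk, x ≠ 0 → HasDerivAt (fun r => Real.log (la r) - ε * r)
        (((ψ ((-‖x‖ : ℝ) : ℂ)).re - 1) / ‖x‖ - ε) ‖x‖ := by
      intro x hx hx0
      have h1 := (h.hasDerivAt_deriv_neg hψ (mem_Ioo_norm hx hx0)).log (hla0 x hx).ne'
      have h2 := h1.sub ((hasDerivAt_id' ‖x‖).const_mul ε)
      refine h2.congr_deriv ?_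
      have := (hla0 x hx).ne'
      simp only [hla] at this
      rw [mul_one, mul_div_cancel_left₀ _ this]
    refine lt_of_polar_critical
      (u := fun x => Real.log ‖deriv f x‖ - (Real.log (la ‖x‖) - ε * ‖x‖))
      (A := fun x => (deriv (deriv f) x * (x * Complex.I) / deriv f x).re)
      (R := fun x => (deriv (deriv f) x * x / deriv f x).re -
        (((ψ ((-‖x‖ : ℝ) : ℂ)).re - 1) / ‖x‖ - ε) * ‖x‖) ?_ ?_ ?_ ?_ ?_ hz
    · refine (hH.continuousOn.norm.log fun x hx => norm_ne_zero_iff.2 (hf.deriv_ne x hx)).sub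
        (ContinuousOn.sub (ContinuousOn.log ?_ fun x hx => (hla0 x hx).ne') (by fun_prop))
      exact h.continuousOn_deriv_neg.comp continuous_norm.continuousOn fun x hx => mem_Ico_norm hx
    · intro x hx hx0
      have h1 := (hHd x hx).comp_rotation
      have e : deriv f (x * Complex.exp (((0 : ℝ) : ℂ) * Complex.I)) = deriv f x := by simp
      have hne := hf.deriv_ne x hx
      have h2 := (h1.norm_complex (by rwa [e])).log (by rw [e]; exact norm_ne_zero_iff.2 hne)
      have h3 := h2.sub (hasDerivAt_rotation_comp_norm (fun r => Real.log (la r) - ε * r) x)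
      refine h3.congr_deriv ?_
      rw [e, sub_zero, mul_div_cancel_left₀ _ (norm_ne_zero_iff.2 hne)]
    · intro x hx hx0
      have h1 := (hHd x hx).comp_radial
      have e : deriv f (((1 : ℝ) : ℂ) * x) = deriv f x := by simp
      have hne := hf.deriv_ne x hx
      have h2 := (h1.norm_complex (by rwa [e])).log (by rw [e]; exact norm_ne_zero_iff.2 hne)
      have h3 := h2.sub (hasDerivAt_radial_comp_norm (hq x hx hx0))
      refine h3.congr_deriv ?_
      rw [e, mul_div_cancel_left₀ _ (norm_ne_zero_iff.2 hne)]
    · simp [hla, h.normalized.deriv_zero, hf.normalized.deriv_zero, hε]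
    · intro x hx hx0 _ hA
      have hn : ‖x‖ ≠ 0 := norm_ne_zero_iff.2 hx0
      have hcq := hwe x hx
      rw [convexQuotient] at hcq
      have hq1 : deriv (deriv f) x * x / deriv f x = ψ (w x) - 1 := by rw [← hcq]; ring
      -- Angular criticality of log |f'| says that x f''/f' = ψ(w(x)) - 1 is real. Hence w(x) is
      -- real with w(x) ≥ -|x|, and monotonicity of ψ compares the radial derivatives.
      have hA2 : (ψ (w x)).im = 0 := by
        have e : deriv (deriv f) x * (x * Complex.I) / deriv f x =
          (deriv (deriv f) x * x / deriv f x) * Complex.I := by ring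
        rw [e, hq1, Complex.mul_I_re] at hA
        simpa using hA
      have hwD := hw.mapsTo hx
      have hwr := hψ.isReal_of_im_eq_zero hwD hA2
      have hwx : w x = ((w x).re : ℂ) := Complex.ext (by simp) (by simp [hwr])
      have hle : -‖x‖ ≤ (w x).re := by
        have := (abs_le.1 ((Complex.abs_re_le_norm (w x)).trans (hw.norm_le hx))).1
        exact this
      have hmem : (w x).re ∈ Ioo (-1 : ℝ) 1 :=
        abs_lt.1 ((Complex.abs_re_le_norm (w x)).trans_lt (mem_unitDisk.1 hwD))
      have hψle := hψ.strictMonoOn.monotoneOn (neg_mem_Ioo_of_mem_Ico (mem_Ico_norm hx)) hmem hle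
      rw [← hwx] at hψle
      have hx' := norm_pos_iff.2 hx0
      rw [hq1, sub_mul, div_mul_cancel₀ _ hn, Complex.sub_re, Complex.one_re]
      nlinarith [mul_pos hε hx']
  have hz1 := mem_unitDisk.1 hz
  have hlog : Real.log (la ‖z‖) ≤ Real.log ‖deriv f z‖ := by
    refine le_of_forall_pos_le_add fun ε hε => ?_
    have := key (ε / 2) (by positivity)
    nlinarith [norm_nonneg z]
  exact (Real.log_le_log_iff (hla0 z hz) (norm_pos_iff.2 (hf.deriv_ne z hz))).1 hlog

/-- Convexity implies starlikeness: `f = z f' P` with `Re P > 0`. -/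
theorem exists_starlike_of_convex (hn : IsNormalized f) (hne : ∀ z ∈ unitDisk, deriv f z ≠ 0)
    (hre : ∀ z ∈ unitDisk, 0 < (convexQuotient f z).re) :
    ∃ P : ℂ → ℂ, (∀ z ∈ unitDisk, 0 < (P z).re) ∧ ∀ z ∈ unitDisk, f z = z * deriv f z * P z := by
  have hH := hn.holo.deriv isOpen_unitDisk
  set P : ℂ → ℂ := fun z => dslope f 0 z / deriv f z with hP
  have hPd : DifferentiableOn ℂ P unitDisk := ((Complex.differentiableOn_dslope
    (unitDisk_mem_nhds zero_mem_unitDisk)).2 hn.holo).fun_div hH hne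
  have hPe : ∀ z ∈ unitDisk, f z = z * deriv f z * P z := fun z hz => by
    have e := sub_smul_dslope f 0 z
    rw [sub_zero, smul_eq_mul, hn.zero, sub_zero] at e
    have := hne z hz
    simp only [hP]
    field_simp
    exact e.symm
  have hPder : ∀ z ∈ unitDisk, HasDerivAt P (deriv P z) z := fun z hz =>
    (hPd.differentiableAt (unitDisk_mem_nhds hz)).hasDerivAt
  -- Differentiate f = z f' P and divide by f'.
  have hode : ∀ z ∈ unitDisk, P z * convexQuotient f z + z * deriv P z = 1 := by
    intro z hz
    have d1 := (hn.holo.differentiableAt (unitDisk_mem_nhds hz)).hasDerivAt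
    have d2 := (hH.differentiableAt (unitDisk_mem_nhds hz)).hasDerivAt
    have d3 := ((hasDerivAt_id' z).fun_mul d2).fun_mul (hPder z hz)
    have e : f =ᶠ[𝓝 z] fun z => z * deriv f z * P z := by
      filter_upwards [unitDisk_mem_nhds hz] with x hx using hPe x hx
    have := (e.deriv_eq.symm.trans d1.deriv).symm.trans d3.deriv
    have hz' := hne z hz
    rw [convexQuotient]
    field_simp
    linear_combination -this
  refine ⟨P, fun z hz => ?_, hPe⟩
  refine lt_of_polar_critical (u := fun z => (P z).re)
    (A := fun z => (deriv P z * (z * Complex.I)).re) (R := fun z => (deriv P z * z).re)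
    (Complex.continuous_re.comp_continuousOn hPd.continuousOn)
    (fun x hx _ => (hPder x hx).comp_rotation.re_complex)
    (fun x hx _ => (hPder x hx).comp_radial.re_complex) ?_ (fun x hx hx0 hPx hA => ?_) hz
  · simp [hP, dslope_same, hn.deriv_zero]
  · by_contra hR
    push Not at hR
    have ho := hode x hx
    have hAim : (x * deriv P x).im = 0 := by
      rw [show deriv P x * (x * Complex.I) = (x * deriv P x) * Complex.I by ring,
        Complex.mul_I_re] at hA
      exact neg_eq_zero.1 hA
    rw [mul_comm] at hR
    have o1 := congrArg Complex.re ho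
    have o2 := congrArg Complex.im ho
    rw [Complex.add_re, Complex.mul_re, Complex.one_re] at o1
    rw [Complex.add_im, Complex.mul_im, Complex.one_im, hAim] at o2
    have hc := hre x hx
    generalize (P x).re = a at *
    generalize (P x).im = b at *
    generalize (convexQuotient f x).re = c at *
    generalize (convexQuotient f x).im = d at *
    -- If z P' is real and nonpositive, P times the convex quotient equals 1 - zP' ≥ 1. Then P is a
    -- positive multiple of the conjugate of that quotient, so Re P > 0, against the assumption Re P
    -- ≤ 0.
    have k1 : 0 < a * c - b * d := by linarith
    have k2 : a * d + b * c = 0 := by linarith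
    have k3 : c * (a * c - b * d) = a * (c ^ 2 + d ^ 2) := by linear_combination -d * k2
    nlinarith [mul_pos hc k1, sq_nonneg d, sq_nonneg c]

theorem IsMaMindaConvex.exists_starlike (hψ : IsMaMinda ψ) (hf : IsMaMindaConvex ψ f) :
    ∃ P : ℂ → ℂ, (∀ z ∈ unitDisk, 0 < (P z).re) ∧ ∀ z ∈ unitDisk, f z = z * deriv f z * P z :=
  exists_starlike_of_convex hf.normalized hf.deriv_ne fun _ hz => hf.re_convexQuotient_pos hψ hz

/-- Growth: `-f₀(-|z|) ≤ |f(z)|`. -/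
theorem IsMaMindaConvex.le_norm (hψ : IsMaMinda ψ) (h : IsConvexExtremal ψ f₀)
    (hf : IsMaMindaConvex ψ f) (hz : z ∈ unitDisk) : -(f₀ ((-‖z‖ : ℝ) : ℂ)).re ≤ ‖f z‖ := by
  obtain ⟨P, hP, hPe⟩ := hf.exists_starlike hψ
  have hd : ∀ x ∈ unitDisk, HasDerivAt f (deriv f x) x := fun x hx =>
    (hf.normalized.holo.differentiableAt (unitDisk_mem_nhds hx)).hasDerivAt
  have hP0 : ∀ x ∈ unitDisk, P x ≠ 0 := fun x hx h0 => by
    have := hP x hx; rw [h0] at this; simp at this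
  have hf0 : ∀ x ∈ unitDisk, x ≠ 0 → f x ≠ 0 := fun x hx hx0 => by
    rw [hPe x hx]; exact mul_ne_zero (mul_ne_zero hx0 (hf.deriv_ne x hx)) (hP0 x hx)
  set l : ℝ → ℝ := fun r => -(f₀ ((-r : ℝ) : ℂ)).re with hl
  have key : ∀ ε : ℝ, 0 < ε → -ε < ‖f z‖ - (l ‖z‖ - ε * ‖z‖) := by
    intro ε hε
    have hq : ∀ x ∈ unitDisk, HasDerivAt (fun r => l r - ε * r)
        ((deriv f₀ ((-‖x‖ : ℝ) : ℂ)).re - ε) ‖x‖ := by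
      intro x hx
      have h2 := (h.hasDerivAt_neg_apply_neg (mem_Ico_norm hx)).fun_sub
        ((hasDerivAt_id' ‖x‖).const_mul ε)
      rwa [mul_one] at h2
    refine lt_of_polar_critical
      (u := fun x => ‖f x‖ - (l ‖x‖ - ε * ‖x‖))
      (A := fun x => ‖f x‖ * (deriv f x * (x * Complex.I) / f x).re)
      (R := fun x => ‖f x‖ * (deriv f x * x / f x).re -
        ((deriv f₀ ((-‖x‖ : ℝ) : ℂ)).re - ε) * ‖x‖) ?_ ?_ ?_ ?_ ?_ hz
    · refine hf.normalized.holo.continuousOn.norm.sub (ContinuousOn.sub ?_ (by fun_prop))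
      exact h.continuousOn_neg.comp continuous_norm.continuousOn fun x hx => mem_Ico_norm hx
    · intro x hx hx0
      have h1 := (hd x hx).comp_rotation
      have e : f (x * Complex.exp (((0 : ℝ) : ℂ) * Complex.I)) = f x := by simp
      have h2 := h1.norm_complex (by rw [e]; exact hf0 x hx hx0)
      have h3 := h2.sub (hasDerivAt_rotation_comp_norm (fun r => l r - ε * r) x)
      refine h3.congr_deriv ?_
      rw [e, sub_zero]
    · intro x hx hx0
      have h1 := (hd x hx).comp_radial
      have e : f (((1 : ℝ) : ℂ) * x) = f x := by simp
      have h2 := h1.norm_complex (by rw [e]; exact hf0 x hx hx0)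
      have h3 := h2.sub (hasDerivAt_radial_comp_norm (hq x hx))
      refine h3.congr_deriv ?_
      rw [e]
    · simp [hl, h.normalized.zero, hf.normalized.zero, hε]
    · intro x hx hx0 _ hA
      have hfx := hf0 x hx hx0
      have hne := hf.deriv_ne x hx
      have hPx := hP0 x hx
      -- Angular criticality of |f| makes x f'/f = 1/P real, and it has positive real part. It
      -- therefore equals its modulus, so the radial term is |x f'(x)|, to which the distortion
      -- bound applies.
      have hquot : deriv f x * x / f x = (P x)⁻¹ := by
        rw [hPe x hx]; field_simp
      have hA2 : ((P x)⁻¹).im = 0 := by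
        rw [show deriv f x * (x * Complex.I) / f x = (deriv f x * x / f x) * Complex.I by ring,
          hquot, Complex.mul_I_re] at hA
        have := (mul_eq_zero.1 hA).resolve_left (norm_ne_zero_iff.2 hfx)
        simpa using this
      have hpos : 0 < ((P x)⁻¹).re := by
        rw [Complex.inv_re]
        exact div_pos (hP x hx) (Complex.normSq_pos.2 hPx)
      have hre : ((P x)⁻¹).re = ‖(P x)⁻¹‖ := by
        rw [← Complex.re_eq_norm.2 ⟨hpos.le, hA2.symm⟩]
      have hval : ‖f x‖ * (deriv f x * x / f x).re = ‖deriv f x‖ * ‖x‖ := by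
        rw [hquot, hre, ← hquot, norm_div, norm_mul]
        have := norm_ne_zero_iff.2 hfx
        field_simp
      have hx' := norm_pos_iff.2 hx0
      have hle := hf.le_norm_deriv hψ h hx
      rw [hval]
      nlinarith [mul_pos hε hx', mul_le_mul_of_nonneg_right hle hx'.le]
  refine le_of_forall_pos_le_add fun ε hε => ?_
  have := key (ε / 2) (by positivity)
  have hz1 := mem_unitDisk.1 hz
  simp only [hl] at this
  nlinarith [norm_nonneg z]

theorem HasDerivAt.eventually_lt_left_of_pos {g : ℝ → ℝ} {d x : ℝ} (h : HasDerivAt g d x)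
    (hd : 0 < d) : ∀ᶠ t in 𝓝[<] (0 : ℝ), g (x + t) < g x := by
  filter_upwards [h.tendsto_slope_zero_left.eventually (lt_mem_nhds hd), self_mem_nhdsWithin]
    with t ht ht0
  have ht0 : t < 0 := ht0
  rw [smul_eq_mul] at ht
  have := neg_of_mul_pos_right ht (inv_nonpos.2 ht0.le)
  linarith

/-- Moving the value `f x` towards the origin moves `x` towards the origin. -/
theorem exists_lift_toward_zero {P : ℂ → ℂ} (hf : DifferentiableOn ℂ f unitDisk)
    (hne : ∀ z ∈ unitDisk, deriv f z ≠ 0) (hP : ∀ z ∈ unitDisk, 0 < (P z).re)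
    (hPe : ∀ z ∈ unitDisk, f z = z * deriv f z * P z) {x : ℂ} (hx : x ∈ unitDisk) (hx0 : x ≠ 0) :
    ∃ γ : ℝ → ℂ, Tendsto γ (𝓝[<] 0) (𝓝 x) ∧
      ∀ᶠ t in 𝓝[<] (0 : ℝ), f (γ t) = ((1 + t : ℝ) : ℂ) * f x ∧ ‖γ t‖ < ‖x‖ := by
  have hs : HasStrictDerivAt f (deriv f x) x :=
    (hf.analyticAt (unitDisk_mem_nhds hx)).hasStrictDerivAt
  set g := hs.localInverse f (deriv f x) x (hne x hx) with hg
  have hgd : HasDerivAt g (deriv f x)⁻¹ (f x) := (hs.to_localInverse (hne x hx)).hasDerivAt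
  have hgx : g (f x) = x :=
    (hs.hasStrictFDerivAt_equiv (hne x hx)).localInverse_apply_image
  have hfg : ∀ᶠ y in 𝓝 (f x), f (g y) = y :=
    (hs.hasStrictFDerivAt_equiv (hne x hx)).eventually_right_inverse
  have hlin : HasDerivAt (fun t : ℝ => (t : ℂ) * f x) (f x) (1 : ℝ) := by
    have := (Complex.ofRealCLM.hasDerivAt (x := (1 : ℝ))).mul_const (f x)
    simpa using this
  have hγ : HasDerivAt (fun t : ℝ => g ((t : ℂ) * f x)) ((deriv f x)⁻¹ * f x) (1 : ℝ) := by
    refine HasDerivAt.comp (1 : ℝ) (h₂ := g) ?_ hlin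
    simpa using hgd
  have e1 : g (((1 : ℝ) : ℂ) * f x) = x := by simp [hgx]
  have hnorm := hγ.norm_complex (by rw [e1]; exact hx0)
  rw [e1] at hnorm
  have hval : (deriv f x)⁻¹ * f x / x = P x := by
    have := hne x hx
    rw [hPe x hx]; field_simp
  rw [hval] at hnorm
  -- This is the derivative of |γ| when f(γ) moves along the ray through f(x), so going towards the
  -- origin strictly decreases |γ|.
  have hpos : 0 < ‖x‖ * (P x).re := mul_pos (norm_pos_iff.2 hx0) (hP x hx)
  have hev := hnorm.eventually_lt_left_of_pos hpos
  rw [e1] at hev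
  have hshift : Tendsto (fun t : ℝ => 1 + t) (𝓝[<] 0) (𝓝 1) := by
    have : Tendsto (fun t : ℝ => 1 + t) (𝓝 0) (𝓝 (1 + 0)) :=
      Continuous.tendsto (by fun_prop) 0
    rw [add_zero] at this
    exact this.mono_left nhdsWithin_le_nhds
  have hlin2 : Tendsto (fun t : ℝ => (((1 + t : ℝ) : ℂ) * f x)) (𝓝[<] 0) (𝓝 (f x)) := by
    have := hlin.continuousAt.tendsto.comp hshift
    simpa [Function.comp_def] using this
  refine ⟨fun t => g (((1 + t : ℝ) : ℂ) * f x), ?_, ?_⟩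
  · have := hgd.continuousAt.tendsto.comp hlin2
    rwa [hgx] at this
  · filter_upwards [hev, hlin2.eventually hfg] with t h1 h2 using ⟨h2, h1⟩

/-- Among pairs of distinct points with equal values, take one minimising the larger modulus. Moving
the common value towards 0 lifts to both points, keeps them distinct and decreases both moduli, a
contradiction. -/
theorem injOn_of_starlike {P : ℂ → ℂ} (hf : DifferentiableOn ℂ f unitDisk)
    (hne : ∀ z ∈ unitDisk, deriv f z ≠ 0) (hP : ∀ z ∈ unitDisk, 0 < (P z).re)
    (hPe : ∀ z ∈ unitDisk, f z = z * deriv f z * P z) : InjOn f unitDisk := by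
  have hzero : ∀ x ∈ unitDisk, f x = 0 → x = 0 := fun x hx h0 => by
    by_contra hx0
    rw [hPe x hx] at h0
    rcases mul_eq_zero.1 h0 with h1 | h1
    · exact mul_ne_zero hx0 (hne x hx) h1
    · have := hP x hx; rw [h1] at this; simp at this
  have hf00 : f 0 = 0 := by simpa using hPe 0 zero_mem_unitDisk
  have hloc : ∀ a : unitDisk, ∃ U : Set ℂ, IsOpen U ∧ (a : ℂ) ∈ U ∧ InjOn f U := fun a => by
    have hs : HasStrictDerivAt f (deriv f a) a :=
      (hf.analyticAt (unitDisk_mem_nhds a.2)).hasStrictDerivAt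
    let e := (hs.hasStrictFDerivAt_equiv (hne a a.2)).toOpenPartialHomeomorph f
    exact ⟨e.source, e.open_source,
      (hs.hasStrictFDerivAt_equiv (hne a a.2)).mem_toOpenPartialHomeomorph_source, e.injOn⟩
  choose U hUo hUa hUi using hloc
  intro a ha b hb hab
  by_contra hne'
  set ρ := max ‖a‖ ‖b‖ with hρ
  have hρ1 : ρ < 1 := max_lt (mem_unitDisk.1 ha) (mem_unitDisk.1 hb)
  set B : Set (ℂ × ℂ) := closedBall 0 ρ ×ˢ closedBall 0 ρ with hB
  have hBD : ∀ p ∈ B, p.1 ∈ unitDisk ∧ p.2 ∈ unitDisk := fun p hp =>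
    ⟨mem_unitDisk.2 ((mem_closedBall_zero_iff.1 hp.1).trans_lt hρ1),
      mem_unitDisk.2 ((mem_closedBall_zero_iff.1 hp.2).trans_lt hρ1)⟩
  have hBc : IsCompact B := (isCompact_closedBall _ _).prod (isCompact_closedBall _ _)
  have hc : ContinuousOn (fun p : ℂ × ℂ => f p.1 - f p.2) B :=
    (hf.continuousOn.comp continuous_fst.continuousOn fun p hp => (hBD p hp).1).sub
      (hf.continuousOn.comp continuous_snd.continuousOn fun p hp => (hBD p hp).2)
  set T : Set (ℂ × ℂ) := B ∩ (fun p : ℂ × ℂ => f p.1 - f p.2) ⁻¹' {0} with hT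
  have hTc : IsCompact T :=
    hBc.of_isClosed_subset (hc.preimage_isClosed_of_isClosed hBc.isClosed isClosed_singleton)
      inter_subset_left
  have hVo : IsOpen (⋃ a : unitDisk, U a ×ˢ U a) :=
    isOpen_iUnion fun a => (hUo a).prod (hUo a)
  -- Removing the squares of neighbourhoods where f is injective deletes the diagonal but no genuine
  -- collision, so the set of collisions is compact.
  have hKc : IsCompact (T \ ⋃ a : unitDisk, U a ×ˢ U a) := hTc.diff hVo
  have hKmem : ∀ p : ℂ × ℂ, p ∈ T → p.1 ≠ p.2 → p ∈ T \ ⋃ a : unitDisk, U a ×ˢ U a := by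
    intro p hp hpne
    refine ⟨hp, fun hmem => ?_⟩
    obtain ⟨c, hc1, hc2⟩ := mem_iUnion.1 hmem
    exact hpne (hUi c hc1 hc2 (sub_eq_zero.1 hp.2))
  have habT : (a, b) ∈ T := ⟨⟨by simp [hρ], by simp [hρ]⟩, by simp [hab]⟩
  obtain ⟨q, hq, hqmin⟩ := hKc.exists_isMinOn ⟨_, hKmem _ habT hne'⟩
    (f := fun p : ℂ × ℂ => max ‖p.1‖ ‖p.2‖) (by fun_prop)
  obtain ⟨hq1, hq2⟩ := hBD q hq.1.1
  have hqf : f q.1 = f q.2 := sub_eq_zero.1 hq.1.2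
  have hqne : q.1 ≠ q.2 := fun he => hq.2 (mem_iUnion.2 ⟨⟨q.1, hq1⟩, hUa _, he ▸ hUa ⟨q.1, hq1⟩⟩)
  have h10 : q.1 ≠ 0 := fun h0 => hqne (by
    rw [h0, hzero q.2 hq2 (by rw [← hqf, h0, hf00])])
  have h20 : q.2 ≠ 0 := fun h0 => hqne (by
    rw [h0, hzero q.1 hq1 (by rw [hqf, h0, hf00])])
  obtain ⟨γ₁, ht1, he1⟩ := exists_lift_toward_zero hf hne hP hPe hq1 h10
  obtain ⟨γ₂, ht2, he2⟩ := exists_lift_toward_zero hf hne hP hPe hq2 h20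
  have hsep : ∀ᶠ t in 𝓝[<] (0 : ℝ), γ₁ t ≠ γ₂ t := by
    have := (ht1.sub ht2).eventually (isOpen_ne.mem_nhds (sub_ne_zero.2 hqne))
    exact this.mono fun t h => sub_ne_zero.1 h
  obtain ⟨t, ⟨h1, h2⟩, h3⟩ := ((he1.and he2).and hsep).exists
  have hlt : max ‖γ₁ t‖ ‖γ₂ t‖ < max ‖q.1‖ ‖q.2‖ := max_lt_max h1.2 h2.2
  have hqB : max ‖q.1‖ ‖q.2‖ ≤ ρ :=
    max_le (mem_closedBall_zero_iff.1 hq.1.1.1) (mem_closedBall_zero_iff.1 hq.1.1.2)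
  have hnew : (γ₁ t, γ₂ t) ∈ T := by
    refine ⟨⟨?_, ?_⟩, ?_⟩
    · rw [mem_closedBall_zero_iff]; exact (le_max_left _ _).trans (hlt.le.trans hqB)
    · rw [mem_closedBall_zero_iff]; exact (le_max_right _ _).trans (hlt.le.trans hqB)
    · simp [h1.1, h2.1, hqf]
  exact absurd (hqmin (hKmem _ hnew h3)) (not_le.2 hlt)

theorem IsMaMindaConvex.injOn (hψ : IsMaMinda ψ) (hf : IsMaMindaConvex ψ f) : InjOn f unitDisk := by
  obtain ⟨P, hP, hPe⟩ := hf.exists_starlike hψ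
  exact injOn_of_starlike hf.normalized.holo hf.deriv_ne hP hPe

/-! ### The image domain and the distance to its boundary -/

theorem isOpen_image_unitDisk (hf : DifferentiableOn ℂ f unitDisk) (hi : InjOn f unitDisk) :
    IsOpen (f '' unitDisk) := by
  rw [isOpen_iff_mem_nhds]
  rintro _ ⟨a, ha, rfl⟩
  exact image_mem_nhds_of_injOn hf hi ha (unitDisk_mem_nhds ha)

/-- A univalent function on the disk omits a value. -/
theorem image_unitDisk_ne_univ (hf : DifferentiableOn ℂ f unitDisk) (hi : InjOn f unitDisk) :
    f '' unitDisk ≠ univ := by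
  intro huniv
  obtain ⟨g, hg, hgf⟩ := exists_holomorphic_inverse hf hi
  have hgd : Differentiable ℂ g := fun b => hg b (huniv ▸ mem_univ b)
  have hb : Bornology.IsBounded (range g) := by
    refine isBounded_ball.subset (t := unitDisk) ?_
    rintro _ ⟨b, rfl⟩
    obtain ⟨a, ha, rfl⟩ : b ∈ f '' unitDisk := huniv ▸ mem_univ b
    rw [hgf a ha]; exact ha
  have h2 : (2⁻¹ : ℂ) ∈ unitDisk := by rw [mem_unitDisk]; norm_num
  have := hgd.apply_eq_apply_of_bounded hb (f 0) (f 2⁻¹)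
  rw [hgf 0 zero_mem_unitDisk, hgf _ h2] at this
  norm_num at this

/-- If a boundary point had modulus below L, choose r with |b| < -f₀(-r). Values of f near b avoid
the compact set f(|x| ≤ r), hence come from |x| > r, where the growth bound makes them too large. -/
theorem IsMaMindaConvex.le_boundaryDist (hψ : IsMaMinda ψ) (h : IsConvexExtremal ψ f₀)
    (hf : IsMaMindaConvex ψ f) {L : ℝ}
    (hL : Tendsto (fun r : ℝ => -(f₀ ((-r : ℝ) : ℂ)).re) (𝓝[<] 1) (𝓝 L)) :
    L ≤ boundaryDist f := by
  have hi := hf.injOn hψ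
  have hd := hf.normalized.holo
  have hopen := isOpen_image_unitDisk hd hi
  have hne : (frontier (f '' unitDisk)).Nonempty :=
    nonempty_frontier_iff.2 ⟨⟨f 0, mem_image_of_mem f zero_mem_unitDisk⟩,
      image_unitDisk_ne_univ hd hi⟩
  rw [boundaryDist, le_infDist hne]
  intro b hb
  rw [hf.normalized.zero, dist_zero_left]
  by_contra hlt
  push Not at hlt
  rw [hopen.frontier_eq] at hb
  obtain ⟨r, hr1, hr2⟩ := ((hL.eventually (lt_mem_nhds hlt)).and
    (Ioo_mem_nhdsLT (zero_lt_one' ℝ))).exists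
  have hsub : closedBall (0 : ℂ) r ⊆ unitDisk := fun x hx =>
    mem_unitDisk.2 ((mem_closedBall_zero_iff.1 hx).trans_lt hr2.2)
  have hcpt : IsCompact (f '' closedBall 0 r) :=
    (isCompact_closedBall 0 r).image_of_continuousOn (hd.continuousOn.mono hsub)
  have hW : IsOpen ({y : ℂ | ‖y‖ < -(f₀ ((-r : ℝ) : ℂ)).re} ∩ (f '' closedBall 0 r)ᶜ) :=
    (isOpen_lt continuous_norm continuous_const).inter hcpt.isClosed.isOpen_compl
  obtain ⟨y, hy, x, hx, rfl⟩ := mem_closure_iff.1 hb.1 _ hW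
    ⟨hr1, fun hmem => hb.2 (image_mono hsub hmem)⟩
  have hrx : r < ‖x‖ := by
    by_contra hle
    exact hy.2 (mem_image_of_mem f (mem_closedBall_zero_iff.2 (not_lt.1 hle)))
  have hgr := hf.le_norm hψ h hx
  have hmono := h.strictMonoOn hψ (neg_mem_Ioo_of_mem_Ico (mem_Ico_norm hx))
    (neg_mem_Ioo_of_mem_Ico (Ioo_subset_Ico_self hr2)) (neg_lt_neg hrx)
  have hy1 : ‖f x‖ < -(f₀ ((-r : ℝ) : ℂ)).re := hy.1
  simp only at hmono
  linarith

/-- The point -L is a limit of values of f₀ but is not attained: by symmetry and univalence a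
preimage would be real, whereas f₀ > -L on (-1, 0] and f₀ > 0 on (0, 1). -/
theorem IsConvexExtremal.boundaryDist_eq (hψ : IsMaMinda ψ) (h : IsConvexExtremal ψ f₀) {L : ℝ}
    (hL0 : 0 < L) (hlt : ∀ r ∈ Ico (0 : ℝ) 1, -(f₀ ((-r : ℝ) : ℂ)).re < L)
    (hL : Tendsto (fun r : ℝ => -(f₀ ((-r : ℝ) : ℂ)).re) (𝓝[<] 1) (𝓝 L))
    (hL' : Tendsto (fun t : ℝ => f₀ (-(t : ℂ))) (𝓝[<] (1 : ℝ)) (𝓝 (-(L : ℂ)))) :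
    boundaryDist f₀ = L := by
  have hf := h.isMaMindaConvex
  have hi := hf.injOn hψ
  refine le_antisymm ?_ (hf.le_boundaryDist hψ h hL)
  have hmem : (-(L : ℂ)) ∈ frontier (f₀ '' unitDisk) := by
    rw [(isOpen_image_unitDisk h.normalized.holo hi).frontier_eq]
    refine ⟨mem_closure_of_tendsto hL' ?_, ?_⟩
    · filter_upwards [Ioo_mem_nhdsLT (zero_lt_one' ℝ)] with t ht
      refine mem_image_of_mem _ ?_
      have := ofReal_mem_unitDisk_of_mem_Ioo (neg_mem_Ioo_of_mem_Ico (Ioo_subset_Ico_self ht))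
      rwa [Complex.ofReal_neg] at this
    · rintro ⟨x, hx, hxL⟩
      have hconj : f₀ ((starRingEnd ℂ) x) = f₀ x := by
        rw [h.conj_apply hψ hx, hxL]; simp
      have hxr : x = (x.re : ℂ) :=
        (Complex.conj_eq_iff_re.1 (hi (conj_mem_unitDisk hx) hx hconj)).symm
      have hxI : x.re ∈ Ioo (-1 : ℝ) 1 :=
        abs_lt.1 ((Complex.abs_re_le_norm x).trans_lt (mem_unitDisk.1 hx))
      rw [hxr] at hxL
      have hre : (f₀ (x.re : ℂ)).re = -L := by rw [hxL]; simp
      rcases le_or_gt x.re 0 with hneg | hpos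
      · have := hlt (-x.re) ⟨by linarith, by linarith [hxI.1]⟩
        rw [neg_neg, hre] at this
        linarith
      · have := h.strictMonoOn hψ (a := 0) (by simp) hxI hpos
        simp only [Complex.ofReal_zero, h.normalized.zero, Complex.zero_re, hre] at this
        linarith
  rw [boundaryDist]
  refine (infDist_le_dist_of_mem hmem).trans_eq ?_
  rw [h.normalized.zero, dist_zero_left, norm_neg, Complex.norm_real, Real.norm_of_nonneg hL0.le]

end Growth

/-! ### Harmonic mappings and Bohr sums -/

section Harmonic

variable {f g f₁ g₁ w ψ f₀ : ℂ → ℂ} {r : ℝ}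

/-- The analytic and co-analytic parts of a harmonic function are determined by it. -/
theorem eqOn_of_add_conj_eq {F G : ℂ → ℂ} (hf : DifferentiableOn ℂ f unitDisk)
    (hg : DifferentiableOn ℂ g unitDisk) (hF : DifferentiableOn ℂ F unitDisk)
    (hG : DifferentiableOn ℂ G unitDisk) (hf0 : f 0 = F 0) (hg0 : g 0 = G 0)
    (h : ∀ z ∈ unitDisk, f z + (starRingEnd ℂ) (g z) = F z + (starRingEnd ℂ) (G z)) :
    EqOn f F unitDisk ∧ EqOn g G unitDisk := by
  have hconn : IsConnected unitDisk := ⟨⟨0, zero_mem_unitDisk⟩, isPreconnected_unitDisk⟩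
  -- Since f - F is the conjugate of G - g, their sum is real and their difference imaginary;
  -- analytic functions of either kind are constant.
  have a1 : AnalyticOnNhd ℂ (fun z => (f z - F z) + (G z - g z)) unitDisk :=
    ((hf.fun_sub hF).fun_add (hG.fun_sub hg)).analyticOnNhd isOpen_unitDisk
  have a2 : AnalyticOnNhd ℂ (fun z => (f z - F z) - (G z - g z)) unitDisk :=
    ((hf.fun_sub hF).fun_sub (hG.fun_sub hg)).analyticOnNhd isOpen_unitDisk
  have e : ∀ z ∈ unitDisk, f z - F z = (starRingEnd ℂ) (G z - g z) := fun z hz => by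
    rw [map_sub]; linear_combination h z hz
  obtain ⟨c1, hc1⟩ := a1.eq_const_of_im_eq_const (c₀ := 0)
    (fun z hz => by rw [e z hz, Complex.add_im, Complex.conj_im]; ring) isOpen_unitDisk hconn
  obtain ⟨c2, hc2⟩ := a2.eq_const_of_re_eq_const (c₀ := 0)
    (fun z hz => by rw [e z hz, Complex.sub_re, Complex.conj_re]; ring) isOpen_unitDisk hconn
  have h1 : c1 = 0 := by rw [← hc1 0 zero_mem_unitDisk, hf0, hg0]; ring
  have h2 : c2 = 0 := by rw [← hc2 0 zero_mem_unitDisk, hf0, hg0]; ring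
  refine ⟨fun z hz => ?_, fun z hz => ?_⟩
  · linear_combination (hc1 z hz + hc2 z hz + h1 + h2) / 2
  · linear_combination (hc2 z hz - hc1 z hz + h2 - h1) / 2

theorem bohrSum_eq (hf : DifferentiableOn ℂ f unitDisk) (hg : DifferentiableOn ℂ g unitDisk)
    (hf0 : f 0 = 0) (hg0 : g 0 = 0) (h0 : 0 ≤ r) (h1 : r < 1) :
    Summable (fun m : ℕ => bohrTerm f g r (m + 1)) ∧
      bohrSum f g r = majorant f r + majorant g r := by
  have sf := summable_taylorCoeff hf h0 h1
  have sg := summable_taylorCoeff hg h0 h1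
  have sf1 := (summable_nat_add_iff 1).2 sf
  have sg1 := (summable_nat_add_iff 1).2 sg
  have e : (fun m : ℕ => bohrTerm f g r (m + 1)) = fun m =>
      ‖taylorCoeff f (m + 1)‖ * r ^ (m + 1) + ‖taylorCoeff g (m + 1)‖ * r ^ (m + 1) := by
    ext m; rw [bohrTerm, add_mul]
  refine ⟨by rw [e]; exact sf1.add sg1, ?_⟩
  rw [bohrSum, e, sf1.tsum_add sg1, majorant, majorant, sf.tsum_eq_zero_add, sg.tsum_eq_zero_add,
    taylorCoeff_zero, taylorCoeff_zero, hf0, hg0]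
  simp

/-- If `|g'/f'| ≤ k` then `ĝ(r) ≤ k f̂(r)` for `r ≤ 1/3`. -/
theorem majorant_le_of_dilatation {k : ℝ} (hf : DifferentiableOn ℂ f unitDisk)
    (hg : DifferentiableOn ℂ g unitDisk) (hg0 : g 0 = 0) (hne : ∀ z ∈ unitDisk, deriv f z ≠ 0)
    (hk : ∀ z ∈ unitDisk, ‖deriv g z / deriv f z‖ ≤ k) (h0 : 0 ≤ r) (h1 : r ≤ 1 / 3) :
    majorant g r ≤ k * majorant f r := by
  have hr1 : r < 1 := by linarith
  have df := hf.deriv isOpen_unitDisk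
  have dg := hg.deriv isOpen_unitDisk
  have hμ : DifferentiableOn ℂ (fun z => deriv g z / deriv f z) unitDisk := dg.fun_div df hne
  have hk0 : 0 ≤ k := (norm_nonneg _).trans (hk 0 zero_mem_unitDisk)
  rw [majorant_eq_integral hf h0 hr1, majorant_eq_integral hg h0 hr1, hg0, norm_zero, zero_add,
    mul_add, ← intervalIntegral.integral_const_mul]
  refine le_add_of_nonneg_of_le (by positivity) ?_
  refine intervalIntegral.integral_mono_on h0 (intervalIntegrable_majorant dg h0 hr1)
    ((intervalIntegrable_majorant df h0 hr1).const_mul k) fun u hu => ?_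
  have hu1 : u < 1 := by linarith [hu.2]
  rw [majorant_congr (g := fun z => deriv g z / deriv f z * deriv f z)
    (fun z hz => by have := hne z hz; field_simp)]
  refine (majorant_mul_le hμ df hu.1 hu1).trans ?_
  have := majorant_nonneg (f := deriv f) hu.1
  gcongr
  exact majorant_le_of_bounded hμ hk hu.1 (hu.2.trans h1)

/-- Compare the coefficients of z in z f₀'' = (ψ - 1) f₀'. -/
theorem IsConvexExtremal.norm_taylorCoeff_deriv_one (hψ : IsMaMinda ψ)
    (h : IsConvexExtremal ψ f₀) : ‖taylorCoeff (deriv f₀) 1‖ = (deriv ψ 0).re := by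
  have hG := h.normalized.holo.deriv isOpen_unitDisk
  have e1 := taylorCoeff_id_mul_succ (hG.deriv isOpen_unitDisk) 0
  have hanti : Finset.HasAntidiagonal.antidiagonal 1 = {((0 : ℕ), 1), (1, 0)} := rfl
  rw [taylorCoeff_congr (g := fun z => (ψ z - 1) * deriv f₀ z)
    (fun z hz => h.mul_deriv_deriv hz), taylorCoeff_mul hψ.sub_one_holo hG, zero_add, hanti,
    Finset.sum_pair (by simp)] at e1
  simp only [taylorCoeff_zero, taylorCoeff_one, hψ.at_zero, sub_self, zero_mul, zero_add,
    h.normalized.deriv_zero, mul_one, deriv_sub_const] at e1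
  rw [taylorCoeff_one, ← e1, hψ.deriv_zero_eq, Complex.norm_real,
    Real.norm_of_nonneg hψ.deriv_re_pos.le, Complex.ofReal_re]

/-- Comparison of the majorant of a function in `𝒞(ψ)` with that of the extremal function. -/
theorem IsMaMindaConvex.majorant_le (hψ : IsMaMinda ψ) (h : IsConvexExtremal ψ f₀)
    (hf : IsMaMindaConvex ψ f) (h0 : 0 ≤ r) (h1 : r ≤ 1 / 3) : majorant f r ≤ majorant f₀ r := by
  obtain ⟨w, hw, hwe⟩ := hf.subord
  exact majorant_le_majorant hψ.sub_one_holo hψ.deriv_re_pos.le hψ.deriv_re_le_two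
    hψ.norm_taylorCoeff_sub_one_le hw h.normalized h.deriv_ne (fun z hz => h.mul_deriv_deriv hz)
    (h.norm_taylorCoeff_deriv_one hψ) hf.normalized
    (fun z hz => mul_deriv_deriv_eq (hf.deriv_ne z hz) (hwe z hz)) h0 h1

theorem bohrSum_le (hψ : IsMaMinda ψ) (h : IsConvexExtremal ψ f₀) {k : ℝ}
    (hf : IsMaMindaConvex ψ f) (hg : DifferentiableOn ℂ g unitDisk) (hg0 : g 0 = 0)
    (hk : ∀ z ∈ unitDisk, ‖deriv g z / deriv f z‖ ≤ k)
    (hf₁ : DifferentiableOn ℂ f₁ unitDisk) (hg₁ : DifferentiableOn ℂ g₁ unitDisk)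
    (hf₁0 : f₁ 0 = 0) (hg₁0 : g₁ 0 = 0)
    (hs : Subordinate (harmonicMap f₁ g₁) (harmonicMap f g)) (h0 : 0 ≤ r) (h1 : r ≤ 1 / 3) :
    bohrSum f₁ g₁ r ≤ (1 + k) * majorant f₀ r := by
  obtain ⟨w, hw, hwe⟩ := hs
  have hfh := hf.normalized.holo
  obtain ⟨e1, e2⟩ := eqOn_of_add_conj_eq hf₁ hg₁ (hw.comp_holo hfh) (hw.comp_holo hg)
    (by rw [hf₁0, hw.zero, hf.normalized.zero]) (by rw [hg₁0, hw.zero, hg0]) hwe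
  rw [(bohrSum_eq hf₁ hg₁ hf₁0 hg₁0 h0 (by linarith)).2, majorant_congr e1, majorant_congr e2]
  have k1 := majorant_comp_le hfh hw h0 h1
  have k2 := majorant_comp_le hg hw h0 h1
  have k3 := majorant_le_of_dilatation hfh hg hg0 hf.deriv_ne hk h0 h1
  have k4 := hf.majorant_le hψ h h0 h1
  have hk0 : 0 ≤ k := (norm_nonneg _).trans (hk 0 zero_mem_unitDisk)
  nlinarith

/-- The first two terms r + (ψ'(0)/2) r² already exceed 1 as r tends to 1. Because L ≤ 1 ≤ 2K/(K+1),
this pushes the left side of the root equation past L inside (0, 1). -/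
theorem IsConvexExtremal.exists_one_lt_majorant (hψ : IsMaMinda ψ) (h : IsConvexExtremal ψ f₀) :
    ∃ r ∈ Ioo (0 : ℝ) 1, 1 < majorant f₀ r := by
  have hp := hψ.deriv_re_pos
  have ht : Tendsto (fun r : ℝ => r + (deriv ψ 0).re / 2 * r ^ 2) (𝓝[<] 1)
      (𝓝 (1 + (deriv ψ 0).re / 2 * 1 ^ 2)) :=
    (Continuous.tendsto (by fun_prop) 1).mono_left nhdsWithin_le_nhds
  obtain ⟨r, hr, hrI⟩ := ((ht.eventually (lt_mem_nhds (by linarith :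
    (1 : ℝ) < 1 + (deriv ψ 0).re / 2 * 1 ^ 2))).and (Ioo_mem_nhdsLT (zero_lt_one' ℝ))).exists
  refine ⟨r, hrI, hr.trans_le ?_⟩
  have hsum := (summable_taylorCoeff h.normalized.holo hrI.1.le hrI.2).sum_le_tsum
    (Finset.range 3) (fun _ _ => by have := hrI.1.le; positivity)
  have h2 := h.norm_taylorCoeff_deriv_one hψ
  rw [taylorCoeff_deriv, norm_mul] at h2
  norm_num at h2
  rw [Finset.sum_range_succ, Finset.sum_range_succ, Finset.sum_range_one, taylorCoeff_zero,
    taylorCoeff_one, h.normalized.zero, h.normalized.deriv_zero] at hsum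
  rw [← h2, majorant]
  norm_num at hsum ⊢
  linarith

theorem IsConvexExtremal.exists_root (hψ : IsMaMinda ψ) (h : IsConvexExtremal ψ f₀) {c L : ℝ}
    (hc : 1 ≤ c) (hL0 : 0 < L) (hL1 : L ≤ 1) :
    ∃ r₀ : ℝ, (r₀ ∈ Ioo (0 : ℝ) 1 ∧ c * majorant f₀ r₀ = L) ∧
      ∀ s ∈ Ioo (0 : ℝ) 1, c * majorant f₀ s = L → s = r₀ := by
  have hm : ∀ {a b : ℝ}, 0 ≤ a → a < b → b < 1 → majorant f₀ a < majorant f₀ b :=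
    majorant_strictMono h.normalized.holo (by rw [h.normalized.deriv_zero]; exact one_ne_zero)
  obtain ⟨t, ht, ht1⟩ := h.exists_one_lt_majorant hψ
  have hcont : ContinuousOn (fun r => c * majorant f₀ r) (Icc 0 t) :=
    continuousOn_const.mul ((continuousOn_majorant h.normalized.holo).mono
      fun x hx => ⟨hx.1, hx.2.trans_lt ht.2⟩)
  obtain ⟨r₀, hr₀, he⟩ := intermediate_value_Ioo ht.1.le hcont (show L ∈ Ioo _ _ from
    ⟨by simp [majorant_zero, h.normalized.zero, hL0], by nlinarith⟩)
  have hr₀' : r₀ ∈ Ioo (0 : ℝ) 1 := ⟨hr₀.1, hr₀.2.trans ht.2⟩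
  refine ⟨r₀, ⟨hr₀', he⟩, fun s hs hsL => ?_⟩
  have heq : majorant f₀ s = majorant f₀ r₀ :=
    mul_left_cancel₀ (by linarith : c ≠ 0) (hsL.trans he.symm)
  rcases lt_trichotomy s r₀ with hlt | rfl | hlt
  · exact absurd heq (hm hs.1.le hlt hr₀'.2).ne
  · rfl
  · exact absurd heq (hm hr₀'.1.le hlt hs.2).ne'

/-- `f + k conj f` is an embedding when `f` is univalent and `0 ≤ k < 1`. -/
theorem isEmbedding_add_conj {k : ℝ} (hk0 : 0 ≤ k) (hk1 : k < 1)
    (hf : DifferentiableOn ℂ f unitDisk) (hi : InjOn f unitDisk) :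
    IsEmbedding (unitDisk.domRestrict (harmonicMap f fun z => (k : ℂ) * f z)) := by
  have hemb : IsEmbedding (unitDisk.domRestrict f) := by
    refine (IsOpenEmbedding.of_continuous_injective_isOpenMap
      (continuousOn_iff_continuous_domRestrict.1 hf.continuousOn) ?_ ?_).isEmbedding
    · exact fun a b hab => Subtype.ext (hi a.2 b.2 hab)
    · refine IsOpenMap.of_nhds_le fun a => ?_
      intro V hV
      rw [mem_map, mem_nhds_subtype] at hV
      obtain ⟨u, hu, hsub⟩ := hV
      refine mem_of_superset (image_mem_nhds_of_injOn hf hi a.2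
        (inter_mem hu (unitDisk_mem_nhds a.2))) ?_
      rintro _ ⟨x, hx, rfl⟩
      exact hsub (show (⟨x, hx.2⟩ : unitDisk) ∈ _ from hx.1)
  -- The map factors as f followed by a real-linear isomorphism of the plane, invertible because k²
  -- < 1.
  let T : ℂ → ℂ := fun ζ => ζ + (starRingEnd ℂ) ((k : ℂ) * ζ)
  have hT : IsEmbedding T := by
    refine Function.LeftInverse.isEmbedding
      (f := fun ζ => (ζ - k * (starRingEnd ℂ) ζ) / (1 - (k : ℂ) ^ 2)) (fun ζ => ?_)
      (((continuous_id.sub (continuous_const.mul Complex.continuous_conj)).div_const _))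
      (continuous_id.add (Complex.continuous_conj.comp (continuous_const.mul continuous_id)))
    have hk : (1 - (k : ℂ) ^ 2) ≠ 0 := by
      have : (1 - k ^ 2 : ℝ) ≠ 0 := by nlinarith
      exact_mod_cast this
    simp only [T, map_add, map_mul, Complex.conj_conj, Complex.conj_ofReal]
    field_simp
    ring
  exact hT.comp hemb

theorem IsConvexExtremal.isQuasiconformalHarmonic (hψ : IsMaMinda ψ) (h : IsConvexExtremal ψ f₀)
    {K : ℝ} (hK : 1 ≤ K) :
    IsQuasiconformalHarmonic K f₀ (fun z => (((K - 1) / (K + 1) : ℝ) : ℂ) * f₀ z) := by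
  have hK1 : 0 < K + 1 := by linarith
  have hk0 : 0 ≤ (K - 1) / (K + 1) := div_nonneg (by linarith) hK1.le
  have hk1 : (K - 1) / (K + 1) < 1 := by rw [div_lt_one hK1]; linarith
  have hd := h.normalized.holo
  have hder : ∀ z ∈ unitDisk, deriv (fun z => (((K - 1) / (K + 1) : ℝ) : ℂ) * f₀ z) z =
      (((K - 1) / (K + 1) : ℝ) : ℂ) * deriv f₀ z := fun z hz =>
    deriv_const_mul _ (hd.differentiableAt (unitDisk_mem_nhds hz))
  refine ⟨hd, hd.const_mul _, by simp [h.normalized.zero],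
    isEmbedding_add_conj hk0 hk1 hd (h.isMaMindaConvex.injOn hψ), fun z hz => ?_, fun z hz => ?_⟩
  · rw [hder z hz, norm_mul, Complex.norm_real, Real.norm_of_nonneg hk0]
    have := norm_pos_iff.2 (h.deriv_ne z hz)
    have h2 : 0 < ‖deriv f₀ z‖ ^ 2 := by positivity
    have h3 : ((K - 1) / (K + 1)) ^ 2 < 1 := by nlinarith
    rw [mul_pow]
    nlinarith
  · rw [hder z hz, mul_div_cancel_right₀ _ (h.deriv_ne z hz), Complex.norm_real,
      Real.norm_of_nonneg hk0]

end Harmonic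

/-! ### Assembly of the inequality and its sharpness -/

theorem mainTheorem3 (ψ : ℂ → ℂ) (hψ : IsMaMinda ψ) :
    -- the solution `f₀`, unique on the disk, and the number `L = -f₀(-1)` (radial limit)
    ∃ f₀ : ℂ → ℂ, IsConvexExtremal ψ f₀ ∧
      (∀ F : ℂ → ℂ, IsConvexExtremal ψ F → EqOn F f₀ unitDisk) ∧
    ∃ L : ℝ, 0 < L ∧
      Tendsto (fun t : ℝ => f₀ (-(t : ℂ))) (𝓝[<] (1 : ℝ)) (𝓝 (-(L : ℂ))) ∧
    ∀ K : ℝ, 1 ≤ K →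
    -- the unique root `r₀`
    ∃ r₀ : ℝ, (r₀ ∈ Ioo (0 : ℝ) 1 ∧ 2 * K / (K + 1) * majorant f₀ r₀ = L) ∧
      (∀ s ∈ Ioo (0 : ℝ) 1, 2 * K / (K + 1) * majorant f₀ s = L → s = r₀) ∧
      -- the Bohr inequality
      (∀ f g f₁ g₁ : ℂ → ℂ,
        IsMaMindaConvex ψ f → IsQuasiconformalHarmonic K f g →
        DifferentiableOn ℂ f₁ unitDisk → DifferentiableOn ℂ g₁ unitDisk →
        f₁ 0 = 0 → g₁ 0 = 0 →
        Subordinate (harmonicMap f₁ g₁) (harmonicMap f g) →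
        ∀ r : ℝ, 0 ≤ r → r ≤ min r₀ (1 / 3) →
          Summable (fun m : ℕ => bohrTerm f₁ g₁ r (m + 1)) ∧
          bohrSum f₁ g₁ r ≤ boundaryDist f) ∧
      -- sharpness for `p = f₀ + k conj f₀`, `k = (K-1)/(K+1)`
      ((∀ n : ℕ, taylorCoeff f₀ n = (‖taylorCoeff f₀ n‖ : ℂ)) → min r₀ (1 / 3) = r₀ →
        ∀ g₀ : ℂ → ℂ, g₀ = (fun z => (((K - 1) / (K + 1) : ℝ) : ℂ) * f₀ z) →
          IsMaMindaConvex ψ f₀ ∧ IsQuasiconformalHarmonic K f₀ g₀ ∧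
          bohrSum f₀ g₀ r₀ = boundaryDist f₀ ∧
          ∀ r : ℝ, r₀ < r → r < 1 →
            Summable (fun m : ℕ => bohrTerm f₀ g₀ r (m + 1)) ∧
            boundaryDist f₀ < bohrSum f₀ g₀ r) := by
  obtain ⟨f₀, h⟩ := hψ.exists_convexExtremal
  obtain ⟨L, hL0, hL1, hlt, hlim, hlim'⟩ := h.exists_limit hψ
  refine ⟨f₀, h, fun F hF => hF.eqOn h, L, hL0, hlim', fun K hK => ?_⟩
  have hK1 : 0 < K + 1 := by linarith
  have hc : 1 ≤ 2 * K / (K + 1) := by rw [le_div_iff₀ hK1]; linarith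
  have hck : 1 + (K - 1) / (K + 1) = 2 * K / (K + 1) := by field_simp; ring
  obtain ⟨r₀, ⟨hr₀, hroot⟩, huniq⟩ := h.exists_root hψ hc hL0 hL1
  have hfd := h.normalized.holo
  refine ⟨r₀, ⟨hr₀, hroot⟩, huniq, ?_, ?_⟩
  · intro f g f₁ g₁ hf hfg hf₁ hg₁ hf₁0 hg₁0 hs r h0 hr
    have hr3 : r ≤ 1 / 3 := hr.trans (min_le_right _ _)
    have hrr : r ≤ r₀ := hr.trans (min_le_left _ _)
    refine ⟨(bohrSum_eq hf₁ hg₁ hf₁0 hg₁0 h0 (by linarith)).1, ?_⟩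
    calc bohrSum f₁ g₁ r ≤ (1 + (K - 1) / (K + 1)) * majorant f₀ r :=
          bohrSum_le hψ h hf hfg.holo_g hfg.g_zero hfg.dilatation_le hf₁ hg₁ hf₁0 hg₁0 hs h0 hr3
      _ ≤ 2 * K / (K + 1) * majorant f₀ r₀ := by
          rw [hck]
          exact mul_le_mul_of_nonneg_left (majorant_mono hfd h0 hrr hr₀.2) (by linarith)
      _ = L := hroot
      _ ≤ boundaryDist f := hf.le_boundaryDist hψ h hlim
  · rintro - - g₀ rfl
    have hk0 : 0 ≤ (K - 1) / (K + 1) := div_nonneg (by linarith) hK1.le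
    -- For p the Bohr sum is an exact multiple of f̂₀(r) on all of [0, 1), so equality at r₀ and
    -- failure beyond it follow from the root equation and strict monotonicity.
    have hsum : ∀ r : ℝ, 0 ≤ r → r < 1 →
        Summable (fun m : ℕ => bohrTerm f₀ (fun z => (((K - 1) / (K + 1) : ℝ) : ℂ) * f₀ z) r (m + 1)) ∧
        bohrSum f₀ (fun z => (((K - 1) / (K + 1) : ℝ) : ℂ) * f₀ z) r =
          2 * K / (K + 1) * majorant f₀ r := fun r h0 h1 => by
      have := bohrSum_eq hfd (hfd.const_mul (((K - 1) / (K + 1) : ℝ) : ℂ)) h.normalized.zero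
        (by simp [h.normalized.zero]) h0 h1
      refine ⟨this.1, this.2.trans ?_⟩
      rw [majorant_const_mul _ hfd, Complex.norm_real, Real.norm_of_nonneg hk0, ← hck]
      ring
    have hdist := h.boundaryDist_eq hψ hL0 hlt hlim hlim'
    refine ⟨h.isMaMindaConvex, h.isQuasiconformalHarmonic hψ hK, ?_, fun r hr hr1 => ?_⟩
    · rw [(hsum r₀ hr₀.1.le hr₀.2).2, hroot, hdist]
    · have hr0 : 0 ≤ r := hr₀.1.le.trans hr.le
      refine ⟨(hsum r hr0 hr1).1, ?_⟩
      rw [(hsum r hr0 hr1).2, hdist, ← hroot]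
      exact mul_lt_mul_of_pos_left (majorant_strictMono hfd
        (by rw [h.normalized.deriv_zero]; exact one_ne_zero) hr₀.1.le hr hr1) (by linarith)
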